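/- **Types.** Fix a set of constants $c$, a set of basic types $b$, a set $\mathbb B(b)$ of constants for each $b$, and for each $c$ a basic type $b_c$ with $c\in\mathbb B(b_c)$. Types are the terms generated coinductively by $t ::= b \mid \alpha \mid \boldsymbol\alpha \mid t\to t\mid t\times t\mid t\vee t\mid \neg t\mid \mathbb 0$ ($\alpha$ polymorphic and $\boldsymbol\alpha$ monomorphic type variables, two disjoint countably infinite sets) that have finitely many different sub-terms and in which every infinite branch contains infinitely many $\to$ or $\times$. Put $\mathbb 1=\neg\mathbb 0$, $s\wedge t=\neg(\neg s\vee\neg t)$. Let $\mathcal D$ be the set of finite terms $d::=c^L\mid(d,d)^L\mid\{(d,\partial),\dots,(d,\partial)\}^L$, $\partial::=d\mid\Omega$, with $L$ a finite set of type variables. Membership of $d$ in $t$ is Boolean on $\vee,\neg,\mathbb 0$; $d$ is in a variable iff the variable is in its outermost label $L$; $c^L\in b$ iff $c\in\mathbb B(b)$; $(d_1,d_2)^L\in t_1\times t_2$ iff $d_i\in t_i$ ($i=1,2$); $R^L\in t_1\to t_2$ iff $d\in t_1$ implies $\Omega\neq\partial\in t_2$ for all $(d,\partial)\in R$; no other memberships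 hold. Then $s\le t$ means that every element of $s$ is in $t$, and $s\simeq t$ means $s\le t\le s$. Letters $u$ denote monomorphic types (no polymorphic variable), $\tau$ test types (no type variables, all arrows of the form $\mathbb 0\to\mathbb 1$), $\sigma$ substitutions of types for polymorphic variables, $\rho$ injective renamings of polymorphic variables, $\Sigma$ finite sets of substitutions $\sigma$; $t\Sigma=\bigwedge_{\sigma\in\Sigma}t\sigma$; and $t'\sqsubseteq t$ means $t'\Sigma\le t$ for some $\Sigma$. **Declarative system.** Source expressions, up to $\alpha$-equivalence, are $e::=c\mid x\mid\lambda x.e\mid e\,e\mid(e,e)\mid\pi_1e\mid\pi_2e\mid(e{\in}\tau)\,?\,e:e$. Environments $\Gamma$ are partial maps from variables to types. $\Gamma\vdash e:t$ is generated by: $c:b_c$; $x:\Gamma(x)$; $\lambda x.e:u\to t$ if $\Gamma,x:u\vdash e:t$; $e_1e_2:t_2$ if $e_1:t_1\to t_2$ and $e_2:t_1$; $(e_1,e_2):t_1\times t_2$ if $e_i:t_i$; $\pi_ie:t_i$ if $e:t_1\times t_2$; $(e{\in}\tau)?e_1{:}e_2$ has type $\mathbb 0$ if $e:\mathbb 0$,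 type $t_1$ if $e:\tau$ and $e_1:t_1$, type $t_2$ if $e:\neg\tau$ and $e_2:t_2$; $e\{e'/x\}:t$ if $\Gamma\vdash e':s$, $\Gamma,x:s\wedge u\vdash e:t$ and $\Gamma,x:s\wedge\neg u\vdash e:t$; $e:t_1\wedge t_2$ if $e:t_1$ and $e:t_2$; $e:t\sigma$ if $e:t$; $e:t'$ if $e:t$ and $t\le t'$. **MSC-forms.** Atoms and canonical forms, up to $\alpha$-equivalence, are $a::=c\mid x\mid\lambda x.\kappa\mid(\mathsf x,\mathsf x)\mid\mathsf x\,\mathsf x\mid\pi_i\mathsf x\mid(\mathsf x{\in}\tau)?\mathsf x{:}\mathsf x$ and $\kappa::=\mathsf x\mid\mathsf{bind}\ \mathsf x=a\ \mathsf{in}\ \kappa$, with binding variables $\mathsf x$ distinct from the lambda variables $x$. The unwinding $\lceil\kappa\rceil$ of a canonical form without free binding variables is the source expression obtained by inlining all bindings. $\equiv$ is the least congruence with $\mathsf{bind}\ \mathsf x_1=a_1\ \mathsf{in\ bind}\ \mathsf x_2=a_2\ \mathsf{in}\ \kappa\equiv\mathsf{bind}\ \mathsf x_2=a_2\ \mathsf{in\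 bind}\ \mathsf x_1=a_1\ \mathsf{in}\ \kappa$ for $\mathsf x_1\notin\mathrm{fv}(a_2)$, $\mathsf x_2\notin\mathrm{fv}(a_1)$. An MSC-form is a canonical form such that, when all its binders have different names: (1) bindings at distinct places define atoms $a_1\not\equiv a_2$; (2) if $\mathsf{bind}\ \mathsf y=a\ \mathsf{in}\ \kappa_2$ occurs in the body of a sub-expression $\lambda x.\kappa_1$, then $\mathrm{fv}(a)\not\subseteq\mathrm{fv}(\lambda x.\kappa_1)$; (3) if $\mathsf{bind}\ \mathsf x=a\ \mathsf{in}\ \kappa'$ occurs, then $\mathsf x\in\mathrm{fv}(\kappa')$. An MSC-form of $e$ is an MSC-form without free binding variables that unwinds to $e$. **Algorithmic system.** Annotations are the trees $\mathbb a::=\varnothing\mid\lambda(u,\mathbb k)\mid(\rho,\rho)\mid @(\Sigma,\Sigma)\mid\pi(\Sigma)\mid\mathbb 0(\Sigma)\mid{\in}_1(\Sigma)\mid{\in}_2(\Sigma)\mid\bigwedge\{\mathbb a,\dots,\mathbb a\}$ for atoms and $\mathbb k::=\rho\mid\mathsf{keep}(\mathbb a,\{(u,\mathbb k),\dots,(u,\mathbb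 k)\})\mid\mathsf{skip}\,\mathbb k\mid\bigwedge\{\mathbb k,\dots,\mathbb k\}$ for forms. $\Gamma\vdash_A[\kappa\mid\mathbb k]:t$ and $\Gamma\vdash_A[a\mid\mathbb a]:t$ are generated by: - $[c\mid\varnothing]:b_c$; $[x\mid\varnothing]:\Gamma(x)$; $[\lambda x.\kappa\mid\lambda(u,\mathbb k)]:u\to t$ if $\Gamma,x:u\vdash_A[\kappa\mid\mathbb k]:t$; - $[\mathsf x_1\mathsf x_2\mid @(\Sigma_1,\Sigma_2)]:\min\{r\mid t_1\le t_2\to r\}$ with $t_i=\Gamma(\mathsf x_i)\Sigma_i$, if $t_1\le\mathbb 0\to\mathbb 1$ and $t_2\le\max\{r\mid t_1\le r\to\mathbb 1\}$; - $[(\mathsf x_1,\mathsf x_2)\mid(\rho_1,\rho_2)]:\Gamma(\mathsf x_1)\rho_1\times\Gamma(\mathsf x_2)\rho_2$; - if $t=\Gamma(\mathsf x)\Sigma\le\mathbb 1\times\mathbb 1$: $[\pi_1\mathsf x\mid\pi(\Sigma)]:\min\{r\mid t\le r\times\mathbb 1\}$ and $[\pi_2\mathsf x\mid\pi(\Sigma)]:\min\{r\mid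 t\le\mathbb 1\times r\}$; - $(\mathsf x{\in}\tau)?\mathsf x_1{:}\mathsf x_2$ has type $\mathbb 0$ with $\mathbb 0(\Sigma)$ if $\Gamma(\mathsf x)\Sigma\simeq\mathbb 0$, type $\Gamma(\mathsf x_1)$ with ${\in}_1(\Sigma)$ if $\Gamma(\mathsf x)\Sigma\le\tau$, type $\Gamma(\mathsf x_2)$ with ${\in}_2(\Sigma)$ if $\Gamma(\mathsf x)\Sigma\le\neg\tau$; - $[\mathsf x\mid\rho]:\Gamma(\mathsf x)\rho$; $[\mathsf{bind}\ \mathsf x=a\ \mathsf{in}\ \kappa\mid\mathsf{skip}\,\mathbb k]:t$ if $\mathsf x\notin\mathrm{dom}\,\Gamma$ and $\Gamma\vdash_A[\kappa\mid\mathbb k]:t$; - $[\mathsf{bind}\ \mathsf x=a\ \mathsf{in}\ \kappa\mid\mathsf{keep}(\mathbb a,\{(u_i,\mathbb k_i)\}_{i\in I})]:\bigvee_{i\in I} t_i$ if $\bigvee_{i\in I} u_i\simeq\mathbb 1$, $\Gamma\vdash_A[a\mid\mathbb a]:s$ and $\Gamma,\mathsf x:s\wedge u_i\vdash_A[\kappa\mid\mathbb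 k_i]:t_i$ for all $i\in I$; - for atoms and forms, annotation $\bigwedge\{\cdot\}_{i\in I}$ with $I\ne\emptyset$ gives $\bigwedge_{i\in I} t_i$ if the $i$-th annotation gives $t_i$ for all $i\in I$. Here $\min$ and $\max$ are taken with respect to $\le$ and are determined up to $\simeq$. **Theorem (Soundness and Completeness).** Every source expression $e$ has an MSC-form, unique up to $\equiv$. If $\kappa$ is an MSC-form of $e$, then: - (completeness) if $\varnothing\vdash e:t$, then $\varnothing\vdash_A[\kappa\mid\mathbb k]:t'$ for some form annotation $\mathbb k$ and some type $t'\le t$; more generally, for every environment $\Gamma$ for the lambda variables, if $\Gamma\vdash e:t$, then $\Gamma\vdash_A[\kappa\mid\mathbb k]:t'$ for some $\mathbb k$ and some $t'\sqsubseteq t$; - (soundness) for every environment $\Gamma$ for the lambda variables, in particular the empty one, if $\Gamma\vdash_A[\kappa\mid\mathbb k]:t$ for some form annotation $\mathbb k$, then $\Gamma\vdash e:t$. -/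

import Mathlib

namespace MSC

universe u

/-! ## Types -/

/-- Constants, basic types, the set `interp b` of constants of each basic type `b`, and the basic
type `basicOf c` of each constant `c`. -/
structure Signature where
  Const : Type u
  Basic : Type u
  interp : Basic → Set Const
  basicOf : Const → Basic
  mem_basicOf : ∀ c, c ∈ interp (basicOf c)

/-- Head constructors of types. Polymorphic and monomorphic type variables are two disjoint
countably infinite families. -/
inductive TyHead (B : Type u) : Type u
  | basic (b : B)
  | poly (n : ℕ)
  | mono (n : ℕ)
  | arrow
  | prod
  | union
  | neg
  | empty

/-- The positions of the immediate sub-terms. -/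
def TyHead.Pos {B : Type u} : TyHead B → Type
  | .basic _ => Fin 0
  | .poly _ => Fin 0
  | .mono _ => Fin 0
  | .arrow => Fin 2
  | .prod => Fin 2
  | .union => Fin 2
  | .neg => Fin 1
  | .empty => Fin 0

instance {B : Type u} (h : TyHead B) : Finite h.Pos := by
  cases h <;> (unfold TyHead.Pos; infer_instance)

/-- The signature functor of the type grammar. -/
def TyFunctor (B : Type u) : PFunctor.{u, 0} := ⟨TyHead B, TyHead.Pos⟩

/-- All finite and infinite terms generated coinductively by the type grammar. -/
abbrev Tree (B : Type u) : Type u := (TyFunctor B).M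

namespace Tree

variable {B : Type u}

/-- The head constructor of a term. -/
def hd (t : Tree B) : TyHead B := t.dest.1

/-- `s` is an immediate sub-term of `t`. -/
def IsChild (s t : Tree B) : Prop := ∃ i, t.dest.2 i = s

/-- `s` is a sub-term of `t` (possibly `t` itself). -/
def IsSubterm (s t : Tree B) : Prop := Relation.ReflTransGen IsChild s t

/-- Finitely many different sub-terms. -/
def Regular (t : Tree B) : Prop := {s | IsSubterm s t}.Finite

/-- Every infinite branch contains infinitely many arrow or product constructors. -/
def Contractive (t : Tree B) : Prop :=
  ∀ f : ℕ → Tree B, f 0 = t → (∀ n, IsChild (f (n + 1)) (f n)) →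
    ∀ N, ∃ n, N ≤ n ∧ ((f n).hd = .arrow ∨ (f n).hd = .prod)

/-- Immediate sub-term of a union or of a negation. -/
def Strip (s t : Tree B) : Prop := IsChild s t ∧ (t.hd = .union ∨ t.hd = .neg)

theorem IsSubterm.cases' {s t : Tree B} (h : IsSubterm s t) :
    s = t ∨ ∃ i, IsSubterm s (t.dest.2 i) := by
  rcases Relation.ReflTransGen.cases_tail h with h | ⟨c, h1, i, rfl⟩
  · exact Or.inl h.symm
  · exact Or.inr ⟨i, h1⟩

theorem Regular.of_children {t : Tree B} (h : ∀ i, Regular (t.dest.2 i)) : Regular t := by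
  have : Finite (TyFunctor B |>.B t.dest.1) := 
    inferInstanceAs (Finite (TyHead.Pos t.hd))
  refine ((Set.finite_singleton t).union (Set.finite_iUnion h)).subset ?_
  intro s hs
  rcases IsSubterm.cases' hs with h | ⟨i, h⟩
  · exact Or.inl h
  · exact Or.inr (Set.mem_iUnion.2 ⟨i, h⟩)

theorem Regular.sub {s t : Tree B} (h : Regular t) (hs : IsSubterm s t) : Regular s :=
  Set.Finite.subset h fun _ hr => Relation.ReflTransGen.trans hr hs

theorem Contractive.of_children {t : Tree B} (h : ∀ i, Contractive (t.dest.2 i)) :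
    Contractive t := by
  intro f h0 hf N
  obtain ⟨i, hi⟩ := hf 0
  subst h0
  obtain ⟨n, hn, h'⟩ := h i (fun n => f (n + 1)) hi.symm (fun n => hf (n + 1)) N
  exact ⟨n + 1, by omega, h'⟩

theorem Contractive.child {s t : Tree B} (h : Contractive t) (hs : IsChild s t) :
    Contractive s := by
  intro f h0 hf N
  obtain ⟨n, hn, h'⟩ := h (fun n => Nat.casesOn n t f) rfl
    (fun n => by cases n with
      | zero => simpa [h0] using hs
      | succ n => exact hf n) (N + 1)
  cases n with
  | zero => omega
  | succ n => exact ⟨n, by omega, h'⟩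

theorem Contractive.sub {s t : Tree B} (h : Contractive t) (hs : IsSubterm s t) :
    Contractive s := by
  induction hs using Relation.ReflTransGen.head_induction_on with
  | refl => exact h
  | head h1 _ ih => exact ih.child h1

theorem Contractive.acc {t : Tree B} (h : Contractive t) : Acc Strip t := by
  rw [acc_iff_isEmpty_descending_chain]
  refine ⟨fun ⟨f, h0, hf⟩ => ?_⟩
  obtain ⟨n, -, hn⟩ := h f h0 (fun n => (hf n).1) 0
  rcases (hf n).2 with h1 | h1 <;> rw [h1] at hn <;> simp at hn

theorem contractive_of_acc {t : Tree B} (h : ∀ s, IsSubterm s t → Acc Strip s) :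
    Contractive t := by
  intro f h0 hf N
  by_contra hN
  push Not at hN
  have hs : ∀ n, IsSubterm (f n) t := by
    intro n
    induction n with
    | zero => rw [h0]; exact Relation.ReflTransGen.refl
    | succ n ih => exact Relation.ReflTransGen.head (hf n) ih
  refine (acc_iff_isEmpty_descending_chain.1 (h _ (hs N))).false
    ⟨fun k => f (N + k), rfl, fun k => ⟨hf (N + k), ?_⟩⟩
  obtain ⟨i, -⟩ := hf (N + k)
  have h1 := hN (N + k) (by omega)
  change TyHead.Pos (f (N + k)).hd at i
  cases hh : (f (N + k)).hd <;> rw [hh] at i h1 <;>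
    first | exact i.elim0 | exact absurd rfl h1.1 | exact absurd rfl h1.2 | simp

/-- Simultaneous substitution of trees for polymorphic variables, by corecursion: a state `inl t`
is a part still to be substituted, a state `inr t` a part to be copied. -/
def substStep (σ : ℕ → Tree B) : Tree B ⊕ Tree B → (TyFunctor B) (Tree B ⊕ Tree B)
  | .inr t => (TyFunctor B).map Sum.inr t.dest
  | .inl t => match t.hd with
    | .poly n => (TyFunctor B).map Sum.inr (σ n).dest
    | _ => (TyFunctor B).map Sum.inl t.dest

/-- The term `t` in which every polymorphic variable `n` is replaced by `σ n`. -/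
def subst (σ : ℕ → Tree B) (t : Tree B) : Tree B := PFunctor.M.corec (substStep σ) (.inl t)

theorem corec_inr (σ : ℕ → Tree B) (t : Tree B) :
    PFunctor.M.corec (substStep σ) (.inr t) = t := by
  have h1 := PFunctor.M.corec_unique (P := TyFunctor B) (PFunctor.M.dest)
    (fun t => PFunctor.M.corec (substStep σ) (.inr t))
    (fun t => by rw [PFunctor.M.dest_corec]; rfl)
  have h2 := PFunctor.M.corec_unique (P := TyFunctor B) (PFunctor.M.dest) id (fun t => rfl)
  exact congrFun (h1.trans h2.symm) t

theorem subst_poly (σ : ℕ → Tree B) {t : Tree B} {n : ℕ} (h : t.hd = .poly n) :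
    subst σ t = σ n := by
  have : (subst σ t).dest = (σ n).dest := by
    rw [subst, PFunctor.M.dest_corec]
    simp only [substStep, h]
    rw [PFunctor.map_map]
    have : (PFunctor.M.corec (substStep σ) ∘ Sum.inr) = id := funext (corec_inr σ)
    rw [this]; rfl
  rw [← PFunctor.M.mk_dest (subst σ t), this, PFunctor.M.mk_dest]

theorem subst_dest (σ : ℕ → Tree B) {t : Tree B} (h : ∀ n, t.hd ≠ .poly n) :
    (subst σ t).dest = (TyFunctor B).map (subst σ) t.dest := by
  rw [subst, PFunctor.M.dest_corec]
  cases hh : t.hd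
  case poly n => exact absurd hh (h n)
  all_goals
    simp only [substStep, hh]
    rw [PFunctor.map_map]
    rfl

theorem subst_hd (σ : ℕ → Tree B) {t : Tree B} (h : ∀ n, t.hd ≠ .poly n) :
    (subst σ t).hd = t.hd := by
  rw [hd, subst_dest σ h]; rfl

theorem subst_child (σ : ℕ → Tree B) {s t : Tree B} (h : ∀ n, t.hd ≠ .poly n)
    (hs : IsChild s (subst σ t)) : ∃ u, IsChild u t ∧ s = subst σ u := by
  rw [IsChild, subst_dest σ h] at hs
  obtain ⟨i, rfl⟩ := hs
  exact ⟨t.dest.2 i, ⟨i, rfl⟩, rfl⟩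

theorem subst_subterm (σ : ℕ → Tree B) {s t : Tree B} (hs : IsSubterm s (subst σ t)) :
    (∃ u, IsSubterm u t ∧ s = subst σ u) ∨
      ∃ u, IsSubterm u t ∧ ∃ n, u.hd = .poly n ∧ IsSubterm s (σ n) := by
  induction hs using Relation.ReflTransGen.head_induction_on with
  | refl => exact Or.inl ⟨t, Relation.ReflTransGen.refl, rfl⟩
  | head h1 _ ih =>
    rcases ih with ⟨u, hu, rfl⟩ | ⟨u, hu, n, hn, h2⟩
    · by_cases hp : ∃ n, u.hd = .poly n
      · obtain ⟨n, hn⟩ := hp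
        rw [subst_poly σ hn] at h1
        exact Or.inr ⟨u, hu, n, hn, Relation.ReflTransGen.single h1⟩
      · push Not at hp
        obtain ⟨v, hv, rfl⟩ := subst_child σ hp h1
        exact Or.inl ⟨v, Relation.ReflTransGen.head hv hu, rfl⟩
    · exact Or.inr ⟨u, hu, n, hn, Relation.ReflTransGen.head h1 h2⟩

theorem Regular.subst {σ : ℕ → Tree B} (hσ : ∀ n, Regular (σ n)) {t : Tree B} (h : Regular t) :
    Regular (subst σ t) := by
  let g : Tree B → Set (Tree B) := fun u =>
    {Tree.subst σ u} ∪ {s | ∃ n, u.hd = .poly n ∧ IsSubterm s (σ n)}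
  have hg : ∀ u ∈ {s | IsSubterm s t}, (g u).Finite := by
    intro u _
    refine (Set.finite_singleton _).union ?_
    by_cases hp : ∃ n, u.hd = .poly n
    · obtain ⟨n, hn⟩ := hp
      refine (hσ n).subset ?_
      rintro s ⟨m, hm, hs⟩
      rw [hn] at hm
      cases hm
      exact hs
    · refine Set.finite_empty.subset ?_
      rintro s ⟨m, hm, _⟩
      exact hp ⟨m, hm⟩
  refine (Set.Finite.biUnion h hg).subset ?_
  intro s hs
  simp only [Set.mem_iUnion]
  rcases subst_subterm σ hs with ⟨u, hu, rfl⟩ | ⟨u, hu, h⟩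
  · exact ⟨u, hu, Or.inl rfl⟩
  · exact ⟨u, hu, Or.inr h⟩

theorem Contractive.subst {σ : ℕ → Tree B} (hσ : ∀ n, Contractive (σ n)) {t : Tree B}
    (h : Contractive t) : Contractive (subst σ t) := by
  refine contractive_of_acc fun s hs => ?_
  rcases subst_subterm σ hs with ⟨u, hu, rfl⟩ | ⟨u, hu, n, hn, h2⟩
  · have := (h.sub hu).acc
    clear hs hu h
    induction this with
    | intro u _ ih =>
      by_cases hp : ∃ n, u.hd = .poly n
      · obtain ⟨n, hn⟩ := hp
        rw [subst_poly σ hn]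
        exact (hσ n).acc
      · push Not at hp
        refine Acc.intro _ fun s hs => ?_
        obtain ⟨v, hv, rfl⟩ := subst_child σ hp hs.1
        exact ih v ⟨hv, by simpa only [subst_hd σ hp] using hs.2⟩
  · exact ((hσ n).sub h2).acc

end Tree

/-- The set of types: regular and contractive terms. -/
def Ty (S : Signature.{u}) : Type u := {t : Tree S.Basic // t.Regular ∧ t.Contractive}

namespace Ty

variable {S : Signature.{u}}

/-- The type with head `h` and immediate sub-terms `c`. -/
def node (h : TyHead S.Basic) (c : h.Pos → Ty S) : Ty S :=
  ⟨PFunctor.M.mk ⟨h, fun i => (c i).1⟩,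
    Tree.Regular.of_children (fun i => (c i).2.1),
    Tree.Contractive.of_children (fun i => (c i).2.2)⟩

def basic (b : S.Basic) : Ty S := node (.basic b) Fin.elim0
def poly (n : ℕ) : Ty S := node (.poly n) Fin.elim0
def mono (n : ℕ) : Ty S := node (.mono n) Fin.elim0
def arrow (s t : Ty S) : Ty S := node .arrow (fun i : Fin 2 => if i = 0 then s else t)
def prod (s t : Ty S) : Ty S := node .prod (fun i : Fin 2 => if i = 0 then s else t)
def union (s t : Ty S) : Ty S := node .union (fun i : Fin 2 => if i = 0 then s else t)
def neg (t : Ty S) : Ty S := node .neg (fun _ => t)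
def empty : Ty S := node .empty Fin.elim0
def any : Ty S := neg empty
def inter (s t : Ty S) : Ty S := neg (union (neg s) (neg t))

/-- Finite unions and intersections; the empty union is `empty`, the empty intersection `any`. -/
def bigUnion (l : List (Ty S)) : Ty S := l.foldr union empty
def bigInter (l : List (Ty S)) : Ty S := l.foldr inter any

/-- The `i`-th immediate sub-term. -/
def child (t : Ty S) (i : t.1.hd.Pos) : Ty S :=
  ⟨t.1.dest.2 i,
    t.2.1.sub (Relation.ReflTransGen.single ⟨i, rfl⟩), t.2.2.child ⟨i, rfl⟩⟩

/-- `s` is a sub-term of `t`. -/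
def IsSubterm (s t : Ty S) : Prop := Tree.IsSubterm s.1 t.1

/-- A monomorphic type: no polymorphic variable occurs in it. -/
def IsMono (t : Ty S) : Prop := ∀ n, ¬ IsSubterm (poly n) t

/-- A test type: a ground type in which every arrow type is `empty → any`. -/
def IsTest (t : Ty S) : Prop :=
  (∀ n, ¬ IsSubterm (poly n) t) ∧ (∀ n, ¬ IsSubterm (mono n) t) ∧
    ∀ s s', IsSubterm (arrow s s') t → s = empty ∧ s' = any

/-- Application of a substitution from polymorphic variables to types. -/
def subst (σ : ℕ → Ty S) (t : Ty S) : Ty S :=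
  ⟨t.1.subst fun n => (σ n).1, t.2.1.subst fun n => (σ n).2.1, t.2.2.subst fun n => (σ n).2.2⟩

/-- Top-level case analysis of a type. -/
inductive View (S : Signature.{u}) : Type u
  | basic (b : S.Basic)
  | poly (n : ℕ)
  | mono (n : ℕ)
  | arrow (s t : Ty S)
  | prod (s t : Ty S)
  | union (s t : Ty S)
  | neg (t : Ty S)
  | empty

def viewAux : (h : TyHead S.Basic) → (h.Pos → Ty S) → View S
  | .basic b, _ => .basic b
  | .poly n, _ => .poly n
  | .mono n, _ => .mono n
  | .arrow, c => .arrow (c (0 : Fin 2)) (c (1 : Fin 2))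
  | .prod, c => .prod (c (0 : Fin 2)) (c (1 : Fin 2))
  | .union, c => .union (c (0 : Fin 2)) (c (1 : Fin 2))
  | .neg, c => .neg (c (0 : Fin 1))
  | .empty, _ => .empty

def view (t : Ty S) : View S := viewAux t.1.hd t.child

/-- The well-founded relation from a union or a negation to its components. -/
def Strip (s t : Ty S) : Prop := Tree.Strip s.1 t.1

theorem wf_strip : WellFounded (Strip (S := S)) :=
  ⟨fun t => InvImage.accessible (fun t : Ty S => t.1) t.2.2.acc⟩

theorem strip_union {t a b : Ty S} (h : t.view = .union a b) : Strip a t ∧ Strip b t := by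
  unfold view at h
  generalize hc : t.child = c at h
  have key : ∀ i, Tree.IsChild (c i).1 t.1 := by subst hc; exact fun i => ⟨i, rfl⟩
  clear hc
  have hu : ∀ (k : TyHead S.Basic), t.1.hd = k → ∀ c : k.Pos → Ty S,
      (∀ i, Tree.IsChild (c i).1 t.1) → viewAux k c = .union a b → Strip a t ∧ Strip b t := by
    intro k hk c hc hv
    cases k <;> simp only [viewAux] at hv <;> cases hv
    exact ⟨⟨hc _, Or.inl hk⟩, ⟨hc _, Or.inl hk⟩⟩
  exact hu _ rfl c key h

theorem strip_neg {t a : Ty S} (h : t.view = .neg a) : Strip a t := by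
  unfold view at h
  generalize hc : t.child = c at h
  have key : ∀ i, Tree.IsChild (c i).1 t.1 := by subst hc; exact fun i => ⟨i, rfl⟩
  clear hc
  have hu : ∀ (k : TyHead S.Basic), t.1.hd = k → ∀ c : k.Pos → Ty S,
      (∀ i, Tree.IsChild (c i).1 t.1) → viewAux k c = .neg a → Strip a t := by
    intro k hk c hc hv
    cases k <;> simp only [viewAux] at hv <;> cases hv
    exact ⟨hc _, Or.inr hk⟩
  exact hu _ rfl c key h

/-- Evaluation of the Boolean structure of a type down to its top-level basic types, variables,
arrows and products, on which `atom` decides. -/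
def boolEval (atom : View S → Prop) : Ty S → Prop :=
  wf_strip.fix fun t rec =>
    match h : t.view with
    | .union a b => rec a (strip_union h).1 ∨ rec b (strip_union h).2
    | .neg a => ¬ rec a (strip_neg h)
    | .empty => False
    | v => atom v

end Ty

/-! ## Interpretation and subtyping -/

/-- Elements of the interpretation domain, labelled by finite sets of type variables (`inl` for
polymorphic, `inr` for monomorphic ones). An element `fn arg res bad L` is the finite relation
`{(arg i, res i)} ∪ {(bad j, Ω)}`. -/
inductive Dom (S : Signature.{u}) : Type u
  | const (c : S.Const) (L : Finset (ℕ ⊕ ℕ))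
  | pair (d₁ d₂ : Dom S) (L : Finset (ℕ ⊕ ℕ))
  | fn {m k : ℕ} (arg res : Fin m → Dom S) (bad : Fin k → Dom S) (L : Finset (ℕ ⊕ ℕ))

/-- The element `d` belongs to the type `t`; `Ω` belongs to no type. -/
def Dom.Mem {S : Signature.{u}} : Dom S → Ty S → Prop
  | .const c L => Ty.boolEval fun
    | .basic b => c ∈ S.interp b
    | .poly n => Sum.inl n ∈ L
    | .mono n => Sum.inr n ∈ L
    | _ => False
  | .pair d₁ d₂ L => Ty.boolEval fun
    | .prod t₁ t₂ => d₁.Mem t₁ ∧ d₂.Mem t₂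
    | .poly n => Sum.inl n ∈ L
    | .mono n => Sum.inr n ∈ L
    | _ => False
  | .fn arg res bad L => Ty.boolEval fun
    | .arrow t₁ t₂ => (∀ i, (arg i).Mem t₁ → (res i).Mem t₂) ∧ ∀ j, ¬ (bad j).Mem t₁
    | .poly n => Sum.inl n ∈ L
    | .mono n => Sum.inr n ∈ L
    | _ => False

namespace Ty

variable {S : Signature.{u}}

/-- Subtyping: inclusion of the interpretations. -/
def Sub (s t : Ty S) : Prop := ∀ d : Dom S, d.Mem s → d.Mem t

/-- Type equivalence. -/
def Equiv (s t : Ty S) : Prop := Sub s t ∧ Sub t s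

/-- `t Σ`, the intersection of the `t σ` for `σ ∈ Σ` (a finite set, given as a list). -/
def inst (t : Ty S) (θs : List (ℕ → Ty S)) : Ty S := bigInter (θs.map fun σ => t.subst σ)

/-- `t ρ` for a renaming `ρ` of polymorphic variables. -/
def rename (t : Ty S) (ρ : ℕ → ℕ) : Ty S := t.subst fun n => poly (ρ n)

/-- The polymorphic subtyping order: `s Σ ≤ t` for some finite set `Σ` of substitutions. -/
def PolySub (s t : Ty S) : Prop := ∃ θs : List (ℕ → Ty S), Sub (s.inst θs) t

/-- `d` is the domain of `t`, the greatest `u` with `t ≤ u → any`. -/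
def IsDom (t d : Ty S) : Prop := Sub t (arrow d any) ∧ ∀ u, Sub t (arrow u any) → Sub u d

/-- `r` is the result of applying `t` to `s`, the least `u` with `t ≤ s → u`. -/
def IsApply (t s r : Ty S) : Prop := Sub t (arrow s r) ∧ ∀ u, Sub t (arrow s u) → Sub r u

/-- `r` is the first projection of `t`, the least `u` with `t ≤ u × any`. -/
def IsProj₁ (t r : Ty S) : Prop := Sub t (prod r any) ∧ ∀ u, Sub t (prod u any) → Sub r u

/-- `r` is the second projection of `t`, the least `u` with `t ≤ any × u`. -/
def IsProj₂ (t r : Ty S) : Prop := Sub t (prod any r) ∧ ∀ u, Sub t (prod any u) → Sub r u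

end Ty

/-- Monomorphic types. -/
abbrev MonoTy (S : Signature.{u}) : Type u := {t : Ty S // t.IsMono}

/-- Test types. -/
abbrev TestTy (S : Signature.{u}) : Type u := {t : Ty S // t.IsTest}

/-- Renamings: injective substitutions from polymorphic variables to polymorphic variables. -/
abbrev Renaming : Type := {ρ : ℕ → ℕ // Function.Injective ρ}

/-- Prepend an entry to a sequence indexed by de Bruijn indices. -/
def scons {α : Type u} (a : α) (f : ℕ → α) : ℕ → α
  | 0 => a
  | n + 1 => f n

/-- Lift a renaming of de Bruijn indices under a binder. -/
def upr (f : ℕ → ℕ) : ℕ → ℕ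
  | 0 => 0
  | n + 1 => f n + 1

/-! ## Source language and declarative system -/

/-- Source expressions up to `α`-equivalence, with de Bruijn indices. -/
inductive Expr (S : Signature.{u}) : Type u
  | const (c : S.Const)
  | var (n : ℕ)
  | lam (e : Expr S)
  | app (e₁ e₂ : Expr S)
  | pair (e₁ e₂ : Expr S)
  | proj₁ (e : Expr S)
  | proj₂ (e : Expr S)
  | tcase (e : Expr S) (τ : TestTy S) (e₁ e₂ : Expr S)

namespace Expr

variable {S : Signature.{u}}

def rename (f : ℕ → ℕ) : Expr S → Expr S
  | const c => const c
  | var n => var (f n)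
  | lam e => lam (e.rename (upr f))
  | app e₁ e₂ => app (e₁.rename f) (e₂.rename f)
  | pair e₁ e₂ => pair (e₁.rename f) (e₂.rename f)
  | proj₁ e => proj₁ (e.rename f)
  | proj₂ e => proj₂ (e.rename f)
  | tcase e τ e₁ e₂ => tcase (e.rename f) τ (e₁.rename f) (e₂.rename f)

/-- Weakening by one variable. -/
def shift (e : Expr S) : Expr S := e.rename Nat.succ

/-- Simultaneous capture-avoiding substitution. -/
def subst (θ : ℕ → Expr S) : Expr S → Expr S
  | const c => const c
  | var n => θ n
  | lam e => lam (e.subst (scons (var 0) fun n => (θ n).shift))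
  | app e₁ e₂ => app (e₁.subst θ) (e₂.subst θ)
  | pair e₁ e₂ => pair (e₁.subst θ) (e₂.subst θ)
  | proj₁ e => proj₁ (e.subst θ)
  | proj₂ e => proj₂ (e.subst θ)
  | tcase e τ e₁ e₂ => tcase (e.subst θ) τ (e₁.subst θ) (e₂.subst θ)

/-- `e {e'/x}` where `x` is the variable of index `0` of `e`. -/
def inst (e e' : Expr S) : Expr S := e.subst (scons e' var)

end Expr

/-- Type environments: partial maps from (indices of) variables to types. -/
abbrev Env (S : Signature.{u}) : Type u := ℕ → Option (Ty S)

/-- The empty environment. -/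
def Env.nil {S : Signature.{u}} : Env S := fun _ => none

/-- `Γ, x : t` where `x` is the new variable of index `0`. -/
def Env.cons {S : Signature.{u}} (t : Ty S) (Γ : Env S) : Env S := scons (some t) Γ

/-- `Γ` under a new variable of index `0` that is not in its domain. -/
def Env.skip {S : Signature.{u}} (Γ : Env S) : Env S := scons none Γ

/-- The declarative type system, `Γ ⊢ e : t`. -/
inductive Decl {S : Signature.{u}} : Env S → Expr S → Ty S → Prop
  | const {Γ c} : Decl Γ (.const c) (.basic (S.basicOf c))
  | ax {Γ n t} : Γ n = some t → Decl Γ (.var n) t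
  | arrowI {Γ e t} (m : MonoTy S) : Decl (Γ.cons m.1) e t → Decl Γ (.lam e) (.arrow m.1 t)
  | arrowE {Γ e₁ e₂ t₁ t₂} : Decl Γ e₁ (.arrow t₁ t₂) → Decl Γ e₂ t₁ → Decl Γ (.app e₁ e₂) t₂
  | prodI {Γ e₁ e₂ t₁ t₂} : Decl Γ e₁ t₁ → Decl Γ e₂ t₂ → Decl Γ (.pair e₁ e₂) (.prod t₁ t₂)
  | prodE₁ {Γ e t₁ t₂} : Decl Γ e (.prod t₁ t₂) → Decl Γ (.proj₁ e) t₁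
  | prodE₂ {Γ e t₁ t₂} : Decl Γ e (.prod t₁ t₂) → Decl Γ (.proj₂ e) t₂
  | caseEmpty {Γ e τ e₁ e₂} : Decl Γ e .empty → Decl Γ (.tcase e τ e₁ e₂) .empty
  | case₁ {Γ e τ e₁ e₂ t₁} : Decl Γ e τ.1 → Decl Γ e₁ t₁ → Decl Γ (.tcase e τ e₁ e₂) t₁
  | case₂ {Γ e τ e₁ e₂ t₂} : Decl Γ e (.neg τ.1) → Decl Γ e₂ t₂ → Decl Γ (.tcase e τ e₁ e₂) t₂
  | union {Γ e e' s t} (m : MonoTy S) : Decl Γ e' s →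
      Decl (Γ.cons (.inter s m.1)) e t → Decl (Γ.cons (.inter s (.neg m.1))) e t →
      Decl Γ (e.inst e') t
  | inter {Γ e t₁ t₂} : Decl Γ e t₁ → Decl Γ e t₂ → Decl Γ e (.inter t₁ t₂)
  | inst {Γ e t} (σ : ℕ → Ty S) : Decl Γ e t → Decl Γ e (t.subst σ)
  | sub {Γ e t t'} : Decl Γ e t → Ty.Sub t t' → Decl Γ e t'

/-! ## Canonical forms

Lambda variables and binding variables have separate de Bruijn indices, so that equality of
canonical forms is `α`-equivalence. -/

mutual
/-- Atoms; all arguments of type `ℕ` other than that of `lvar` are binding variables. -/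
inductive Atom (S : Signature.{u}) : Type u
  | const (c : S.Const)
  | lvar (n : ℕ)
  | lam (κ : Canon S)
  | pair (x₁ x₂ : ℕ)
  | app (x₁ x₂ : ℕ)
  | proj₁ (x : ℕ)
  | proj₂ (x : ℕ)
  | tcase (x : ℕ) (τ : TestTy S) (x₁ x₂ : ℕ)

/-- Canonical forms: `bind a κ` is `bind x = a in κ`, where `x` is the binding variable of index
`0` of `κ`. -/
inductive Canon (S : Signature.{u}) : Type u
  | bvar (x : ℕ)
  | bind (a : Atom S) (κ : Canon S)
end

mutual
/-- Renaming of lambda variables by `f` and of binding variables by `g`. -/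
def Atom.rename {S : Signature.{u}} (f g : ℕ → ℕ) : Atom S → Atom S
  | .const c => .const c
  | .lvar n => .lvar (f n)
  | .lam κ => .lam (κ.rename (upr f) g)
  | .pair x₁ x₂ => .pair (g x₁) (g x₂)
  | .app x₁ x₂ => .app (g x₁) (g x₂)
  | .proj₁ x => .proj₁ (g x)
  | .proj₂ x => .proj₂ (g x)
  | .tcase x τ x₁ x₂ => .tcase (g x) τ (g x₁) (g x₂)

def Canon.rename {S : Signature.{u}} (f g : ℕ → ℕ) : Canon S → Canon S
  | .bvar x => .bvar (g x)
  | .bind a κ => .bind (a.rename f g) (κ.rename f (upr g))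
end

/-- The atom `a` seen under `l` more lambda binders and `b` more bind binders. -/
def Atom.shift {S : Signature.{u}} (l b : ℕ) (a : Atom S) : Atom S :=
  a.rename (fun n => n + l) (fun x => x + b)

mutual
/-- Free variables of atoms and canonical forms: `inl` lambda variables, `inr` binding variables. -/
def Atom.fv {S : Signature.{u}} : Atom S → Set (ℕ ⊕ ℕ)
  | .const _ => ∅
  | .lvar n => {.inl n}
  | .lam κ => {v | Sum.map Nat.succ id v ∈ κ.fv}
  | .pair x₁ x₂ => {.inr x₁, .inr x₂}
  | .app x₁ x₂ => {.inr x₁, .inr x₂}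
  | .proj₁ x => {.inr x}
  | .proj₂ x => {.inr x}
  | .tcase x _ x₁ x₂ => {.inr x, .inr x₁, .inr x₂}

def Canon.fv {S : Signature.{u}} : Canon S → Set (ℕ ⊕ ℕ)
  | .bvar x => {.inr x}
  | .bind a κ => a.fv ∪ {v | Sum.map id Nat.succ v ∈ κ.fv}
end

mutual
/-- Unwinding, where `ρ` gives the expressions to be inlined for the binding variables. -/
def Atom.unwind {S : Signature.{u}} (ρ : ℕ → Expr S) : Atom S → Expr S
  | .const c => .const c
  | .lvar n => .var n
  | .lam κ => .lam (κ.unwind fun x => (ρ x).shift)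
  | .pair x₁ x₂ => .pair (ρ x₁) (ρ x₂)
  | .app x₁ x₂ => .app (ρ x₁) (ρ x₂)
  | .proj₁ x => .proj₁ (ρ x)
  | .proj₂ x => .proj₂ (ρ x)
  | .tcase x τ x₁ x₂ => .tcase (ρ x) τ (ρ x₁) (ρ x₂)

def Canon.unwind {S : Signature.{u}} (ρ : ℕ → Expr S) : Canon S → Expr S
  | .bvar x => ρ x
  | .bind a κ => κ.unwind (scons (a.unwind ρ) ρ)
end

mutual
/-- Canonical equivalence: the least congruence that exchanges consecutive independent bindings.
In `swap`, the second atom of the left-hand side is a weakening, hence does not use the first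
binding. -/
inductive Atom.EqCan {S : Signature.{u}} : Atom S → Atom S → Prop
  | refl (a) : Atom.EqCan a a
  | symm {a b} : Atom.EqCan a b → Atom.EqCan b a
  | trans {a b c} : Atom.EqCan a b → Atom.EqCan b c → Atom.EqCan a c
  | lam {κ κ'} : Canon.EqCan κ κ' → Atom.EqCan (.lam κ) (.lam κ')

inductive Canon.EqCan {S : Signature.{u}} : Canon S → Canon S → Prop
  | refl (κ) : Canon.EqCan κ κ
  | symm {κ κ'} : Canon.EqCan κ κ' → Canon.EqCan κ' κ
  | trans {κ κ' κ''} : Canon.EqCan κ κ' → Canon.EqCan κ' κ'' → Canon.EqCan κ κ''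
  | bind {a a' κ κ'} : Atom.EqCan a a' → Canon.EqCan κ κ' →
      Canon.EqCan (.bind a κ) (.bind a' κ')
  | swap (a₁ a₂ κ) : Canon.EqCan
      (.bind a₁ (.bind (a₂.shift 0 1) κ))
      (.bind a₂ (.bind (a₁.shift 0 1) (κ.rename id (Equiv.swap 0 1))))
end

/-- `Occurs κ l b κ'`: the canonical form `κ'` is a sub-expression of `κ`, at a place under `l`
lambda binders and `b` bind binders of `κ`. -/
inductive Canon.Occurs {S : Signature.{u}} : Canon S → ℕ → ℕ → Canon S → Prop
  | refl (κ) : Canon.Occurs κ 0 0 κ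
  | body {a κ l b κ'} : Canon.Occurs κ l b κ' → Canon.Occurs (.bind a κ) l (b + 1) κ'
  | lam {κ₀ κ l b κ'} : Canon.Occurs κ₀ l b κ' → Canon.Occurs (.bind (.lam κ₀) κ) (l + 1) b κ'

/-- `Atom.Defines a l b a'`: a binding of the atom `a'` is a sub-expression of the atom `a`, at a
place under `l` lambda binders and `b` bind binders of `a`. -/
def Atom.Defines {S : Signature.{u}} (a : Atom S) (l b : ℕ) (a' : Atom S) : Prop :=
  ∃ κ l' κ', a = .lam κ ∧ l = l' + 1 ∧ κ.Occurs l' b (.bind a' κ')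

/-- The same for a canonical form `κ`. -/
def Canon.Defines {S : Signature.{u}} (κ : Canon S) (l b : ℕ) (a' : Atom S) : Prop :=
  ∃ κ', κ.Occurs l b (.bind a' κ')

/-- First condition on maximal sharing forms: two bindings at distinct places never define
equivalent atoms. Two places are compared at the sub-expression `bind a κ'` where they separate:
either one of them is this very binding, or one of them is in `a` and the other in `κ'`. Atoms
under different binders are the same if they are weakenings of one atom (up to equivalence), that
is, if their free variables refer to the same binders. -/
def Canon.Shared {S : Signature.{u}} (κ : Canon S) : Prop :=
  ∀ l b a κ', κ.Occurs l b (.bind a κ') →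
    (∀ l' b' a', κ'.Defines l' b' a' → ¬ (a.shift l' (b' + 1)).EqCan a') ∧
    (∀ l' b' a', a.Defines l' b' a' → ¬ (a.shift l' b').EqCan a') ∧
    (∀ l₁ b₁ a₁ l₂ b₂ a₂, a.Defines l₁ b₁ a₁ → κ'.Defines l₂ b₂ a₂ →
      ¬ ∃ a₀ : Atom S, (a₀.shift l₁ b₁).EqCan a₁ ∧ (a₀.shift l₂ (b₂ + 1)).EqCan a₂)

/-- Second condition: bindings are extruded from abstractions whenever possible. For no binding of
an atom `a` in the body of an abstraction `λ x. κ₁`, the free variables of `a` are all free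
variables of `λ x. κ₁`. -/
def Canon.Extruded {S : Signature.{u}} (κ : Canon S) : Prop :=
  ∀ l b κ₁ κ₂, κ.Occurs l b (.bind (.lam κ₁) κ₂) →
    ∀ l' b' a, (Atom.lam κ₁).Defines l' b' a →
      ¬ a.fv ⊆ Sum.map (fun n => n + l') (fun x => x + b') '' (Atom.lam κ₁).fv

/-- Third condition: no useless binding. -/
def Canon.Useful {S : Signature.{u}} (κ : Canon S) : Prop :=
  ∀ l b a κ', κ.Occurs l b (.bind a κ') → Sum.inr 0 ∈ κ'.fv

/-- Maximal sharing canonical forms. -/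
structure Canon.IsMSC {S : Signature.{u}} (κ : Canon S) : Prop where
  shared : κ.Shared
  extruded : κ.Extruded
  useful : κ.Useful

/-- `κ` is an MSC-form of `e`: an MSC-form without free binding variables that unwinds to `e`
(the choice of `ρ` in the unwinding is then irrelevant). -/
structure Canon.IsMSCOf {S : Signature.{u}} (κ : Canon S) (e : Expr S) : Prop where
  msc : κ.IsMSC
  closed : ∀ x, Sum.inr x ∉ κ.fv
  unwind_eq : κ.unwind Expr.var = e

/-! ## Annotations and algorithmic system -/

mutual
/-- Atom annotations. Finite sets of annotations are given as finite families, finite sets of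
substitutions as lists. -/
inductive AAnnot (S : Signature.{u}) : Type u
  | none
  | lam (m : MonoTy S) (A : FAnnot S)
  | pair (ρ₁ ρ₂ : Renaming)
  | app (θs₁ θs₂ : List (ℕ → Ty S))
  | proj (θs : List (ℕ → Ty S))
  | empty (θs : List (ℕ → Ty S))
  | thn (θs : List (ℕ → Ty S))
  | els (θs : List (ℕ → Ty S))
  | inter {n : ℕ} (A : Fin n → AAnnot S)

/-- Form annotations. -/
inductive FAnnot (S : Signature.{u}) : Type u
  | var (ρ : Renaming)
  | keep (A : AAnnot S) {n : ℕ} (m : Fin n → MonoTy S) (As : Fin n → FAnnot S)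
  | skip (A : FAnnot S)
  | inter {n : ℕ} (A : Fin n → FAnnot S)
end

mutual
/-- Algorithmic typing of atoms; `Γ` types the lambda variables and `Δ` the binding variables. -/
inductive AlgA {S : Signature.{u}} : Env S → Env S → Atom S → AAnnot S → Ty S → Prop
  | const {Γ Δ c} : AlgA Γ Δ (.const c) .none (.basic (S.basicOf c))
  | ax {Γ Δ n t} : Γ n = some t → AlgA Γ Δ (.lvar n) .none t
  | arrowI {Γ Δ κ A t} {m : MonoTy S} : AlgF (Γ.cons m.1) Δ κ A t →
      AlgA Γ Δ (.lam κ) (.lam m A) (.arrow m.1 t)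
  | arrowE {Γ Δ x₁ x₂ s₁ s₂ θs₁ θs₂ d r} : Δ x₁ = some s₁ → Δ x₂ = some s₂ →
      Ty.Sub (s₁.inst θs₁) (.arrow .empty .any) →
      Ty.IsDom (s₁.inst θs₁) d → Ty.Sub (s₂.inst θs₂) d →
      Ty.IsApply (s₁.inst θs₁) (s₂.inst θs₂) r →
      AlgA Γ Δ (.app x₁ x₂) (.app θs₁ θs₂) r
  | prodI {Γ Δ x₁ x₂ s₁ s₂} {ρ₁ ρ₂ : Renaming} : Δ x₁ = some s₁ → Δ x₂ = some s₂ →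
      AlgA Γ Δ (.pair x₁ x₂) (.pair ρ₁ ρ₂) (.prod (s₁.rename ρ₁.1) (s₂.rename ρ₂.1))
  | prodE₁ {Γ Δ x s θs r} : Δ x = some s → Ty.Sub (s.inst θs) (.prod .any .any) →
      Ty.IsProj₁ (s.inst θs) r → AlgA Γ Δ (.proj₁ x) (.proj θs) r
  | prodE₂ {Γ Δ x s θs r} : Δ x = some s → Ty.Sub (s.inst θs) (.prod .any .any) →
      Ty.IsProj₂ (s.inst θs) r → AlgA Γ Δ (.proj₂ x) (.proj θs) r
  | caseEmpty {Γ Δ x τ x₁ x₂ s θs} : Δ x = some s → Ty.Equiv (s.inst θs) .empty →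
      AlgA Γ Δ (.tcase x τ x₁ x₂) (.empty θs) .empty
  | case₁ {Γ Δ x τ x₁ x₂ s θs t} : Δ x = some s → Ty.Sub (s.inst θs) τ.1 → Δ x₁ = some t →
      AlgA Γ Δ (.tcase x τ x₁ x₂) (.thn θs) t
  | case₂ {Γ Δ x τ x₁ x₂ s θs t} : Δ x = some s → Ty.Sub (s.inst θs) (.neg τ.1) →
      Δ x₂ = some t → AlgA Γ Δ (.tcase x τ x₁ x₂) (.els θs) t
  | inter {Γ Δ a n} {A : Fin n → AAnnot S} {t : Fin n → Ty S} : n ≠ 0 →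
      (∀ i, AlgA Γ Δ a (A i) (t i)) → AlgA Γ Δ a (.inter A) (.bigInter (List.ofFn t))

/-- Algorithmic typing of canonical forms. -/
inductive AlgF {S : Signature.{u}} : Env S → Env S → Canon S → FAnnot S → Ty S → Prop
  | var {Γ Δ x s} {ρ : Renaming} : Δ x = some s →
      AlgF Γ Δ (.bvar x) (.var ρ) (s.rename ρ.1)
  | bind₁ {Γ Δ a κ A t} : AlgF Γ Δ.skip κ A t → AlgF Γ Δ (.bind a κ) (.skip A) t
  | bind₂ {Γ Δ a κ A s n} {m : Fin n → MonoTy S} {As : Fin n → FAnnot S} {t : Fin n → Ty S} :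
      Ty.Equiv (.bigUnion (List.ofFn fun i => (m i).1)) .any → AlgA Γ Δ a A s →
      (∀ i, AlgF Γ (Δ.cons (.inter s (m i).1)) κ (As i) (t i)) →
      AlgF Γ Δ (.bind a κ) (.keep A m As) (.bigUnion (List.ofFn t))
  | inter {Γ Δ κ n} {A : Fin n → FAnnot S} {t : Fin n → Ty S} : n ≠ 0 →
      (∀ i, AlgF Γ Δ κ (A i) (t i)) → AlgF Γ Δ κ (.inter A) (.bigInter (List.ofFn t))
end

end MSC

open MSC

namespace MSC

universe u

/-! ## Case analysis and induction on types -/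

namespace Ty

variable {S : Signature.{u}}

-- Maximal sharing forms have a semantic description, `Canon.Good`. Every binding variable stands
-- for an expression. A closed form is maximally sharing exactly when its bindings stand for
-- different sub-expressions of the whole, none of them already available in the context, and every
-- binding inside an abstraction contains the variable of the innermost abstraction
-- (`Canon.isMSCOf_iff`). The unwinding then dictates the set of bound expressions
-- (`Canon.Good.Sb_unwind`), so two forms of one expression differ only in the order of independent
-- bindings (`Canon.Good.eqCan`). A form exists because a smallest sub-expression not yet bound can
-- always be bound next (`exists_good`).
--
-- Soundness reads a binding split into cases as union elimination on the bound expression.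
-- `Decl.cover` turns the binary rule into one for finite covers.
--
-- Completeness does not rewrite derivations; it builds a countermodel. Suppose that a form has no
-- type `⊑ t`. Each of its bindings is given a set of types: the polymorphic supertypes of `s ∧ m`,
-- where `s` is a type of the atom and `m` belongs to an ultrafilter of monomorphic types for which
-- the remaining form stays untypable. If there were no such ultrafilter, compactness would give
-- finitely many good cases covering the domain, which is just what a `keep` annotation needs. The
-- result is a `World` in which `t` is missing at the variable of the whole expression
-- (`exists_world_of_not_hasFIn`). But every declarative rule preserves membership in a world
-- (`World.mem_of_decl`). Union elimination does, because the sets decide all monomorphic types and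
-- sharing represents all occurrences of an expression by a single variable. Abstraction does,
-- because the construction can be repeated in the body.
--
-- These arguments rest on a calculus of `⊑`. Substitution is simulated by changing labels in the
-- domain (`Ty.Relabel.mem_iff`), which makes subtyping stable under substitution. Renaming types
-- apart lets the components of products and unions be instantiated independently. The operators of
-- the algorithmic rules exist because each is a set of elements definable from finitely many types.
-- In the empty environment all algorithmic types are invariant under substitution, so that `⊑`
-- becomes `≤`.

theorem view_node (h : TyHead S.Basic) (c : h.Pos → Ty S) : (node h c).view = viewAux h c := by
  have key : ∀ (p : (TyFunctor S.Basic) (Tree S.Basic)) (c' : TyHead.Pos p.1 → Ty S),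
      p = (⟨h, fun i => (c i).1⟩ : (TyFunctor S.Basic) (Tree S.Basic)) →
      (∀ i, (c' i).1 = p.2 i) → viewAux p.1 c' = viewAux h c := by
    rintro _ c' rfl h'
    have : c' = c := funext fun i => Subtype.ext (h' i)
    rw [this]
  exact key (node h c).1.dest (node h c).child (PFunctor.M.dest_mk _) fun _ => rfl

theorem eq_node (t : Ty S) : t = node t.1.hd t.child :=
  Subtype.ext (PFunctor.M.mk_dest t.1).symm

@[simp] theorem view_basic (b : S.Basic) : (basic b).view = .basic b := view_node _ _
@[simp] theorem view_poly (n : ℕ) : (poly n : Ty S).view = .poly n := view_node _ _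
@[simp] theorem view_mono (n : ℕ) : (mono n : Ty S).view = .mono n := view_node _ _
@[simp] theorem view_arrow (s t : Ty S) : (arrow s t).view = .arrow s t := view_node _ _
@[simp] theorem view_prod (s t : Ty S) : (prod s t).view = .prod s t := view_node _ _
@[simp] theorem view_union (s t : Ty S) : (union s t).view = .union s t := view_node _ _
@[simp] theorem view_neg (t : Ty S) : (neg t).view = .neg t := view_node _ _
@[simp] theorem view_empty : (empty : Ty S).view = .empty := view_node _ _

/-- The type with a given top-level case. -/
def View.toTy : View S → Ty S
  | .basic b => Ty.basic b
  | .poly n => Ty.poly n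
  | .mono n => Ty.mono n
  | .arrow s t => Ty.arrow s t
  | .prod s t => Ty.prod s t
  | .union s t => Ty.union s t
  | .neg t => Ty.neg t
  | .empty => Ty.empty

theorem node_eq_toTy (h : TyHead S.Basic) (c : h.Pos → Ty S) :
    node h c = (viewAux h c).toTy := by
  cases h <;> simp only [viewAux, View.toTy, basic, poly, mono, arrow, prod, union, neg, empty] <;>
    congr 1 <;> funext i <;> (unfold TyHead.Pos at i; fin_cases i) <;> rfl

theorem toTy_view (t : Ty S) : t.view.toTy = t := by
  conv_rhs => rw [eq_node t, node_eq_toTy]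
  rfl

/-- Induction on the Boolean structure of a type. -/
theorem stripInduction {motive : Ty S → Prop} (basic : ∀ b, motive (basic b))
    (poly : ∀ n, motive (poly n)) (mono : ∀ n, motive (mono n))
    (arrow : ∀ s t, motive (arrow s t)) (prod : ∀ s t, motive (prod s t))
    (union : ∀ s t, motive s → motive t → motive (union s t))
    (neg : ∀ t, motive t → motive (neg t)) (empty : motive empty) (t : Ty S) : motive t := by
  induction t using wf_strip.induction with
  | _ t ih =>
    have h := toTy_view t
    cases hv : t.view <;> rw [hv] at h <;> rw [← h]
    · exact basic _
    · exact poly _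
    · exact mono _
    · exact arrow _ _
    · exact prod _ _
    · exact union _ _ (ih _ (strip_union hv).1) (ih _ (strip_union hv).2)
    · exact neg _ (ih _ (strip_neg hv))
    · exact empty

/-- One unfolding of the well-founded recursion. Types may be infinite trees, so recursion and
induction on them are available only along unions and negations. -/
theorem boolEval_eq (atom : View S → Prop) (t : Ty S) : boolEval atom t =
    match t.view with
    | .union a b => boolEval atom a ∨ boolEval atom b
    | .neg a => ¬ boolEval atom a
    | .empty => False
    | v => atom v := by
  rw [boolEval, WellFounded.fix_eq]
  split <;> rename_i h <;> simp only [h]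

section boolEval

variable (atom : View S → Prop)

theorem boolEval_union (s t : Ty S) :
    boolEval atom (union s t) ↔ boolEval atom s ∨ boolEval atom t := by
  rw [boolEval_eq]; simp
theorem boolEval_neg (t : Ty S) : boolEval atom (neg t) ↔ ¬ boolEval atom t := by
  rw [boolEval_eq]; simp
theorem boolEval_empty : ¬ boolEval atom empty := by
  rw [boolEval_eq]; simp
theorem boolEval_basic (b : S.Basic) : boolEval atom (basic b) ↔ atom (.basic b) := by
  rw [boolEval_eq]; simp
theorem boolEval_poly (n : ℕ) : boolEval atom (poly n) ↔ atom (.poly n) := by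
  rw [boolEval_eq]; simp
theorem boolEval_mono (n : ℕ) : boolEval atom (mono n) ↔ atom (.mono n) := by
  rw [boolEval_eq]; simp
theorem boolEval_arrow (s t : Ty S) : boolEval atom (arrow s t) ↔ atom (.arrow s t) := by
  rw [boolEval_eq]; simp
theorem boolEval_prod (s t : Ty S) : boolEval atom (prod s t) ↔ atom (.prod s t) := by
  rw [boolEval_eq]; simp

end boolEval

end Ty

/-! ## Membership -/

namespace Dom

variable {S : Signature.{u}}

/-- The outermost label. -/
def label : Dom S → Finset (ℕ ⊕ ℕ)
  | const _ L => L
  | pair _ _ L => L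
  | fn _ _ _ L => L

@[simp] theorem mem_union (d : Dom S) (s t : Ty S) : d.Mem (.union s t) ↔ d.Mem s ∨ d.Mem t := by
  cases d <;> simp only [Mem] <;> exact Ty.boolEval_union _ _ _

@[simp] theorem mem_neg (d : Dom S) (t : Ty S) : d.Mem (.neg t) ↔ ¬ d.Mem t := by
  cases d <;> simp only [Mem] <;> exact Ty.boolEval_neg _ _

@[simp] theorem mem_empty (d : Dom S) : ¬ d.Mem .empty := by
  cases d <;> simp only [Mem] <;> exact Ty.boolEval_empty _

@[simp] theorem mem_any (d : Dom S) : d.Mem .any := by simp [Ty.any]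

@[simp] theorem mem_inter (d : Dom S) (s t : Ty S) : d.Mem (.inter s t) ↔ d.Mem s ∧ d.Mem t := by
  simp [Ty.inter, not_or]

@[simp] theorem mem_poly (d : Dom S) (n : ℕ) : d.Mem (.poly n) ↔ Sum.inl n ∈ d.label := by
  cases d <;> simp only [Mem, label] <;> exact Ty.boolEval_poly _ _

@[simp] theorem mem_mono (d : Dom S) (n : ℕ) : d.Mem (.mono n) ↔ Sum.inr n ∈ d.label := by
  cases d <;> simp only [Mem, label] <;> exact Ty.boolEval_mono _ _

@[simp] theorem const_mem_basic (c : S.Const) (L) (b : S.Basic) :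
    (const c L).Mem (.basic b) ↔ c ∈ S.interp b := by
  simp only [Mem]; exact Ty.boolEval_basic _ _
@[simp] theorem const_mem_arrow (c : S.Const) (L) (s t : Ty S) : ¬ (const c L).Mem (.arrow s t) := by
  simp only [Mem, Ty.boolEval_arrow, not_false_iff]
@[simp] theorem const_mem_prod (c : S.Const) (L) (s t : Ty S) : ¬ (const c L).Mem (.prod s t) := by
  simp only [Mem, Ty.boolEval_prod, not_false_iff]

@[simp] theorem pair_mem_basic (d₁ d₂ : Dom S) (L) (b : S.Basic) :
    ¬ (pair d₁ d₂ L).Mem (.basic b) := by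
  simp only [Mem, Ty.boolEval_basic, not_false_iff]
@[simp] theorem pair_mem_arrow (d₁ d₂ : Dom S) (L) (s t : Ty S) :
    ¬ (pair d₁ d₂ L).Mem (.arrow s t) := by
  simp only [Mem, Ty.boolEval_arrow, not_false_iff]
@[simp] theorem pair_mem_prod (d₁ d₂ : Dom S) (L) (s t : Ty S) :
    (pair d₁ d₂ L).Mem (.prod s t) ↔ d₁.Mem s ∧ d₂.Mem t := by
  simp only [Mem]; exact Ty.boolEval_prod _ _ _

@[simp] theorem fn_mem_basic {m k : ℕ} (arg res : Fin m → Dom S) (bad : Fin k → Dom S) (L)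
    (b : S.Basic) : ¬ (fn arg res bad L).Mem (.basic b) := by
  simp only [Mem, Ty.boolEval_basic, not_false_iff]
@[simp] theorem fn_mem_prod {m k : ℕ} (arg res : Fin m → Dom S) (bad : Fin k → Dom S) (L)
    (s t : Ty S) : ¬ (fn arg res bad L).Mem (.prod s t) := by
  simp only [Mem, Ty.boolEval_prod, not_false_iff]
@[simp] theorem fn_mem_arrow {m k : ℕ} (arg res : Fin m → Dom S) (bad : Fin k → Dom S) (L)
    (s t : Ty S) : (fn arg res bad L).Mem (.arrow s t) ↔
      (∀ i, (arg i).Mem s → (res i).Mem t) ∧ ∀ j, ¬ (bad j).Mem s := by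
  simp only [Mem]; exact Ty.boolEval_arrow _ _ _

theorem mem_bigInter (d : Dom S) (l : List (Ty S)) : d.Mem (.bigInter l) ↔ ∀ t ∈ l, d.Mem t := by
  induction l with
  | nil => simp [Ty.bigInter]
  | cons a l ih => simpa [Ty.bigInter] using fun _ => ih

theorem mem_bigUnion (d : Dom S) (l : List (Ty S)) : d.Mem (.bigUnion l) ↔ ∃ t ∈ l, d.Mem t := by
  induction l with
  | nil => simp [Ty.bigUnion]
  | cons a l ih =>
    simp only [Ty.bigUnion, List.foldr_cons, mem_union, List.mem_cons, exists_eq_or_imp] at ih ⊢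
    rw [ih]

end Dom

/-! ## Substitution -/

namespace Ty

variable {S : Signature.{u}} (σ : ℕ → Ty S)

theorem dest_node (h : TyHead S.Basic) (c : h.Pos → Ty S) : (node h c).1.dest =
    (Sigma.mk (β := fun a => (TyFunctor S.Basic).B a → Tree S.Basic) h fun i => (c i).1) :=
  PFunctor.M.dest_mk (F := TyFunctor S.Basic) _

theorem hd_node (h : TyHead S.Basic) (c : h.Pos → Ty S) : (node h c).1.hd = h :=
  congrArg Sigma.fst (dest_node h c)

theorem subst_node (h : TyHead S.Basic) (hp : ∀ n, h ≠ .poly n) (c : h.Pos → Ty S) :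
    (node h c).subst σ = node h fun i => (c i).subst σ := by
  refine Subtype.ext ?_
  have h1 := Tree.subst_dest (fun n => (σ n).1) (t := (node h c).1) (by rw [hd_node]; exact hp)
  rw [dest_node] at h1
  change Tree.subst _ (node h c).1 = _
  rw [← PFunctor.M.mk_dest (Tree.subst _ (node h c).1), h1]
  rfl

@[simp] theorem subst_basic (b : S.Basic) : (basic b).subst σ = basic b :=
  (subst_node σ _ (by simp) _).trans (congrArg (node _) (funext fun i => i.elim0))
@[simp] theorem subst_mono (n : ℕ) : (mono n).subst σ = mono n :=
  (subst_node σ _ (by simp) _).trans (congrArg (node _) (funext fun i => i.elim0))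
@[simp] theorem subst_empty : (empty : Ty S).subst σ = empty :=
  (subst_node σ _ (by simp) _).trans (congrArg (node _) (funext fun i => i.elim0))
@[simp] theorem subst_poly (n : ℕ) : (poly n).subst σ = σ n :=
  Subtype.ext (Tree.subst_poly _ (hd_node _ _))
@[simp] theorem subst_arrow (s t : Ty S) :
    (arrow s t).subst σ = arrow (s.subst σ) (t.subst σ) :=
  (subst_node σ _ (by simp) _).trans
    (congrArg (node _) (funext fun i : Fin 2 => apply_ite (subst σ) (i = 0) s t))
@[simp] theorem subst_prod (s t : Ty S) :
    (prod s t).subst σ = prod (s.subst σ) (t.subst σ) :=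
  (subst_node σ _ (by simp) _).trans
    (congrArg (node _) (funext fun i : Fin 2 => apply_ite (subst σ) (i = 0) s t))
@[simp] theorem subst_union (s t : Ty S) :
    (union s t).subst σ = union (s.subst σ) (t.subst σ) :=
  (subst_node σ _ (by simp) _).trans
    (congrArg (node _) (funext fun i : Fin 2 => apply_ite (subst σ) (i = 0) s t))
@[simp] theorem subst_neg (t : Ty S) : (neg t).subst σ = neg (t.subst σ) :=
  subst_node σ _ (by simp) _
@[simp] theorem subst_any : (any : Ty S).subst σ = any := by simp [any]
@[simp] theorem subst_inter (s t : Ty S) :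
    (inter s t).subst σ = inter (s.subst σ) (t.subst σ) := by simp [inter]

theorem subst_bigInter (l : List (Ty S)) :
    (bigInter l).subst σ = bigInter (l.map fun t => t.subst σ) := by
  induction l with
  | nil => simp [bigInter]
  | cons a l ih => simp only [bigInter, List.foldr_cons, subst_inter, List.map_cons] at ih ⊢; rw [ih]

theorem subst_bigUnion (l : List (Ty S)) :
    (bigUnion l).subst σ = bigUnion (l.map fun t => t.subst σ) := by
  induction l with
  | nil => simp [bigUnion]
  | cons a l ih => simp only [bigUnion, List.foldr_cons, subst_union, List.map_cons] at ih ⊢; rw [ih]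

/-! ## Sub-terms and variables -/

theorem isSubterm_node {s : Ty S} {h : TyHead S.Basic} {c : h.Pos → Ty S} :
    IsSubterm s (node h c) ↔ s = node h c ∨ ∃ i, IsSubterm s (c i) := by
  constructor
  · intro h'
    rcases Tree.IsSubterm.cases' h' with h1 | ⟨i, hi⟩
    · exact Or.inl (Subtype.ext h1)
    · refine Or.inr ?_
      clear h'
      revert i
      rw [dest_node]
      exact fun i hi => ⟨i, hi⟩
  · rintro (rfl | ⟨i, hi⟩)
    · exact Relation.ReflTransGen.refl
    · refine Relation.ReflTransGen.tail hi ?_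
      unfold Tree.IsChild
      rw [dest_node]
      exact ⟨i, rfl⟩

/-- The polymorphic variables of a type. -/
def vars (t : Ty S) : Set ℕ := {n | IsSubterm (poly n) t}

theorem poly_injective : Function.Injective (poly : ℕ → Ty S) := by
  intro m n h
  have h1 : (poly m : Ty S).view = (poly n : Ty S).view := by rw [h]
  simpa using h1

theorem finite_vars (t : Ty S) : t.vars.Finite := by
  -- The variables embed into the set of sub-terms, which is finite by regularity.
  refine Set.Finite.of_finite_image (f := fun n => (poly n : Ty S).1) (t.2.1.subset ?_)
    (fun m _ n _ h => poly_injective (Subtype.ext h))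
  rintro _ ⟨n, hn, rfl⟩
  exact hn

theorem mem_vars_node {h : TyHead S.Basic} (hp : ∀ n, h ≠ .poly n) (c : h.Pos → Ty S) (n : ℕ) :
    n ∈ (node h c).vars ↔ ∃ i, n ∈ (c i).vars := by
  refine isSubterm_node.trans (or_iff_right fun h' => ?_)
  have h1 : (poly n : Ty S).1.hd = (node h c).1.hd := by rw [h']
  exact hp n (((hd_node _ _).symm.trans h1).trans (hd_node _ _)).symm

@[simp] theorem vars_poly (n : ℕ) : (poly n : Ty S).vars = {n} := by
  ext m
  rw [Set.mem_singleton_iff]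
  constructor
  · intro h
    rcases isSubterm_node.1 h with h | ⟨i, _⟩
    · exact poly_injective h
    · exact i.elim0
  · rintro rfl
    exact Relation.ReflTransGen.refl

@[simp] theorem vars_arrow (s t : Ty S) : (arrow s t).vars = s.vars ∪ t.vars := by
  ext n
  rw [Set.mem_union]
  exact (mem_vars_node (by simp) _ n).trans
    (Fin.exists_fin_two (p := fun i : Fin 2 => n ∈ (if i = 0 then s else t).vars))
@[simp] theorem vars_prod (s t : Ty S) : (prod s t).vars = s.vars ∪ t.vars := by
  ext n
  rw [Set.mem_union]
  exact (mem_vars_node (by simp) _ n).trans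
    (Fin.exists_fin_two (p := fun i : Fin 2 => n ∈ (if i = 0 then s else t).vars))
@[simp] theorem vars_union (s t : Ty S) : (union s t).vars = s.vars ∪ t.vars := by
  ext n
  rw [Set.mem_union]
  exact (mem_vars_node (by simp) _ n).trans
    (Fin.exists_fin_two (p := fun i : Fin 2 => n ∈ (if i = 0 then s else t).vars))
@[simp] theorem vars_neg (t : Ty S) : (neg t).vars = t.vars := by
  ext n
  exact (mem_vars_node (by simp) _ n).trans ⟨fun ⟨_, h⟩ => h, fun h => ⟨(0 : Fin 1), h⟩⟩
@[simp] theorem vars_empty : (empty : Ty S).vars = ∅ :=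
  Set.eq_empty_of_forall_notMem fun n h => ((mem_vars_node (by simp) _ n).1 h).elim
    fun i _ => i.elim0
@[simp] theorem vars_inter (s t : Ty S) : (inter s t).vars = s.vars ∪ t.vars := by simp [inter]

theorem isMono_iff {t : Ty S} : t.IsMono ↔ t.vars = ∅ := Set.eq_empty_iff_forall_notMem.symm

theorem IsMono.neg {t : Ty S} (h : t.IsMono) : t.neg.IsMono := by
  rw [isMono_iff] at h ⊢; simpa
theorem IsMono.inter {s t : Ty S} (hs : s.IsMono) (ht : t.IsMono) : (s.inter t).IsMono := by
  rw [isMono_iff] at hs ht ⊢; simp [hs, ht]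

/-! ## The effect of substitutions on membership -/

/-- `d'` is `d` up to labels, and the polymorphic variables `n ∈ V` in the labels of `d'` tell
which of the types `σ n` contain the corresponding part of `d`. -/
inductive Relabel (V : Set ℕ) (σ : ℕ → Ty S) : Dom S → Dom S → Prop
  | const {c L L'} : (∀ n ∈ V, Sum.inl n ∈ L' ↔ (Dom.const c L).Mem (σ n)) →
      (∀ n, Sum.inr n ∈ L' ↔ Sum.inr n ∈ L) → Relabel V σ (.const c L) (.const c L')
  | pair {d₁ d₂ d₁' d₂' L L'} : (∀ n ∈ V, Sum.inl n ∈ L' ↔ (Dom.pair d₁ d₂ L).Mem (σ n)) →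
      (∀ n, Sum.inr n ∈ L' ↔ Sum.inr n ∈ L) → Relabel V σ d₁ d₁' → Relabel V σ d₂ d₂' →
      Relabel V σ (.pair d₁ d₂ L) (.pair d₁' d₂' L')
  | fn {m k : ℕ} {arg res arg' res' : Fin m → Dom S} {bad bad' : Fin k → Dom S} {L L'} :
      (∀ n ∈ V, Sum.inl n ∈ L' ↔ (Dom.fn arg res bad L).Mem (σ n)) →
      (∀ n, Sum.inr n ∈ L' ↔ Sum.inr n ∈ L) → (∀ i, Relabel V σ (arg i) (arg' i)) →
      (∀ i, Relabel V σ (res i) (res' i)) → (∀ j, Relabel V σ (bad j) (bad' j)) →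
      Relabel V σ (.fn arg res bad L) (.fn arg' res' bad' L')

/-- Labels are finite, so membership in `σ n` can be recorded for finitely many variables only. The
variables of a type suffice. -/
theorem exists_relabel {V : Set ℕ} (hV : V.Finite) (d : Dom S) : ∃ d', Relabel V σ d d' := by
  have hL : ∀ (d : Dom S) (L : Finset (ℕ ⊕ ℕ)), ∃ L' : Finset (ℕ ⊕ ℕ),
      (∀ n ∈ V, Sum.inl n ∈ L' ↔ d.Mem (σ n)) ∧ ∀ n, Sum.inr n ∈ L' ↔ Sum.inr n ∈ L := by
    intro d L
    have hf : (Sum.inl '' {n ∈ V | d.Mem (σ n)} ∪ {v | v ∈ L ∧ v.isRight}).Finite :=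
      ((hV.subset (Set.sep_subset _ _)).image _).union
        (L.finite_toSet.subset fun v hv => hv.1)
    exact ⟨hf.toFinset, fun n hn => by simp [hn], fun n => by simp⟩
  induction d with
  | const c L =>
    obtain ⟨L', h1, h2⟩ := hL (.const c L) L
    exact ⟨_, .const h1 h2⟩
  | pair d₁ d₂ L ih₁ ih₂ =>
    obtain ⟨L', h1, h2⟩ := hL (.pair d₁ d₂ L) L
    obtain ⟨d₁', h₁⟩ := ih₁
    obtain ⟨d₂', h₂⟩ := ih₂
    exact ⟨_, .pair h1 h2 h₁ h₂⟩
  | fn arg res bad L ih₁ ih₂ ih₃ =>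
    obtain ⟨L', h1, h2⟩ := hL (.fn arg res bad L) L
    choose arg' h₁ using ih₁
    choose res' h₂ using ih₂
    choose bad' h₃ using ih₃
    exact ⟨_, .fn h1 h2 h₁ h₂ h₃⟩

variable {σ}

/-- The outer induction is on the element, which is finite, the inner one on the Boolean structure
of the type. Arrows and products pass to components of the element, so the possibly infinite type is
never descended on its own. -/
theorem Relabel.mem_iff {V : Set ℕ} {d d' : Dom S} (h : Relabel V σ d d') :
    ∀ t : Ty S, t.vars ⊆ V → (d.Mem (t.subst σ) ↔ d'.Mem t) := by
  induction h with
  | const h1 h2 =>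
    intro t
    induction t using stripInduction with
    | basic b => simp
    | poly n => intro hn; simpa [Dom.label] using (h1 n (by simpa using hn)).symm
    | mono n => intro hn; simpa [Dom.label] using (h2 n).symm
    | arrow s t => simp
    | prod s t => simp
    | union s t ihs iht =>
      intro hn
      simp only [vars_union, Set.union_subset_iff] at hn
      simp [ihs hn.1, iht hn.2]
    | neg t iht => intro hn; simp only [vars_neg] at hn; simp [iht hn]
    | empty => simp
  | pair h1 h2 _ _ ih₁ ih₂ =>
    intro t
    induction t using stripInduction with
    | basic b => simp
    | poly n => intro hn; simpa [Dom.label] using (h1 n (by simpa using hn)).symm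
    | mono n => intro hn; simpa [Dom.label] using (h2 n).symm
    | arrow s t => simp
    | prod s t =>
      intro hn
      simp only [vars_prod, Set.union_subset_iff] at hn
      simp [ih₁ s hn.1, ih₂ t hn.2]
    | union s t ihs iht =>
      intro hn
      simp only [vars_union, Set.union_subset_iff] at hn
      simp [ihs hn.1, iht hn.2]
    | neg t iht => intro hn; simp only [vars_neg] at hn; simp [iht hn]
    | empty => simp
  | fn h1 h2 _ _ _ ih₁ ih₂ ih₃ =>
    intro t
    induction t using stripInduction with
    | basic b => simp
    | poly n => intro hn; simpa [Dom.label] using (h1 n (by simpa using hn)).symm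
    | mono n => intro hn; simpa [Dom.label] using (h2 n).symm
    | prod s t => simp
    | arrow s t =>
      intro hn
      simp only [vars_arrow, Set.union_subset_iff] at hn
      simp [fun i => ih₁ i s hn.1, fun i => ih₂ i t hn.2, fun i => ih₃ i s hn.1]
    | union s t ihs iht =>
      intro hn
      simp only [vars_union, Set.union_subset_iff] at hn
      simp [ihs hn.1, iht hn.2]
    | neg t iht => intro hn; simp only [vars_neg] at hn; simp [iht hn]
    | empty => simp

theorem Sub.refl (t : Ty S) : Sub t t := fun _ h => h
theorem Sub.trans {r s t : Ty S} (h : Sub r s) (h' : Sub s t) : Sub r t := fun d hd => h' d (h d hd)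

/-- An element refuting the instance becomes, after relabelling, an element refuting the original
subtyping. -/
theorem Sub.subst {s t : Ty S} (h : Sub s t) (σ : ℕ → Ty S) : Sub (s.subst σ) (t.subst σ) := by
  intro d hd
  obtain ⟨d', hd'⟩ := exists_relabel σ (s.finite_vars.union t.finite_vars) d
  rw [hd'.mem_iff _ Set.subset_union_left] at hd
  rw [hd'.mem_iff _ Set.subset_union_right]
  exact h _ hd

theorem Relabel.congr {V : Set ℕ} {σ τ : ℕ → Ty S} (hστ : ∀ n ∈ V, ∀ d : Dom S,
    d.Mem (σ n) ↔ d.Mem (τ n)) {d d' : Dom S} (h : Relabel V σ d d') : Relabel V τ d d' := by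
  induction h with
  | const h1 h2 => exact .const (fun n hn => (h1 n hn).trans (hστ n hn _)) h2
  | pair h1 h2 _ _ ih₁ ih₂ => exact .pair (fun n hn => (h1 n hn).trans (hστ n hn _)) h2 ih₁ ih₂
  | fn h1 h2 _ _ _ ih₁ ih₂ ih₃ =>
    exact .fn (fun n hn => (h1 n hn).trans (hστ n hn _)) h2 ih₁ ih₂ ih₃

theorem Relabel.refl (V : Set ℕ) (d : Dom S) : Relabel V poly d d := by
  induction d with
  | const c L => exact .const (fun n _ => by simp [Dom.label]) (fun _ => Iff.rfl)
  | pair d₁ d₂ L ih₁ ih₂ => exact .pair (fun n _ => by simp [Dom.label]) (fun _ => Iff.rfl) ih₁ ih₂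
  | fn arg res bad L ih₁ ih₂ ih₃ =>
    exact .fn (fun n _ => by simp [Dom.label]) (fun _ => Iff.rfl) ih₁ ih₂ ih₃

theorem mem_subst_congr {σ τ : ℕ → Ty S} (t : Ty S)
    (h : ∀ n ∈ t.vars, ∀ d : Dom S, d.Mem (σ n) ↔ d.Mem (τ n)) (d : Dom S) :
    d.Mem (t.subst σ) ↔ d.Mem (t.subst τ) := by
  obtain ⟨d', hd'⟩ := exists_relabel σ t.finite_vars d
  rw [hd'.mem_iff _ le_rfl, (hd'.congr h).mem_iff _ le_rfl]

theorem mem_subst_poly (t : Ty S) (d : Dom S) : d.Mem (t.subst poly) ↔ d.Mem t :=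
  (Relabel.refl Set.univ d).mem_iff t (Set.subset_univ _)

theorem IsMono.mem_subst {t : Ty S} (ht : t.IsMono) (σ : ℕ → Ty S) (d : Dom S) :
    d.Mem (t.subst σ) ↔ d.Mem t := by
  rw [← mem_subst_poly t d]
  exact mem_subst_congr t (fun n hn => absurd hn (ht n)) d

/-- The composition law is needed only up to equivalence, so the double induction on elements and
Boolean structure replaces a bisimulation of trees. -/
theorem mem_subst_subst (σ τ : ℕ → Ty S) (d : Dom S) : ∀ t : Ty S,
    d.Mem ((t.subst σ).subst τ) ↔ d.Mem (t.subst fun n => (σ n).subst τ) := by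
  induction d with
  | const c L => intro t; induction t using stripInduction <;> simp [*]
  | pair d₁ d₂ L ih₁ ih₂ => intro t; induction t using stripInduction <;> simp [*]
  | fn arg res bad L ih₁ ih₂ ih₃ => intro t; induction t using stripInduction <;> simp [*]

end Ty

namespace Ty

variable {S : Signature.{u}}

/-! ## Existence of domain, application and projection operators -/

/-- A set of elements that only depends on membership in finitely many types is a type. -/
theorem exists_ty_of_invariant (l : List (Ty S)) : ∀ X : Set (Dom S),
    (∀ d d', (∀ t ∈ l, d.Mem t ↔ d'.Mem t) → d ∈ X → d' ∈ X) →
      ∃ t : Ty S, ∀ d : Dom S, d.Mem t ↔ d ∈ X := by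
  induction l with
  | nil =>
    intro X hX
    by_cases h : ∃ d, d ∈ X
    · obtain ⟨d₀, h₀⟩ := h
      exact ⟨any, fun d => by simpa using hX d₀ d (by simp) h₀⟩
    · exact ⟨empty, fun d => by simpa using fun h' => h ⟨d, h'⟩⟩
  | cons a l ih =>
    intro X hX
    -- The part of `X` inside `a` (for `True`) or outside `a` (for `False`), saturated under
    -- agreement on `l`. Both parts are types by induction, and `X` is recovered by a case split on
    -- `a`.
    have key : ∀ p : Prop, ∃ t : Ty S, ∀ d : Dom S, d.Mem t ↔
        ∃ d₀ ∈ X, (d₀.Mem a ↔ p) ∧ ∀ t ∈ l, d₀.Mem t ↔ d.Mem t := by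
      intro p
      refine ih {d | ∃ d₀ ∈ X, (d₀.Mem a ↔ p) ∧ ∀ t ∈ l, d₀.Mem t ↔ d.Mem t} ?_
      rintro d d' h ⟨d₀, h₀, h1, h2⟩
      exact ⟨d₀, h₀, h1, fun t ht => (h2 t ht).trans (h t ht)⟩
    obtain ⟨t₁, h₁⟩ := key True
    obtain ⟨t₂, h₂⟩ := key False
    refine ⟨(a.inter t₁).union (a.neg.inter t₂), fun d => ?_⟩
    simp only [Dom.mem_union, Dom.mem_inter, Dom.mem_neg, h₁, h₂]
    constructor
    · rintro (⟨ha, d₀, h₀, h1, h2⟩ | ⟨ha, d₀, h₀, h1, h2⟩) <;> refine hX d₀ d ?_ h₀ <;>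
        simp only [List.mem_cons, forall_eq_or_imp] <;> exact ⟨by simp [h1, ha], h2⟩
    · intro hd
      by_cases ha : d.Mem a
      · exact Or.inl ⟨ha, d, hd, by simp [ha], fun _ _ => Iff.rfl⟩
      · exact Or.inr ⟨ha, d, hd, by simp [ha], fun _ _ => Iff.rfl⟩

/-- Membership of a functional element only depends on finitely many arrow types. -/
theorem exists_arrows (t : Ty S) : ∃ l : List (Ty S × Ty S), ∀ {m k m' k' : ℕ}
    (arg res : Fin m → Dom S) (bad : Fin k → Dom S) (arg' res' : Fin m' → Dom S)
    (bad' : Fin k' → Dom S) (L),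
    (∀ p ∈ l, (Dom.fn arg res bad L).Mem (arrow p.1 p.2) ↔
      (Dom.fn arg' res' bad' L).Mem (arrow p.1 p.2)) →
    ((Dom.fn arg res bad L).Mem t ↔ (Dom.fn arg' res' bad' L).Mem t) := by
  induction t using stripInduction with
  | basic b => exact ⟨[], by simp⟩
  | poly n => exact ⟨[], by simp [Dom.label]⟩
  | mono n => exact ⟨[], by simp [Dom.label]⟩
  | arrow s t => exact ⟨[(s, t)], fun _ _ _ _ _ _ _ h => h _ (List.mem_singleton_self _)⟩
  | prod s t => exact ⟨[], by simp⟩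
  | union s t ihs iht =>
    obtain ⟨l₁, h₁⟩ := ihs
    obtain ⟨l₂, h₂⟩ := iht
    refine ⟨l₁ ++ l₂, fun a r b a' r' b' L h => ?_⟩
    rw [Dom.mem_union, Dom.mem_union, h₁ a r b a' r' b' L fun p hp => h p (by simp [hp]),
      h₂ a r b a' r' b' L fun p hp => h p (by simp [hp])]
  | neg t iht =>
    obtain ⟨l, h⟩ := iht
    refine ⟨l, fun a r b a' r' b' L h' => ?_⟩
    rw [Dom.mem_neg, Dom.mem_neg, h a r b a' r' b' L h']
  | empty => exact ⟨[], by simp⟩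

/-- Membership of a pair only depends on finitely many product types. -/
theorem exists_prods (t : Ty S) : ∃ l : List (Ty S × Ty S), ∀ (d₁ d₂ d₁' d₂' : Dom S) (L),
    (∀ p ∈ l, (Dom.pair d₁ d₂ L).Mem (prod p.1 p.2) ↔ (Dom.pair d₁' d₂' L).Mem (prod p.1 p.2)) →
    ((Dom.pair d₁ d₂ L).Mem t ↔ (Dom.pair d₁' d₂' L).Mem t) := by
  induction t using stripInduction with
  | basic b => exact ⟨[], by simp⟩
  | poly n => exact ⟨[], by simp [Dom.label]⟩
  | mono n => exact ⟨[], by simp [Dom.label]⟩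
  | prod s t => exact ⟨[(s, t)], fun _ _ _ _ _ h => h _ (List.mem_singleton_self _)⟩
  | arrow s t => exact ⟨[], by simp⟩
  | union s t ihs iht =>
    obtain ⟨l₁, h₁⟩ := ihs
    obtain ⟨l₂, h₂⟩ := iht
    refine ⟨l₁ ++ l₂, fun a r b a' L h => ?_⟩
    rw [Dom.mem_union, Dom.mem_union, h₁ a r b a' L fun p hp => h p (by simp [hp]),
      h₂ a r b a' L fun p hp => h p (by simp [hp])]
  | neg t iht =>
    obtain ⟨l, h⟩ := iht
    refine ⟨l, fun a r b a' L h' => ?_⟩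
    rw [Dom.mem_neg, Dom.mem_neg, h a r b a' L h']
  | empty => exact ⟨[], by simp⟩

theorem mem_arrow_iff {d : Dom S} {s t : Ty S} : d.Mem (arrow s t) ↔
    ∃ (m k : ℕ) (arg res : Fin m → Dom S) (bad : Fin k → Dom S) (L : _),
      d = .fn arg res bad L ∧ (∀ i, (arg i).Mem s → (res i).Mem t) ∧ ∀ j, ¬ (bad j).Mem s := by
  cases d with
  | const c L => simp
  | pair d₁ d₂ L => simp
  | fn arg res bad L =>
    rw [Dom.fn_mem_arrow]
    refine ⟨fun h => ⟨_, _, arg, res, bad, L, rfl, h⟩, ?_⟩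
    rintro ⟨m, k, a, r, b, L', h, h'⟩
    cases h
    exact h'

theorem mem_prod_iff {d : Dom S} {s t : Ty S} : d.Mem (prod s t) ↔
    ∃ d₁ d₂ L, d = .pair d₁ d₂ L ∧ d₁.Mem s ∧ d₂.Mem t := by
  cases d with
  | const c L => simp
  | fn arg res bad L => simp
  | pair d₁ d₂ L =>
    rw [Dom.pair_mem_prod]
    refine ⟨fun h => ⟨_, _, _, rfl, h⟩, ?_⟩
    rintro ⟨a, b, L', h, h'⟩
    cases h
    exact h'

theorem Sub.arrow {s s' t t' : Ty S} (hs : Sub s' s) (ht : Sub t t') :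
    Sub (arrow s t) (arrow s' t') := by
  intro d hd
  obtain ⟨m, k, arg, res, bad, L, rfl, h1, h2⟩ := mem_arrow_iff.1 hd
  rw [Dom.fn_mem_arrow]
  exact ⟨fun i hi => ht _ (h1 i (hs _ hi)), fun j hj => h2 j (hs _ hj)⟩

theorem Sub.prod {s s' t t' : Ty S} (hs : Sub s s') (ht : Sub t t') :
    Sub (prod s t) (prod s' t') := by
  intro d hd
  obtain ⟨d₁, d₂, L, rfl, h1, h2⟩ := mem_prod_iff.1 hd
  rw [Dom.pair_mem_prod]
  exact ⟨hs _ h1, ht _ h2⟩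

theorem sub_any (t : Ty S) : Sub t any := fun d _ => d.mem_any
theorem empty_sub (t : Ty S) : Sub empty t := fun d h => absurd h d.mem_empty

/-- The domain consists of the elements that no function in `t` sends to `Ω`. Exchanging such a bad
argument for an element with the same memberships in the sources of the finitely many arrows of `t`
keeps the function in `t`, so this set is a type. -/
theorem exists_isDom {t : Ty S} (h : Sub t (arrow empty any)) : ∃ d, IsDom t d := by
  obtain ⟨l, hl⟩ := exists_arrows t
  obtain ⟨r, hr⟩ := exists_ty_of_invariant (l.map Prod.fst)
    {d | ¬ ∃ (m k : ℕ) (arg res : Fin m → Dom S) (bad : Fin k → Dom S) (L : _) (j : Fin k),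
      (Dom.fn arg res bad L).Mem t ∧ bad j = d} (by
    rintro d d' hdd hd ⟨m, k, arg, res, bad, L, j, hm, rfl⟩
    refine hd ⟨m, k, arg, res, Function.update bad j d, L, j, ?_, by simp⟩
    refine (hl _ _ _ _ _ _ _ fun p hp => ?_).1 hm
    simp only [Dom.fn_mem_arrow]
    refine and_congr_right fun _ => forall_congr' fun j' => not_congr ?_
    by_cases hj : j' = j
    · subst hj; simpa using (hdd p.1 (List.mem_map_of_mem hp)).symm
    · simp [hj])
  refine ⟨r, fun d hd => ?_, fun u hu d hd => (hr d).2 ?_⟩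
  · obtain ⟨m, k, arg, res, bad, L, rfl, -⟩ := mem_arrow_iff.1 (h d hd)
    rw [Dom.fn_mem_arrow]
    exact ⟨fun i _ => Dom.mem_any _, fun j hj => (hr _).1 hj ⟨m, k, arg, res, bad, L, j, hd, rfl⟩⟩
  · rintro ⟨m, k, arg, res, bad, L, j, hm, rfl⟩
    exact ((Dom.fn_mem_arrow _ _ _ _ _ _).1 (hu _ hm)).2 j hd

/-- The result consists of all values taken on arguments from `s` by functions in `t`. It is a type
because a value can be exchanged for any element with the same memberships in the targets of the
arrows of `t`. -/
theorem exists_isApply {t s : Ty S} (h : Sub t (arrow s any)) : ∃ r, IsApply t s r := by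
  obtain ⟨l, hl⟩ := exists_arrows t
  obtain ⟨r, hr⟩ := exists_ty_of_invariant (l.map Prod.snd)
    {d | ∃ (m k : ℕ) (arg res : Fin m → Dom S) (bad : Fin k → Dom S) (L : _) (i : Fin m),
      (Dom.fn arg res bad L).Mem t ∧ (arg i).Mem s ∧ res i = d} (by
    rintro d d' hdd ⟨m, k, arg, res, bad, L, i, hm, hs, rfl⟩
    refine ⟨m, k, arg, Function.update res i d', bad, L, i, ?_, hs, by simp⟩
    refine (hl _ _ _ _ _ _ _ fun p hp => ?_).1 hm
    simp only [Dom.fn_mem_arrow]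
    refine and_congr_left fun _ => forall_congr' fun i' => imp_congr_right fun _ => ?_
    by_cases hi : i' = i
    · subst hi; simpa using hdd p.2 (List.mem_map_of_mem hp)
    · simp [hi])
  refine ⟨r, fun d hd => ?_, fun u hu d hd => ?_⟩
  · obtain ⟨m, k, arg, res, bad, L, rfl, -, h2⟩ := mem_arrow_iff.1 (h d hd)
    rw [Dom.fn_mem_arrow]
    exact ⟨fun i hi => (hr _).2 ⟨m, k, arg, res, bad, L, i, hd, hi, rfl⟩, h2⟩
  · obtain ⟨m, k, arg, res, bad, L, i, hm, hs, rfl⟩ := (hr d).1 hd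
    exact ((Dom.fn_mem_arrow _ _ _ _ _ _).1 (hu _ hm)).1 i hs

theorem exists_isProj₁ {t : Ty S} (h : Sub t (prod any any)) : ∃ r, IsProj₁ t r := by
  obtain ⟨l, hl⟩ := exists_prods t
  obtain ⟨r, hr⟩ := exists_ty_of_invariant (l.map Prod.fst)
    {d | ∃ d₂ L, (Dom.pair d d₂ L).Mem t} (by
    rintro d d' hdd ⟨d₂, L, hm⟩
    refine ⟨d₂, L, (hl _ _ _ _ _ fun p hp => ?_).1 hm⟩
    simp only [Dom.pair_mem_prod]
    exact and_congr_left fun _ => hdd p.1 (List.mem_map_of_mem hp))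
  refine ⟨r, fun d hd => ?_, fun u hu d hd => ?_⟩
  · obtain ⟨d₁, d₂, L, rfl, -⟩ := mem_prod_iff.1 (h d hd)
    exact (Dom.pair_mem_prod _ _ _ _ _).2 ⟨(hr _).2 ⟨_, _, hd⟩, Dom.mem_any _⟩
  · obtain ⟨d₂, L, hm⟩ := (hr d).1 hd
    exact ((Dom.pair_mem_prod _ _ _ _ _).1 (hu _ hm)).1

theorem exists_isProj₂ {t : Ty S} (h : Sub t (prod any any)) : ∃ r, IsProj₂ t r := by
  obtain ⟨l, hl⟩ := exists_prods t
  obtain ⟨r, hr⟩ := exists_ty_of_invariant (l.map Prod.snd)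
    {d | ∃ d₁ L, (Dom.pair d₁ d L).Mem t} (by
    rintro d d' hdd ⟨d₁, L, hm⟩
    refine ⟨d₁, L, (hl _ _ _ _ _ fun p hp => ?_).1 hm⟩
    simp only [Dom.pair_mem_prod]
    exact and_congr_right fun _ => hdd p.2 (List.mem_map_of_mem hp))
  refine ⟨r, fun d hd => ?_, fun u hu d hd => ?_⟩
  · obtain ⟨d₁, d₂, L, rfl, -⟩ := mem_prod_iff.1 (h d hd)
    exact (Dom.pair_mem_prod _ _ _ _ _).2 ⟨Dom.mem_any _, (hr _).2 ⟨_, _, hd⟩⟩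
  · obtain ⟨d₁, L, hm⟩ := (hr d).1 hd
    exact ((Dom.pair_mem_prod _ _ _ _ _).1 (hu _ hm)).2

/-! ## Polymorphic subtyping -/

theorem mem_inst {t : Ty S} {θs : List (ℕ → Ty S)} {d : Dom S} :
    d.Mem (t.inst θs) ↔ ∀ σ ∈ θs, d.Mem (t.subst σ) := by
  simp [inst, Dom.mem_bigInter]

theorem mem_inst_subst {t : Ty S} {θs : List (ℕ → Ty S)} {σ : ℕ → Ty S} {d : Dom S} :
    d.Mem ((t.inst θs).subst σ) ↔ ∀ τ ∈ θs, d.Mem (t.subst fun n => (τ n).subst σ) := by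
  simp [inst, subst_bigInter, Dom.mem_bigInter, mem_subst_subst]

theorem inst_poly_sub (t : Ty S) : Sub (t.inst [poly]) t := fun d hd =>
  (mem_subst_poly t d).1 (mem_inst.1 hd _ (List.mem_singleton_self _))

theorem Sub.inst {s t : Ty S} (h : Sub s t) (θs : List (ℕ → Ty S)) :
    Sub (s.inst θs) (t.inst θs) := fun d hd =>
  mem_inst.2 fun σ hσ => h.subst σ d (mem_inst.1 hd σ hσ)

theorem Sub.polySub {s t : Ty S} (h : Sub s t) : PolySub s t := ⟨[poly], (inst_poly_sub s).trans h⟩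

theorem PolySub.refl (t : Ty S) : PolySub t t := (Sub.refl t).polySub

/-- Instances of instances are instances. -/
theorem exists_inst_sub_inst_inst (t : Ty S) (θs θs' : List (ℕ → Ty S)) :
    ∃ θs'', Sub (t.inst θs'') ((t.inst θs).inst θs') := by
  refine ⟨θs'.flatMap fun σ => θs.map fun τ n => (τ n).subst σ, fun d hd => ?_⟩
  refine mem_inst.2 fun σ hσ => mem_inst_subst.2 fun τ hτ => mem_inst.1 hd _ ?_
  exact List.mem_flatMap.2 ⟨σ, hσ, List.mem_map.2 ⟨τ, hτ, rfl⟩⟩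

theorem PolySub.exists_inst_sub_inst {s t : Ty S} (h : PolySub s t) (θs : List (ℕ → Ty S)) :
    ∃ θs', Sub (s.inst θs') (t.inst θs) := by
  obtain ⟨θs₁, h₁⟩ := h
  obtain ⟨θs₂, h₂⟩ := exists_inst_sub_inst_inst s θs₁ θs
  exact ⟨θs₂, h₂.trans (h₁.inst θs)⟩

theorem PolySub.trans {r s t : Ty S} (h : PolySub r s) (h' : PolySub s t) : PolySub r t := by
  obtain ⟨θs, h₁⟩ := h'
  obtain ⟨θs', h₂⟩ := h.exists_inst_sub_inst θs
  exact ⟨θs', h₂.trans h₁⟩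

theorem PolySub.trans_sub {r s t : Ty S} (h : PolySub r s) (h' : Sub s t) : PolySub r t :=
  h.trans h'.polySub

theorem polySub_subst (t : Ty S) (σ : ℕ → Ty S) : PolySub t (t.subst σ) :=
  ⟨[σ], fun _ hd => mem_inst.1 hd _ (List.mem_singleton_self _)⟩

/-- Instantiation with a left inverse undoes an injective renaming. -/
theorem rename_polySub (t : Ty S) {ρ : ℕ → ℕ} (hρ : Function.Injective ρ) :
    PolySub (t.rename ρ) t := by
  refine ⟨[fun n => poly (Function.invFun ρ n)], fun d hd => ?_⟩
  have := mem_inst.1 hd _ (List.mem_singleton_self _)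
  rw [rename, mem_subst_subst] at this
  refine (mem_subst_poly t d).1 ((mem_subst_congr t (fun n _ d => ?_) d).1 this)
  rw [subst_poly, Function.leftInverse_invFun hρ]

/-- The empty intersection is `any`, which is below no arrow or product. Adding the identity
substitution only shrinks the intersection and excludes this case. -/
theorem PolySub.exists_ne_nil {s t : Ty S} (h : PolySub s t) :
    ∃ θs ≠ [], Sub (s.inst θs) t := by
  obtain ⟨θs, h⟩ := h
  exact ⟨poly :: θs, by simp, fun d hd => h d (mem_inst.2 fun σ hσ =>
    mem_inst.1 hd σ (List.mem_cons_of_mem _ hσ))⟩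

theorem PolySub.inter_right {r s t : Ty S} (h : PolySub r s) (h' : PolySub r t) :
    PolySub r (s.inter t) := by
  obtain ⟨θs, h⟩ := h
  obtain ⟨θs', h'⟩ := h'
  refine ⟨θs ++ θs', fun d hd => (Dom.mem_inter _ _ _).2 ⟨h d ?_, h' d ?_⟩⟩ <;>
    exact mem_inst.2 fun σ hσ => mem_inst.1 hd σ (by simp [hσ])

theorem PolySub.bigInter_right {r : Ty S} {l : List (Ty S)} (h : ∀ t ∈ l, PolySub r t) :
    PolySub r (bigInter l) := by
  induction l with
  | nil => exact (sub_any r).polySub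
  | cons a l ih =>
    simp only [List.mem_cons, forall_eq_or_imp] at h
    exact h.1.inter_right (ih h.2)

theorem inter_sub_left (s t : Ty S) : Sub (s.inter t) s := fun _ hd => ((Dom.mem_inter _ _ _).1 hd).1
theorem inter_sub_right (s t : Ty S) : Sub (s.inter t) t := fun _ hd => ((Dom.mem_inter _ _ _).1 hd).2

theorem bigInter_sub {l : List (Ty S)} {t : Ty S} (h : t ∈ l) : Sub (bigInter l) t := fun _ hd =>
  (Dom.mem_bigInter _ _).1 hd t h
theorem sub_bigUnion {l : List (Ty S)} {t : Ty S} (h : t ∈ l) : Sub t (bigUnion l) := fun d hd =>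
  (Dom.mem_bigUnion d _).2 ⟨t, h, hd⟩

theorem PolySub.inter_mono {s t : Ty S} (m : Ty S) (h : PolySub s t) :
    PolySub (s.inter m) (t.inter m) := by
  refine ((inter_sub_left s m).polySub.trans h).inter_right (inter_sub_right s m).polySub

/-- Substitutions do not affect `m`, so a non-empty intersection of instances of `m → s` is `m →`
the intersection of the instances of `s`. -/
theorem PolySub.arrow {s t m : Ty S} (hm : m.IsMono) (h : PolySub s t) :
    PolySub (m.arrow s) (m.arrow t) := by
  obtain ⟨θs, h0, h⟩ := h.exists_ne_nil
  obtain ⟨τ, hτ⟩ := List.exists_mem_of_ne_nil _ h0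
  refine ⟨θs, fun d hd => ?_⟩
  simp only [mem_inst, subst_arrow] at hd
  obtain ⟨_, _, arg, res, bad, L, rfl, -⟩ := mem_arrow_iff.1 (hd τ hτ)
  simp only [Dom.fn_mem_arrow, hm.mem_subst] at hd ⊢
  exact ⟨fun i hi => h _ (mem_inst.2 fun σ hσ => (hd σ hσ).1 i hi), (hd τ hτ).2⟩

/-- The renaming of variables by copies of index `i`. -/
def copy (i : ℕ) : Renaming := ⟨Nat.pair i, fun m n h => by simpa using h⟩

theorem mem_copy_subst {t : Ty S} (f : ℕ → ℕ → Ty S) (i : ℕ) (d : Dom S) :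
    d.Mem ((t.rename (copy i).1).subst fun n => f n.unpair.1 n.unpair.2) ↔
      d.Mem (t.subst (f i)) := by
  rw [rename, mem_subst_subst]
  refine mem_subst_congr t (fun n _ d => ?_) d
  simp [copy]

/-- After renaming apart, a single substitution acts as any chosen `σ` on the left and any chosen
`σ'` on the right. The intersection over all pairs therefore gives both components all of their
instances. -/
theorem PolySub.prod {s s' t t' : Ty S} (hs : PolySub s s') (ht : PolySub t t') :
    PolySub ((s.rename (copy 0).1).prod (t.rename (copy 1).1)) (s'.prod t') := by
  obtain ⟨θs, h0, h⟩ := hs.exists_ne_nil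
  obtain ⟨θs', h0', h'⟩ := ht.exists_ne_nil
  obtain ⟨τ, hτ⟩ := List.exists_mem_of_ne_nil _ h0
  obtain ⟨τ', hτ'⟩ := List.exists_mem_of_ne_nil _ h0'
  refine ⟨θs.flatMap fun σ => θs'.map fun σ' n =>
    (if n.unpair.1 = 0 then σ else σ') n.unpair.2, fun d hd => ?_⟩
  have key : ∀ σ ∈ θs, ∀ σ' ∈ θs', ∃ d₁ d₂ L, d = .pair d₁ d₂ L ∧ d₁.Mem (s.subst σ) ∧
      d₂.Mem (t.subst σ') := by
    intro σ hσ σ' hσ'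
    have := mem_inst.1 hd _ (List.mem_flatMap.2 ⟨σ, hσ, List.mem_map.2 ⟨σ', hσ', rfl⟩⟩)
    rw [subst_prod] at this
    obtain ⟨d₁, d₂, L, rfl, h1, h2⟩ := mem_prod_iff.1 this
    rw [mem_copy_subst (fun i => if i = 0 then σ else σ')] at h1 h2
    exact ⟨d₁, d₂, L, rfl, by simpa using h1, by simpa using h2⟩
  obtain ⟨d₁, d₂, L, rfl, -⟩ := key τ hτ τ' hτ'
  refine (Dom.pair_mem_prod _ _ _ _ _).2 ⟨h _ (mem_inst.2 fun σ hσ => ?_),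
    h' _ (mem_inst.2 fun σ hσ => ?_)⟩
  · obtain ⟨_, _, _, h, h1, h2⟩ := key σ hσ τ' hτ'
    cases h
    exact h1
  · obtain ⟨_, _, _, h, h1, h2⟩ := key τ hτ σ hσ
    cases h
    exact h2

/-- Polymorphic subtyping for a union of types without common variables. -/
theorem PolySub.bigUnion_copy {n : ℕ} {s s' : Fin n → Ty S} {t : Ty S}
    (hs : ∀ i, PolySub (s i) t) (h : ∀ i : Fin n, Sub (s' i) ((s i).rename (copy i).1)) :
    PolySub (bigUnion (List.ofFn s')) t := by
  choose θs hθ using hs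
  -- One substitution for every choice `f`: on the variables of the `i`-th copy it acts as the
  -- substitution number `f i` of the `i`-th list. Variables of copies `≥ n` are irrelevant and get
  -- a default.
  let c : (∀ i, Fin (θs i).length) → ℕ → Ty S := fun f k =>
    if hk : k.unpair.1 < n then (θs ⟨_, hk⟩)[f ⟨_, hk⟩] k.unpair.2 else empty
  refine ⟨Finset.univ.toList.map c, fun d hd => ?_⟩
  by_contra hdt
  -- An element outside `t` misses some instance of each `s i`. Under the substitution that combines
  -- these choices it still lies in the union, hence in one of the instances that it misses.
  have h1 : ∀ i, ∃ j : Fin (θs i).length, ¬ d.Mem ((s i).subst (θs i)[j]) := by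
    intro i
    by_contra hc
    push Not at hc
    refine hdt (hθ i d (mem_inst.2 fun σ hσ => ?_))
    obtain ⟨j, hj, rfl⟩ := List.getElem_of_mem hσ
    exact hc ⟨j, hj⟩
  choose f hf using h1
  have h2 := mem_inst.1 hd (c f) (List.mem_map_of_mem (Finset.mem_toList.2 (Finset.mem_univ f)))
  rw [subst_bigUnion, Dom.mem_bigUnion] at h2
  obtain ⟨_, h3, h4⟩ := h2
  obtain ⟨_, h5, rfl⟩ := List.mem_map.1 h3
  obtain ⟨i, rfl⟩ := (List.mem_ofFn' _ _).1 h5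
  have h6 := (h i).subst (c f) d h4
  let g : ℕ → ℕ → Ty S := fun k l => if hk : k < n then (θs ⟨_, hk⟩)[f ⟨_, hk⟩] l else empty
  have h7 := (mem_copy_subst g i d).1 h6
  refine hf i ?_
  have : g i = (θs i)[f i] := by funext l; simp [g]
  rwa [this] at h7

/-! ## Types that are invariant under substitution -/

/-- Every instance of the type is equivalent to it. -/
def Invariant (t : Ty S) : Prop := ∀ (σ : ℕ → Ty S) (d : Dom S), d.Mem (t.subst σ) ↔ d.Mem t

/-- The converse inclusion follows from the hypothesis for one renaming `e` to fresh variables.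
Applying `e` to `t ≤ t e` gives `t e ≤ t`, and the fresh copies can then be instantiated at will
while `t` stays fixed. -/
theorem invariant_of_sub {t : Ty S} (h : ∀ σ, Sub t (t.subst σ)) : t.Invariant := by
  obtain ⟨N, hN⟩ := t.finite_vars.bddAbove
  -- Exchanges `n ≤ N` with `n + (N + 1)`, so that on the variables of `t` applying it twice is the
  -- identity.
  let e : ℕ → Ty S := fun n => if n < N + 1 then poly (n + (N + 1)) else poly (n - (N + 1))
  have h1 : ∀ d : Dom S, d.Mem (t.subst e) → d.Mem t := by
    intro d hd
    have h2 := (h e).subst e d hd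
    rw [mem_subst_subst] at h2
    refine (mem_subst_poly t d).1 ((mem_subst_congr t (fun n hn d => ?_) d).1 h2)
    simp [e, (hN hn : n ≤ N), show ¬ n + (N + 1) ≤ N by omega]
  have h3 : ∀ (σ : ℕ → Ty S), Sub (t.subst σ) t := by
    intro σ d hd
    -- Fixes the variables of `t` and acts as `σ` on their copies, turning `t e ≤ t` into `t σ ≤ t`.
    let σ' : ℕ → Ty S := fun n => if n < N + 1 then poly n else σ (n - (N + 1))
    have h4 : Sub (t.subst e) t := h1
    have h5 : d.Mem ((t.subst e).subst σ') := by
      rw [mem_subst_subst]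
      refine (mem_subst_congr t (fun n hn d => ?_) d).1 hd
      simp [e, σ', (hN hn : n ≤ N), show ¬ n + (N + 1) ≤ N by omega]
    refine (mem_subst_poly t d).1 ((mem_subst_congr t (fun n hn d => ?_) d).1 (h4.subst σ' d h5))
    simp [σ', (hN hn : n ≤ N)]
  exact fun σ d => ⟨h3 σ d, h σ d⟩

theorem Invariant.inst {t : Ty S} (h : t.Invariant) (θs : List (ℕ → Ty S)) :
    (t.inst θs).Invariant := fun σ d => by
  rw [mem_inst_subst, mem_inst]
  exact forall₂_congr fun τ _ => by rw [h, h]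

/-- Every instance of `s` contains `s`, and so does any intersection of instances. -/
theorem Invariant.sub_of_polySub {s t : Ty S} (h : s.Invariant) (h' : PolySub s t) : Sub s t := by
  obtain ⟨θs, h'⟩ := h'
  exact fun d hd => h' d (mem_inst.2 fun σ _ => (h σ d).2 hd)

end Ty

/-! ## Renaming and substitution of expressions -/

@[simp] theorem scons_zero {α : Type u} (a : α) (f : ℕ → α) : scons a f 0 = a := rfl
@[simp] theorem scons_succ {α : Type u} (a : α) (f : ℕ → α) (n : ℕ) : scons a f (n + 1) = f n := rfl
@[simp] theorem upr_zero (f : ℕ → ℕ) : upr f 0 = 0 := rfl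
@[simp] theorem upr_succ (f : ℕ → ℕ) (n : ℕ) : upr f (n + 1) = f n + 1 := rfl

theorem upr_id : upr id = id := by
  funext n; cases n <;> rfl

theorem upr_comp (f g : ℕ → ℕ) : upr (g ∘ f) = upr g ∘ upr f := by
  funext n; cases n <;> rfl

theorem upr_injective {f : ℕ → ℕ} (hf : Function.Injective f) : Function.Injective (upr f) := by
  intro m n h
  cases m <;> cases n <;> simp at h ⊢
  exact hf h

namespace Expr

variable {S : Signature.{u}}

theorem rename_rename (e : Expr S) : ∀ f g : ℕ → ℕ, (e.rename f).rename g = e.rename (g ∘ f) := by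
  induction e <;> intro f g <;> simp_all [rename, upr_comp]

theorem rename_id (e : Expr S) : e.rename id = e := by
  induction e <;> simp_all [rename, upr_id]

theorem rename_injective (e : Expr S) : ∀ {f : ℕ → ℕ}, Function.Injective f → ∀ e' : Expr S,
    e.rename f = e'.rename f → e = e' := by
  induction e with
  | lam e ih =>
    intro f hf e' h
    cases e' <;> simp only [rename, reduceCtorEq, lam.injEq] at h ⊢
    exact ih (upr_injective hf) _ h
  | _ =>
    intro f hf e' h
    cases e' <;> simp only [rename, reduceCtorEq, const.injEq, var.injEq, app.injEq, pair.injEq,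
      proj₁.injEq, proj₂.injEq, tcase.injEq] at h ⊢
    all_goals grind [Function.Injective]

theorem shift_rename (e : Expr S) (f : ℕ → ℕ) : e.shift.rename (upr f) = (e.rename f).shift := by
  simp only [shift, rename_rename]; rfl

theorem shift_injective : Function.Injective (shift : Expr S → Expr S) :=
  fun e e' h => rename_injective e Nat.succ_injective e' h

theorem rename_subst (e : Expr S) : ∀ (f : ℕ → ℕ) (θ : ℕ → Expr S),
    (e.rename f).subst θ = e.subst (θ ∘ f) := by
  induction e with
  | lam e ih =>
    intro f θ
    simp only [rename, subst, ih]
    congr 2; funext n; cases n <;> rfl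
  | _ => intro f θ; simp_all [rename, subst]

theorem subst_rename (e : Expr S) : ∀ (f : ℕ → ℕ) (θ : ℕ → Expr S),
    (e.subst θ).rename f = e.subst fun n => (θ n).rename f := by
  induction e with
  | lam e ih =>
    intro f θ
    simp only [rename, subst, ih]
    congr 2; funext n; cases n
    · rfl
    · exact shift_rename _ _
  | _ => intro f θ; simp_all [rename, subst]

theorem shift_subst (e : Expr S) (e' : Expr S) (θ : ℕ → Expr S) :
    e.shift.subst (scons e' θ) = e.subst θ := rename_subst _ _ _

theorem subst_subst (e : Expr S) : ∀ θ η : ℕ → Expr S,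
    (e.subst θ).subst η = e.subst fun n => (θ n).subst η := by
  induction e with
  | lam e ih =>
    intro θ η
    simp only [subst, ih]
    congr 2; funext n; cases n
    · rfl
    · simp only [scons_succ, shift_subst]
      simp only [shift, subst_rename]
  | _ => intro f θ; simp_all [subst]

theorem subst_var (e : Expr S) : e.subst var = e := by
  induction e with
  | lam e ih =>
    simp only [subst]
    have : (scons (var 0) fun n => (var n : Expr S).shift) = var := by
      funext n; cases n <;> rfl
    rw [this, ih]
  | _ => simp_all [subst]

theorem inst_subst (e e' : Expr S) (θ : ℕ → Expr S) :
    (e.inst e').subst θ = e.subst (scons (e'.subst θ) θ) := by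
  rw [inst, subst_subst]
  congr 1; funext n; cases n <;> rfl

/-! ## Free variables and sub-expressions -/

/-- Free variables of an expression. -/
def FV : Expr S → Set ℕ
  | const _ => ∅
  | var n => {n}
  | lam e => {n | n + 1 ∈ e.FV}
  | app e₁ e₂ => e₁.FV ∪ e₂.FV
  | pair e₁ e₂ => e₁.FV ∪ e₂.FV
  | proj₁ e => e.FV
  | proj₂ e => e.FV
  | tcase e _ e₁ e₂ => e.FV ∪ (e₁.FV ∪ e₂.FV)

theorem mem_FV_rename (e : Expr S) : ∀ (f : ℕ → ℕ) (n : ℕ),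
    n ∈ (e.rename f).FV ↔ ∃ m ∈ e.FV, f m = n := by
  induction e with
  | lam e ih =>
    intro f n
    change n + 1 ∈ (e.rename (upr f)).FV ↔ ∃ m, m + 1 ∈ e.FV ∧ f m = n
    rw [ih]
    constructor
    · rintro ⟨m, hm, h⟩
      cases m with
      | zero => simp at h
      | succ m => exact ⟨m, hm, by simpa using h⟩
    · rintro ⟨m, hm, h⟩
      exact ⟨m + 1, hm, by simpa using h⟩
  | _ =>
    intro f n
    simp_all only [rename, FV, Set.mem_union, Set.mem_empty_iff_false, Set.mem_singleton_iff] <;>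
      grind

theorem exists_rename_eq (e : Expr S) : ∀ (f : ℕ → ℕ), (∀ n ∈ e.FV, n ∈ Set.range f) →
    ∃ e' : Expr S, e'.rename f = e := by
  induction e with
  | const c => exact fun f _ => ⟨const c, rfl⟩
  | var n =>
    intro f h
    obtain ⟨m, hm⟩ := h n rfl
    exact ⟨var m, congrArg var hm⟩
  | lam e ih =>
    intro f h
    obtain ⟨e', rfl⟩ := ih (upr f) (by
      rintro (_ | n) hn
      · exact ⟨0, rfl⟩
      · obtain ⟨m, hm⟩ := h n hn
        exact ⟨m + 1, by simp [hm]⟩)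
    exact ⟨lam e', rfl⟩
  | app e₁ e₂ ih₁ ih₂ =>
    intro f h
    obtain ⟨e₁', rfl⟩ := ih₁ f fun n hn => h n (Or.inl hn)
    obtain ⟨e₂', rfl⟩ := ih₂ f fun n hn => h n (Or.inr hn)
    exact ⟨app e₁' e₂', rfl⟩
  | pair e₁ e₂ ih₁ ih₂ =>
    intro f h
    obtain ⟨e₁', rfl⟩ := ih₁ f fun n hn => h n (Or.inl hn)
    obtain ⟨e₂', rfl⟩ := ih₂ f fun n hn => h n (Or.inr hn)
    exact ⟨pair e₁' e₂', rfl⟩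
  | proj₁ e ih =>
    intro f h
    obtain ⟨e', rfl⟩ := ih f h
    exact ⟨proj₁ e', rfl⟩
  | proj₂ e ih =>
    intro f h
    obtain ⟨e', rfl⟩ := ih f h
    exact ⟨proj₂ e', rfl⟩
  | tcase e τ e₁ e₂ ih ih₁ ih₂ =>
    intro f h
    obtain ⟨e', rfl⟩ := ih f fun n hn => h n (Or.inl hn)
    obtain ⟨e₁', rfl⟩ := ih₁ f fun n hn => h n (Or.inr (Or.inl hn))
    obtain ⟨e₂', rfl⟩ := ih₂ f fun n hn => h n (Or.inr (Or.inr hn))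
    exact ⟨tcase e' τ e₁' e₂', rfl⟩

theorem zero_notMem_FV_shift (e : Expr S) : 0 ∉ e.shift.FV := by
  rw [shift, mem_FV_rename]
  rintro ⟨m, _, h⟩
  cases h

theorem exists_shift_eq {e : Expr S} (h : 0 ∉ e.FV) : ∃ e' : Expr S, e'.shift = e := by
  refine exists_rename_eq e _ fun n hn => ?_
  cases n with
  | zero => exact absurd hn h
  | succ n => exact ⟨n, rfl⟩

/-- The sub-expressions of an expression whose free variables are free in the whole expression. -/
def Sb : Expr S → Set (Expr S)
  | const c => {const c}
  | var n => {var n}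
  | lam e => insert (lam e) {s | s.shift ∈ e.Sb}
  | app e₁ e₂ => insert (app e₁ e₂) (e₁.Sb ∪ e₂.Sb)
  | pair e₁ e₂ => insert (pair e₁ e₂) (e₁.Sb ∪ e₂.Sb)
  | proj₁ e => insert (proj₁ e) e.Sb
  | proj₂ e => insert (proj₂ e) e.Sb
  | tcase e τ e₁ e₂ => insert (tcase e τ e₁ e₂) (e.Sb ∪ (e₁.Sb ∪ e₂.Sb))

theorem mem_Sb_self (e : Expr S) : e ∈ e.Sb := by cases e <;> simp [Sb]

theorem finite_Sb (e : Expr S) : e.Sb.Finite := by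
  induction e with
  | lam e ih => exact (ih.preimage shift_injective.injOn).insert _
  | _ => simp_all [Sb]

theorem FV_of_mem_Sb (e : Expr S) : ∀ s ∈ e.Sb, s.FV ⊆ e.FV := by
  induction e with
  | lam e ih =>
    rintro s (rfl | hs)
    · exact le_rfl
    · exact fun n hn => ih _ hs ((mem_FV_rename _ _ _).2 ⟨n, hn, rfl⟩)
  | _ =>
    intro s hs
    simp only [Sb, Set.mem_insert_iff, Set.mem_union, Set.mem_singleton_iff] at hs
    intro n hn
    simp only [FV, Set.mem_union]
    grind [FV]

theorem rename_mem_Sb (e : Expr S) : ∀ (f : ℕ → ℕ), ∀ s ∈ e.Sb, s.rename f ∈ (e.rename f).Sb := by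
  induction e with
  | lam e ih =>
    rintro f s (rfl | hs)
    · exact mem_Sb_self _
    · refine Or.inr ?_
      have := ih (upr f) _ hs
      rwa [shift_rename] at this
  | _ =>
    intro f s hs
    simp only [rename, Sb, Set.mem_insert_iff, Set.mem_union, Set.mem_singleton_iff] at hs ⊢
    grind [rename]

theorem exists_of_mem_Sb_rename (e : Expr S) : ∀ (f : ℕ → ℕ), ∀ s ∈ (e.rename f).Sb,
    ∃ s' ∈ e.Sb, s'.rename f = s := by
  induction e with
  | lam e ih =>
    rintro f s (rfl | hs)
    · exact ⟨_, mem_Sb_self _, rfl⟩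
    · obtain ⟨s', hs', h⟩ := ih _ _ hs
      -- The renaming of `s'` is a weakening and `upr f` fixes `0`. Hence `s'` does not contain the
      -- bound variable and is itself a weakening.
      have h0 : 0 ∉ s'.FV := fun h0 => zero_notMem_FV_shift s
        (h ▸ (mem_FV_rename s' (upr f) 0).2 ⟨0, h0, rfl⟩)
      obtain ⟨s'', rfl⟩ := exists_shift_eq h0
      rw [shift_rename] at h
      exact ⟨s'', Or.inr hs', shift_injective h⟩
  | _ =>
    intro f s hs
    simp only [rename, Sb, Set.mem_insert_iff, Set.mem_union, Set.mem_singleton_iff] at hs ⊢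
    grind [rename]

theorem rename_mem_Sb_iff {f : ℕ → ℕ} (hf : Function.Injective f) {e s : Expr S} :
    s.rename f ∈ (e.rename f).Sb ↔ s ∈ e.Sb := by
  refine ⟨fun h => ?_, rename_mem_Sb e f s⟩
  obtain ⟨s', hs', h⟩ := exists_of_mem_Sb_rename e f _ h
  rwa [← rename_injective s' hf s h]

theorem Sb_trans (e : Expr S) : ∀ s ∈ e.Sb, s.Sb ⊆ e.Sb := by
  induction e with
  | lam e ih =>
    rintro s (rfl | hs)
    · exact le_rfl
    · exact fun r hr => Or.inr (ih _ hs (rename_mem_Sb _ _ _ hr))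
  | _ =>
    intro s hs
    simp only [Sb, Set.mem_insert_iff, Set.mem_union, Set.mem_singleton_iff] at hs
    intro n hn
    simp only [Sb, Set.mem_insert_iff, Set.mem_union, Set.mem_singleton_iff]
    grind [Sb]

/-- The number of constructors. -/
def size : Expr S → ℕ
  | const _ => 1
  | var _ => 1
  | lam e => e.size + 1
  | app e₁ e₂ => e₁.size + e₂.size + 1
  | pair e₁ e₂ => e₁.size + e₂.size + 1
  | proj₁ e => e.size + 1
  | proj₂ e => e.size + 1
  | tcase e _ e₁ e₂ => e.size + e₁.size + e₂.size + 1

theorem size_rename (e : Expr S) : ∀ f : ℕ → ℕ, (e.rename f).size = e.size := by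
  induction e <;> intro f <;> simp_all [rename, size]

theorem size_le_of_mem_Sb (e : Expr S) : ∀ s ∈ e.Sb, s.size ≤ e.size := by
  induction e with
  | lam e ih =>
    rintro s (rfl | hs)
    · exact le_rfl
    · have := ih _ hs
      rw [shift, size_rename] at this
      exact Nat.le_succ_of_le this
  | _ =>
    intro s hs
    simp only [Sb, Set.mem_insert_iff, Set.mem_union, Set.mem_singleton_iff] at hs
    simp only [size]
    grind [size]

theorem size_lt_of_mem_Sb (e s : Expr S) (hs : s ∈ e.Sb) (hne : s ≠ e) : s.size < e.size := by
  cases e with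
  | lam e =>
    rcases hs with rfl | hs
    · exact absurd rfl hne
    · have := size_le_of_mem_Sb e _ hs
      rw [shift, size_rename] at this
      exact Nat.lt_succ_of_le this
  | _ =>
    simp only [Sb, Set.mem_insert_iff, Set.mem_union, Set.mem_singleton_iff] at hs
    simp only [size]
    have key := fun e' : Expr S => size_le_of_mem_Sb e' s
    grind

end Expr

variable {S : Signature.{u}}

/-! ## Renaming and unwinding of canonical forms -/

mutual
theorem Atom.rename_rename (f g f' g' : ℕ → ℕ) : ∀ a : Atom S,
    (a.rename f g).rename f' g' = a.rename (f' ∘ f) (g' ∘ g)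
  | .const _ => rfl
  | .lvar _ => rfl
  | .lam κ => by
    simp only [Atom.rename, Canon.rename_rename (upr f) g (upr f') g' κ, upr_comp]
  | .pair _ _ => rfl
  | .app _ _ => rfl
  | .proj₁ _ => rfl
  | .proj₂ _ => rfl
  | .tcase _ _ _ _ => rfl

theorem Canon.rename_rename (f g f' g' : ℕ → ℕ) : ∀ κ : Canon S,
    (κ.rename f g).rename f' g' = κ.rename (f' ∘ f) (g' ∘ g)
  | .bvar _ => rfl
  | .bind a κ => by
    simp only [Canon.rename, Atom.rename_rename f g f' g' a,
      Canon.rename_rename f (upr g) f' (upr g') κ, upr_comp]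
end

mutual
theorem Atom.rename_id : ∀ a : Atom S, a.rename id id = a
  | .const _ => rfl
  | .lvar _ => rfl
  | .lam κ => by simp only [Atom.rename, upr_id, Canon.rename_id κ]
  | .pair _ _ => rfl
  | .app _ _ => rfl
  | .proj₁ _ => rfl
  | .proj₂ _ => rfl
  | .tcase _ _ _ _ => rfl

theorem Canon.rename_id : ∀ κ : Canon S, κ.rename id id = κ
  | .bvar _ => rfl
  | .bind a κ => by simp only [Canon.rename, upr_id, Atom.rename_id a, Canon.rename_id κ]
end

theorem Atom.shift_zero (a : Atom S) : a.shift 0 0 = a := Atom.rename_id a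

theorem Atom.shift_shift (a : Atom S) (l b l' b' : ℕ) :
    (a.shift l b).shift l' b' = a.shift (l + l') (b + b') := by
  simp only [Atom.shift, Atom.rename_rename]
  congr 1 <;> funext n <;> simp only [Function.comp] <;> omega

mutual
theorem Atom.unwind_rename (f g : ℕ → ℕ) (ρ ρ' : ℕ → Expr S)
    (h : ∀ x, ρ' (g x) = (ρ x).rename f) : ∀ a : Atom S,
    (a.rename f g).unwind ρ' = (a.unwind ρ).rename f
  | .const _ => rfl
  | .lvar _ => rfl
  | .lam κ => congrArg Expr.lam (Canon.unwind_rename (upr f) g _ _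
      (fun x => by rw [h, Expr.shift_rename]) κ)
  | .pair _ _ => by simp only [Atom.rename, Atom.unwind, Expr.rename, h]
  | .app _ _ => by simp only [Atom.rename, Atom.unwind, Expr.rename, h]
  | .proj₁ _ => by simp only [Atom.rename, Atom.unwind, Expr.rename, h]
  | .proj₂ _ => by simp only [Atom.rename, Atom.unwind, Expr.rename, h]
  | .tcase _ _ _ _ => by simp only [Atom.rename, Atom.unwind, Expr.rename, h]

theorem Canon.unwind_rename (f g : ℕ → ℕ) (ρ ρ' : ℕ → Expr S)
    (h : ∀ x, ρ' (g x) = (ρ x).rename f) : ∀ κ : Canon S,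
    (κ.rename f g).unwind ρ' = (κ.unwind ρ).rename f
  | .bvar x => h x
  | .bind a κ => Canon.unwind_rename f (upr g) _ _ (by
      intro x
      cases x with
      | zero => exact Atom.unwind_rename f g ρ ρ' h a
      | succ x => exact h x) κ
end

theorem Atom.unwind_shift (a : Atom S) {l b : ℕ} {ρ ρ' : ℕ → Expr S}
    (h : ∀ x, ρ' (x + b) = (ρ x).rename fun n => n + l) :
    (a.shift l b).unwind ρ' = (a.unwind ρ).rename fun n => n + l :=
  Atom.unwind_rename _ _ _ _ h a

theorem Atom.unwind_weaken (a : Atom S) (s : Expr S) (ρ : ℕ → Expr S) :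
    (a.shift 0 1).unwind (scons s ρ) = a.unwind ρ :=
  (a.unwind_shift (ρ := ρ) fun x => (Expr.rename_id (ρ x)).symm).trans (Expr.rename_id _)

theorem Atom.unwind_weaken_lam (a : Atom S) (ρ : ℕ → Expr S) :
    (a.shift 1 0).unwind (fun x => (ρ x).shift) = (a.unwind ρ).shift :=
  a.unwind_shift fun _ => rfl

mutual
theorem Atom.EqCan.unwind_eq {a a' : Atom S} : a.EqCan a' → ∀ ρ, a.unwind ρ = a'.unwind ρ
  | .refl _ => fun _ => rfl
  | .symm h => fun ρ => (h.unwind_eq ρ).symm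
  | .trans h h' => fun ρ => (h.unwind_eq ρ).trans (h'.unwind_eq ρ)
  | .lam h => fun _ => congrArg Expr.lam (h.unwind_eq _)

theorem Canon.EqCan.unwind_eq {κ κ' : Canon S} : κ.EqCan κ' → ∀ ρ, κ.unwind ρ = κ'.unwind ρ
  | .refl _ => fun _ => rfl
  | .symm h => fun ρ => (h.unwind_eq ρ).symm
  | .trans h h' => fun ρ => (h.unwind_eq ρ).trans (h'.unwind_eq ρ)
  | .bind h h' => fun ρ => by
    simp only [Canon.unwind]
    rw [h.unwind_eq ρ, h'.unwind_eq]
  | .swap a₁ a₂ κ => fun ρ => by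
    simp only [Canon.unwind, Atom.unwind_weaken]
    refine ((Canon.unwind_rename id _ (scons (a₂.unwind ρ) (scons (a₁.unwind ρ) ρ)) _ ?_ κ).trans
      (Expr.rename_id _)).symm
    rintro (_ | _ | x)
    · exact (Expr.rename_id _).symm
    · exact (Expr.rename_id _).symm
    · rw [Equiv.swap_apply_of_ne_of_ne (by omega) (by omega)]
      exact (Expr.rename_id _).symm
end

/-! ## Free variables of canonical forms -/

mutual
theorem Atom.exists_rename_eq (f g : ℕ → ℕ) : ∀ a : Atom S,
    (∀ n, Sum.inl n ∈ a.fv → n ∈ Set.range f) → (∀ x, Sum.inr x ∈ a.fv → x ∈ Set.range g) →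
      ∃ a' : Atom S, a'.rename f g = a
  | .const c => fun _ _ => ⟨.const c, rfl⟩
  | .lvar n => fun h _ => by
    obtain ⟨m, rfl⟩ := h n rfl
    exact ⟨.lvar m, rfl⟩
  | .lam κ => fun h h' => by
    obtain ⟨κ', rfl⟩ := Canon.exists_rename_eq (upr f) g κ (by
      rintro (_ | n) hn
      · exact ⟨0, rfl⟩
      · obtain ⟨m, rfl⟩ := h n hn
        exact ⟨m + 1, rfl⟩) fun x hx => h' x hx
    exact ⟨.lam κ', rfl⟩
  | .pair x y => fun _ h => by
    obtain ⟨x', rfl⟩ := h x (Or.inl rfl)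
    obtain ⟨y', rfl⟩ := h y (Or.inr rfl)
    exact ⟨.pair x' y', rfl⟩
  | .app x y => fun _ h => by
    obtain ⟨x', rfl⟩ := h x (Or.inl rfl)
    obtain ⟨y', rfl⟩ := h y (Or.inr rfl)
    exact ⟨.app x' y', rfl⟩
  | .proj₁ x => fun _ h => by
    obtain ⟨x', rfl⟩ := h x rfl
    exact ⟨.proj₁ x', rfl⟩
  | .proj₂ x => fun _ h => by
    obtain ⟨x', rfl⟩ := h x rfl
    exact ⟨.proj₂ x', rfl⟩
  | .tcase x τ y z => fun _ h => by
    obtain ⟨x', rfl⟩ := h x (Or.inl rfl)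
    obtain ⟨y', rfl⟩ := h y (Or.inr (Or.inl rfl))
    obtain ⟨z', rfl⟩ := h z (Or.inr (Or.inr rfl))
    exact ⟨.tcase x' τ y' z', rfl⟩

theorem Canon.exists_rename_eq (f g : ℕ → ℕ) : ∀ κ : Canon S,
    (∀ n, Sum.inl n ∈ κ.fv → n ∈ Set.range f) → (∀ x, Sum.inr x ∈ κ.fv → x ∈ Set.range g) →
      ∃ κ' : Canon S, κ'.rename f g = κ
  | .bvar x => fun _ h => by
    obtain ⟨x', rfl⟩ := h x rfl
    exact ⟨.bvar x', rfl⟩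
  | .bind a κ => fun h h' => by
    obtain ⟨a', rfl⟩ := Atom.exists_rename_eq f g a (fun n hn => h n (Or.inl hn))
      fun x hx => h' x (Or.inl hx)
    obtain ⟨κ', rfl⟩ := Canon.exists_rename_eq f (upr g) κ (fun n hn => h n (Or.inr hn)) (by
      rintro (_ | n) hn
      · exact ⟨0, rfl⟩
      · obtain ⟨m, rfl⟩ := h' n (Or.inr hn)
        exact ⟨m + 1, rfl⟩)
    exact ⟨.bind a' κ', rfl⟩
end

/-! ## A semantic description of maximal sharing forms -/

mutual
/-- `a.Good b ρ`: the atom `a` uses the binding variables `x < b`, standing for the expressions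
`ρ x`, and its body is a maximal sharing form. -/
def Atom.Good (b : ℕ) (ρ : ℕ → Expr S) : Atom S → Prop
  | .const _ => True
  | .lvar _ => True
  | .lam κ => κ.Good (fun s => 0 ∈ s.FV) b (fun x => (ρ x).shift)
  | .pair x₁ x₂ => x₁ < b ∧ x₂ < b
  | .app x₁ x₂ => x₁ < b ∧ x₂ < b
  | .proj₁ x => x < b
  | .proj₂ x => x < b
  | .tcase x _ x₁ x₂ => x < b ∧ x₁ < b ∧ x₂ < b

/-- The same for a canonical form, the bindings of which must stand for different sub-expressions
of the whole that satisfy `P`. -/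
def Canon.Good (P : Expr S → Prop) (b : ℕ) (ρ : ℕ → Expr S) : Canon S → Prop
  | .bvar x => x < b
  | .bind a κ => a.Good b ρ ∧ P (a.unwind ρ) ∧
      a.unwind ρ ∈ (κ.unwind (scons (a.unwind ρ) ρ)).Sb ∧
      κ.Good (fun s => P s ∧ s ≠ a.unwind ρ) (b + 1) (scons (a.unwind ρ) ρ)
end

/-- The expressions of the binding variables `x < b` are different, closed under
sub-expressions, and do not satisfy `P`. -/
structure Ctx (P : Expr S → Prop) (b : ℕ) (ρ : ℕ → Expr S) : Prop where
  inj : ∀ x < b, ∀ y < b, ρ x = ρ y → x = y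
  closed : ∀ x < b, ∀ s ∈ (ρ x).Sb, ∃ y < b, ρ y = s
  not_mem : ∀ x < b, ¬ P (ρ x)

theorem Ctx.lam {P : Expr S → Prop} {b : ℕ} {ρ : ℕ → Expr S} (h : Ctx P b ρ) :
    Ctx (fun s => 0 ∈ s.FV) b (fun x => (ρ x).shift) where
  inj x hx y hy hxy := h.inj x hx y hy (Expr.shift_injective hxy)
  closed x hx s hs := by
    obtain ⟨s', hs', rfl⟩ := Expr.exists_of_mem_Sb_rename _ _ _ hs
    obtain ⟨y, hy, rfl⟩ := h.closed x hx s' hs'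
    exact ⟨y, hy, rfl⟩
  not_mem x _ := Expr.zero_notMem_FV_shift _

mutual
-- Goodness speaks only of unwound expressions, and these are transformed by `f`. The equivalence
-- serves weakenings under both kinds of binder as well as the exchange of two bindings.
theorem Atom.good_rename_iff {f g : ℕ → ℕ} (hf : Function.Injective f) {b b' : ℕ}
    {ρ ρ' : ℕ → Expr S} (h : ∀ x, ρ' (g x) = (ρ x).rename f) (hb : ∀ x, g x < b' ↔ x < b) :
    ∀ a : Atom S, (a.rename f g).Good b' ρ' ↔ a.Good b ρ
  | .const _ => Iff.rfl
  | .lvar _ => Iff.rfl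
  | .lam κ => Canon.good_rename_iff (upr_injective hf)
      (fun x => by rw [h, Expr.shift_rename]) hb (fun s => by
        rw [Expr.mem_FV_rename]
        refine ⟨fun ⟨m, hm, h0⟩ => ?_, fun h0 => ⟨0, h0, rfl⟩⟩
        cases m with
        | zero => exact hm
        | succ m => cases h0) κ
  | .pair _ _ => by simp only [Atom.rename, Atom.Good, hb]
  | .app _ _ => by simp only [Atom.rename, Atom.Good, hb]
  | .proj₁ _ => by simp only [Atom.rename, Atom.Good, hb]
  | .proj₂ _ => by simp only [Atom.rename, Atom.Good, hb]
  | .tcase _ _ _ _ => by simp only [Atom.rename, Atom.Good, hb]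

theorem Canon.good_rename_iff {f g : ℕ → ℕ} (hf : Function.Injective f) {b b' : ℕ}
    {ρ ρ' : ℕ → Expr S} (h : ∀ x, ρ' (g x) = (ρ x).rename f) (hb : ∀ x, g x < b' ↔ x < b)
    {P P' : Expr S → Prop} (hP : ∀ s, P' (s.rename f) ↔ P s) :
    ∀ κ : Canon S, (κ.rename f g).Good P' b' ρ' ↔ κ.Good P b ρ
  | .bvar x => hb x
  | .bind a κ => by
    have h' : ∀ x, scons ((a.unwind ρ).rename f) ρ' (upr g x) =
        (scons (a.unwind ρ) ρ x).rename f := by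
      rintro (_ | x)
      · rfl
      · exact h x
    simp only [Canon.rename, Canon.Good, Atom.unwind_rename f g ρ ρ' h,
      Canon.unwind_rename f (upr g) _ _ h', Expr.rename_mem_Sb_iff hf, hP,
      Atom.good_rename_iff hf h hb a]
    refine and_congr_right fun _ => and_congr_right fun _ => and_congr_right fun _ =>
      Canon.good_rename_iff hf h' ?_ (fun s => ?_) κ
    · rintro (_ | x) <;> simp [hb]
    · exact and_congr (hP s) (not_congr ⟨fun h => Expr.rename_injective _ hf _ h,
        fun h => congrArg _ h⟩)
end

theorem Atom.good_weaken_iff (a : Atom S) {b : ℕ} {s : Expr S} {ρ : ℕ → Expr S} :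
    (a.shift 0 1).Good (b + 1) (scons s ρ) ↔ a.Good b ρ :=
  Atom.good_rename_iff (f := id) (g := Nat.succ) (fun _ _ h => h)
    (fun x => (Expr.rename_id (ρ x)).symm) (fun _ => Nat.succ_lt_succ_iff) a

theorem Atom.good_weaken_lam_iff (a : Atom S) {b : ℕ} {ρ : ℕ → Expr S} :
    (a.shift 1 0).Good b (fun x => (ρ x).shift) ↔ a.Good b ρ :=
  Atom.good_rename_iff (Nat.succ_injective) (fun _ => rfl) (fun _ => Iff.rfl) a

mutual
theorem Atom.Good.of_mem_fv {b : ℕ} {ρ : ℕ → Expr S} : ∀ {a : Atom S}, a.Good b ρ →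
    ∀ x, Sum.inr x ∈ a.fv → x < b ∧ ρ x ∈ (a.unwind ρ).Sb
  | .const _, _ => fun _ h => h.elim
  | .lvar _, _ => fun _ h => by cases h
  | .lam _, h => fun x hx =>
    have h' := Canon.Good.of_mem_fv (ρ := fun x => (ρ x).shift) h x hx
    ⟨h'.1, Or.inr h'.2⟩
  | .pair _ _, h => by
    rintro x (hx | hx) <;> cases hx
    · exact ⟨h.1, Or.inr (Or.inl (Expr.mem_Sb_self _))⟩
    · exact ⟨h.2, Or.inr (Or.inr (Expr.mem_Sb_self _))⟩
  | .app _ _, h => by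
    rintro x (hx | hx) <;> cases hx
    · exact ⟨h.1, Or.inr (Or.inl (Expr.mem_Sb_self _))⟩
    · exact ⟨h.2, Or.inr (Or.inr (Expr.mem_Sb_self _))⟩
  | .proj₁ _, h => by
    rintro x hx; cases hx
    exact ⟨h, Or.inr (Expr.mem_Sb_self _)⟩
  | .proj₂ _, h => by
    rintro x hx; cases hx
    exact ⟨h, Or.inr (Expr.mem_Sb_self _)⟩
  | .tcase _ _ _ _, h => by
    rintro x (hx | hx | hx) <;> cases hx
    · exact ⟨h.1, Or.inr (Or.inl (Expr.mem_Sb_self _))⟩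
    · exact ⟨h.2.1, Or.inr (Or.inr (Or.inl (Expr.mem_Sb_self _)))⟩
    · exact ⟨h.2.2, Or.inr (Or.inr (Or.inr (Expr.mem_Sb_self _)))⟩

theorem Canon.Good.of_mem_fv {P : Expr S → Prop} {b : ℕ} {ρ : ℕ → Expr S} :
    ∀ {κ : Canon S}, κ.Good P b ρ → ∀ x, Sum.inr x ∈ κ.fv → x < b ∧ ρ x ∈ (κ.unwind ρ).Sb
  | .bvar _, h => by
    rintro x hx; cases hx
    exact ⟨h, Expr.mem_Sb_self _⟩
  | .bind _ _, h => by
    rintro x (hx | hx)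
    · have h' := h.1.of_mem_fv x hx
      exact ⟨h'.1, Expr.Sb_trans _ _ h.2.2.1 h'.2⟩
    · have h' := h.2.2.2.of_mem_fv (x + 1) hx
      exact ⟨by omega, h'.2⟩
end

mutual
theorem Atom.Good.mem_FV {b : ℕ} {ρ : ℕ → Expr S} : ∀ {a : Atom S}, a.Good b ρ →
    ∀ n, Sum.inl n ∈ a.fv → n ∈ (a.unwind ρ).FV
  | .const _, _ => fun _ h => h.elim
  | .lvar _, _ => fun _ h => by cases h; rfl
  | .lam _, h => fun n hn => Canon.Good.mem_FV (ρ := fun x => (ρ x).shift) h (n + 1) hn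
  | .pair _ _, _ => by rintro x (hx | hx) <;> cases hx
  | .app _ _, _ => by rintro x (hx | hx) <;> cases hx
  | .proj₁ _, _ => by rintro x hx; cases hx
  | .proj₂ _, _ => by rintro x hx; cases hx
  | .tcase _ _ _ _, _ => by rintro x (hx | hx | hx) <;> cases hx

theorem Canon.Good.mem_FV {P : Expr S → Prop} {b : ℕ} {ρ : ℕ → Expr S} :
    ∀ {κ : Canon S}, κ.Good P b ρ → ∀ n, Sum.inl n ∈ κ.fv → n ∈ (κ.unwind ρ).FV
  | .bvar _, _ => by rintro x hx; cases hx
  | .bind _ _, h => by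
    rintro x (hx | hx)
    · exact Expr.FV_of_mem_Sb _ _ h.2.2.1 (h.1.mem_FV x hx)
    · exact h.2.2.2.mem_FV x hx
end

/-- The expressions of the bindings of a canonical form, not counting those in abstractions. -/
def Canon.Binds (ρ : ℕ → Expr S) : Canon S → Set (Expr S)
  | .bvar _ => ∅
  | .bind a κ => insert (a.unwind ρ) (κ.Binds (scons (a.unwind ρ) ρ))

theorem Canon.Good.of_mem_binds {P : Expr S → Prop} {b : ℕ} {ρ : ℕ → Expr S} :
    ∀ {κ : Canon S}, κ.Good P b ρ → ∀ s ∈ κ.Binds ρ, P s ∧ s ∈ (κ.unwind ρ).Sb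
  | .bvar _, _ => fun _ hs => hs.elim
  | .bind _ _, h => by
    rintro s (rfl | hs)
    · exact ⟨h.2.1, h.2.2.1⟩
    · have h' := Canon.Good.of_mem_binds h.2.2.2 s hs
      exact ⟨h'.1.1, h'.2⟩

/-- The new conjunct `r ≠ s` records that `s` has become available. The hypothesis on
sub-expressions keeps the context closed. -/
theorem Ctx.cons {P : Expr S → Prop} {b : ℕ} {ρ : ℕ → Expr S} (h : Ctx P b ρ) {s : Expr S}
    (hP : P s) (hs : ∀ r ∈ s.Sb, r = s ∨ ∃ x < b, ρ x = r) :
    Ctx (fun r => P r ∧ r ≠ s) (b + 1) (scons s ρ) where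
  inj := by
    rintro (_ | x) hx (_ | y) hy hxy
    · rfl
    · exact absurd (show P (ρ y) from (show s = ρ y from hxy) ▸ hP) (h.not_mem y (by omega))
    · exact absurd (show P (ρ x) from (show ρ x = s from hxy) ▸ hP) (h.not_mem x (by omega))
    · rw [h.inj x (by omega) y (by omega) hxy]
  closed := by
    rintro (_ | x) hx r hr
    · rcases hs r hr with rfl | ⟨y, hy, rfl⟩
      · exact ⟨0, by omega, rfl⟩
      · exact ⟨y + 1, by omega, rfl⟩
    · obtain ⟨y, hy, rfl⟩ := h.closed x (by omega) r hr
      exact ⟨y + 1, by omega, rfl⟩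
  not_mem := by
    rintro (_ | x) hx ⟨h1, h2⟩
    · exact h2 rfl
    · exact h.not_mem x (by omega) h1

mutual
-- Arguments of atoms are variables, so the proper sub-expressions of an atom come from the context.
-- A sub-expression of an abstraction avoids the abstracted variable, hence is not bound in the
-- body, where all bindings contain it. Together with `Canon.Good.of_mem_binds`, the bound
-- expressions of a form are exactly the sub-expressions satisfying `P`.
theorem Atom.Good.Sb_unwind {P : Expr S → Prop} {b : ℕ} {ρ : ℕ → Expr S} (hρ : Ctx P b ρ) :
    ∀ {a : Atom S}, a.Good b ρ → ∀ s ∈ (a.unwind ρ).Sb, s = a.unwind ρ ∨ ∃ x < b, ρ x = s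
  | .const _, _ => fun _ hs => Or.inl hs
  | .lvar _, _ => fun _ hs => Or.inl hs
  | .lam κ, h => by
    rintro s (hs | hs)
    · exact Or.inl hs
    · have h' : κ.Good _ b (fun x => (ρ x).shift) := h
      rcases h'.Sb_unwind hρ.lam _ hs with ⟨x, hx, hxs⟩ | hs'
      · exact Or.inr ⟨x, hx, Expr.shift_injective hxs⟩
      · exact absurd (h'.of_mem_binds _ hs').1 (Expr.zero_notMem_FV_shift s)
  | .pair x y, h => by
    rintro s (hs | hs | hs)
    · exact Or.inl hs
    · exact Or.inr (hρ.closed x h.1 s hs)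
    · exact Or.inr (hρ.closed y h.2 s hs)
  | .app x y, h => by
    rintro s (hs | hs | hs)
    · exact Or.inl hs
    · exact Or.inr (hρ.closed x h.1 s hs)
    · exact Or.inr (hρ.closed y h.2 s hs)
  | .proj₁ x, h => by
    rintro s (hs | hs)
    · exact Or.inl hs
    · exact Or.inr (hρ.closed x h s hs)
  | .proj₂ x, h => by
    rintro s (hs | hs)
    · exact Or.inl hs
    · exact Or.inr (hρ.closed x h s hs)
  | .tcase x _ y z, h => by
    rintro s (hs | hs | hs | hs)
    · exact Or.inl hs
    · exact Or.inr (hρ.closed x h.1 s hs)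
    · exact Or.inr (hρ.closed y h.2.1 s hs)
    · exact Or.inr (hρ.closed z h.2.2 s hs)

theorem Canon.Good.Sb_unwind {P : Expr S → Prop} {b : ℕ} {ρ : ℕ → Expr S} (hρ : Ctx P b ρ) :
    ∀ {κ : Canon S}, κ.Good P b ρ →
      ∀ s ∈ (κ.unwind ρ).Sb, (∃ x < b, ρ x = s) ∨ s ∈ κ.Binds ρ
  | .bvar x, h => fun s hs => Or.inl (hρ.closed x h s hs)
  | .bind a κ, h => by
    intro s hs
    rcases h.2.2.2.Sb_unwind (hρ.cons h.2.1 (h.1.Sb_unwind hρ)) s hs with ⟨x, hx, rfl⟩ | hs'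
    · cases x with
      | zero => exact Or.inr (Or.inl rfl)
      | succ x => exact Or.inl ⟨x, by omega, rfl⟩
    · exact Or.inr (Or.inr hs')
end

theorem Canon.Good.ctx {P : Expr S → Prop} {b : ℕ} {ρ : ℕ → Expr S} (hρ : Ctx P b ρ)
    {a : Atom S} {κ : Canon S} (h : (Canon.bind a κ).Good P b ρ) :
    Ctx (fun s => P s ∧ s ≠ a.unwind ρ) (b + 1) (scons (a.unwind ρ) ρ) :=
  hρ.cons h.2.1 (h.1.Sb_unwind hρ)

/-! ## Uniqueness of maximal sharing forms -/

/-- Exchange of the first two bindings. -/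
theorem Canon.Good.swap {P : Expr S → Prop} {b : ℕ} {ρ : ℕ → Expr S} {a₁ a₂ : Atom S}
    {κ : Canon S} (h : (Canon.bind a₁ (.bind (a₂.shift 0 1) κ)).Good P b ρ) :
    (Canon.bind a₂ (.bind (a₁.shift 0 1) (κ.rename id (Equiv.swap 0 1)))).Good P b ρ := by
  obtain ⟨h1, h2, h3, h4, h5, h6, h7⟩ := h
  simp only [Atom.unwind_weaken, Atom.good_weaken_iff, Canon.unwind] at h3 h4 h5 h6 h7
  have hsw : ∀ x, scons (a₁.unwind ρ) (scons (a₂.unwind ρ) ρ) (Equiv.swap 0 1 x) =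
      (scons (a₂.unwind ρ) (scons (a₁.unwind ρ) ρ) x).rename id := by
    rintro (_ | _ | x)
    · exact (Expr.rename_id _).symm
    · exact (Expr.rename_id _).symm
    · rw [Equiv.swap_apply_of_ne_of_ne (by omega) (by omega)]
      exact (Expr.rename_id _).symm
  have hu : (κ.rename id (Equiv.swap 0 1)).unwind
      (scons (a₁.unwind ρ) (scons (a₂.unwind ρ) ρ)) =
      κ.unwind (scons (a₂.unwind ρ) (scons (a₁.unwind ρ) ρ)) :=
    (Canon.unwind_rename id _ _ _ hsw κ).trans (Expr.rename_id _)
  refine ⟨h4, h5.1, ?_, ?_⟩ <;>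
    simp only [Canon.Good, Atom.unwind_weaken, Atom.good_weaken_iff, Canon.unwind, hu]
  · exact h6
  · refine ⟨h1, ⟨h2, Ne.symm h5.2⟩, h3, ?_⟩
    refine (Canon.good_rename_iff (f := id) (fun _ _ h => h) hsw ?_ (fun s => ?_) κ).2 h7
    · rintro (_ | _ | x)
      · simp
      · simp
      · rw [Equiv.swap_apply_of_ne_of_ne (by omega) (by omega)]
    · rw [Expr.rename_id]
      tauto

/-- A binding whose proper sub-expressions are in the context can be moved to the front. -/
theorem Canon.Good.exists_bind_first : ∀ {κ : Canon S} {P : Expr S → Prop} {b : ℕ}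
    {ρ : ℕ → Expr S}, Ctx P b ρ → κ.Good P b ρ → ∀ s ∈ κ.Binds ρ,
    (∀ r ∈ s.Sb, r = s ∨ ∃ x < b, ρ x = r) →
    ∃ a κ₁, κ.EqCan (.bind a κ₁) ∧ a.unwind ρ = s ∧ (Canon.bind a κ₁).Good P b ρ
  | .bvar _, _, _, _, _, _, _, hs, _ => hs.elim
  | .bind a κ, P, b, ρ, hρ, h, s, hs, hr => by
    by_cases hsa : a.unwind ρ = s
    · exact ⟨a, κ, .refl _, hsa, h⟩
    have hs' : s ∈ κ.Binds (scons (a.unwind ρ) ρ) := hs.resolve_left (Ne.symm hsa)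
    have hρ' := Canon.Good.ctx hρ h
    obtain ⟨a₂, κ₂, h₁, h₂, h₃⟩ := h.2.2.2.exists_bind_first hρ' s hs' (fun r hr' => by
      rcases hr r hr' with h | ⟨x, hx, h⟩
      · exact Or.inl h
      · exact Or.inr ⟨x + 1, by omega, h⟩)
    -- If `a₂` used the binding of `a`, the expression of `a` would be a sub-expression of `s`,
    -- hence equal to `s` or in the context. Both are excluded, so the two bindings are independent.
    have h0 : ∀ x, Sum.inr x ∈ a₂.fv → x ∈ Set.range Nat.succ := by
      rintro (_ | x) hx
      · exfalso
        have h4 := (h₃.1.of_mem_fv 0 hx).2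
        rw [h₂] at h4
        rcases hr _ h4 with h5 | ⟨y, hy, h5⟩
        · exact hsa h5
        · exact hρ.not_mem y hy (h5 ▸ h.2.1)
      · exact ⟨x, rfl⟩
    obtain ⟨a₂', rfl⟩ := Atom.exists_rename_eq id Nat.succ a₂ (fun n _ => ⟨n, rfl⟩) h0
    have h₂' : a₂'.unwind ρ = s := (Atom.unwind_weaken a₂' _ ρ).symm.trans h₂
    refine ⟨a₂', .bind (a.shift 0 1) (κ₂.rename id (Equiv.swap 0 1)),
      (Canon.EqCan.bind (.refl a) h₁).trans (.swap a a₂' κ₂), h₂', ?_⟩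
    refine Canon.Good.swap ⟨h.1, h.2.1, ?_, h₃⟩
    have h5 := h.2.2.1
    rwa [h₁.unwind_eq] at h5

mutual
-- Equal unwindings force equal arguments of atoms, since the context is injective. For forms, the
-- first binding of the one also occurs in the other and needs only the context, so it can be pulled
-- to the front there; heads and tails are then compared separately.
theorem Atom.Good.eqCan : ∀ {a : Atom S} {P : Expr S → Prop} {b : ℕ} {ρ : ℕ → Expr S},
    Ctx P b ρ → a.Good b ρ → ∀ a' : Atom S, a'.Good b ρ → a.unwind ρ = a'.unwind ρ → a.EqCan a'
  | .const _, _, _, _, _, _ => fun a' _ hu => by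
    cases a' <;> simp only [Atom.unwind, reduceCtorEq, Expr.const.injEq] at hu
    subst hu
    exact .refl _
  | .lvar _, _, _, _, _, _ => fun a' _ hu => by
    cases a' <;> simp only [Atom.unwind, reduceCtorEq, Expr.var.injEq] at hu
    subst hu
    exact .refl _
  | .lam κ, _, b, ρ, hρ, h => fun a' h' hu => by
    cases a' <;> simp only [Atom.unwind, reduceCtorEq, Expr.lam.injEq] at hu
    exact .lam (Canon.Good.eqCan (κ := κ) hρ.lam h _ h' hu)
  | .pair x y, _, b, ρ, hρ, h => fun a' h' hu => by
    cases a' <;> simp only [Atom.unwind, reduceCtorEq, Expr.pair.injEq] at hu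
    rw [hρ.inj _ h.1 _ h'.1 hu.1, hρ.inj _ h.2 _ h'.2 hu.2]
    exact .refl _
  | .app x y, _, b, ρ, hρ, h => fun a' h' hu => by
    cases a' <;> simp only [Atom.unwind, reduceCtorEq, Expr.app.injEq] at hu
    rw [hρ.inj _ h.1 _ h'.1 hu.1, hρ.inj _ h.2 _ h'.2 hu.2]
    exact .refl _
  | .proj₁ x, _, b, ρ, hρ, h => fun a' h' hu => by
    cases a' <;> simp only [Atom.unwind, reduceCtorEq, Expr.proj₁.injEq] at hu
    rw [hρ.inj _ h _ h' hu]
    exact .refl _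
  | .proj₂ x, _, b, ρ, hρ, h => fun a' h' hu => by
    cases a' <;> simp only [Atom.unwind, reduceCtorEq, Expr.proj₂.injEq] at hu
    rw [hρ.inj _ h _ h' hu]
    exact .refl _
  | .tcase x τ y z, _, b, ρ, hρ, h => fun a' h' hu => by
    cases a' <;> simp only [Atom.unwind, reduceCtorEq, Expr.tcase.injEq] at hu
    rw [hρ.inj _ h.1 _ h'.1 hu.1, hu.2.1, hρ.inj _ h.2.1 _ h'.2.1 hu.2.2.1,
      hρ.inj _ h.2.2 _ h'.2.2 hu.2.2.2]
    exact .refl _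

theorem Canon.Good.eqCan : ∀ {κ : Canon S} {P : Expr S → Prop} {b : ℕ} {ρ : ℕ → Expr S},
    Ctx P b ρ → κ.Good P b ρ → ∀ κ' : Canon S, κ'.Good P b ρ → κ.unwind ρ = κ'.unwind ρ →
      κ.EqCan κ'
  | .bvar x, P, b, ρ, hρ, h => fun κ' h' hu => by
    cases κ' with
    | bvar y =>
      rw [hρ.inj x h y h' hu]
      exact .refl _
    | bind a' κ' =>
      exfalso
      -- The whole expression is in the context, and with it all of its sub-expressions. A binding,
      -- however, must define something not in the context.
      have h1 := h'.2.2.1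
      change a'.unwind ρ ∈ ((Canon.bind a' κ').unwind ρ).Sb at h1
      rw [← hu] at h1
      obtain ⟨y, hy, h2⟩ := hρ.closed x h _ h1
      exact hρ.not_mem y hy (h2 ▸ h'.2.1)
  | .bind a κ, P, b, ρ, hρ, h => fun κ' h' hu => by
    have hs : a.unwind ρ ∈ κ'.Binds ρ := by
      have h1 := h.2.2.1
      change a.unwind ρ ∈ ((Canon.bind a κ).unwind ρ).Sb at h1
      rw [hu] at h1
      rcases h'.Sb_unwind hρ _ h1 with ⟨y, hy, h2⟩ | h2
      · exact absurd (h2 ▸ h.2.1) (hρ.not_mem y hy)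
      · exact h2
    obtain ⟨a', κ₁, h₁, h₂, h₃⟩ := h'.exists_bind_first hρ _ hs (h.1.Sb_unwind hρ)
    have hu' := hu.trans (h₁.unwind_eq ρ)
    obtain ⟨g1, g2, g3, g4⟩ := h₃
    simp only [h₂] at g4
    simp only [Canon.unwind, h₂] at hu'
    exact (Canon.EqCan.bind (h.1.eqCan hρ a' g1 h₂.symm)
      (h.2.2.2.eqCan (Canon.Good.ctx hρ h) κ₁ g4 hu')).trans h₁.symm
end

/-! ## Existence of maximal sharing forms -/

/-- The atom of an expression whose proper sub-expressions are in the context. -/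
theorem exists_good_atom {b : ℕ} {ρ : ℕ → Expr S} (s : Expr S)
    (hs : ∀ r ∈ s.Sb, r = s ∨ ∃ x < b, ρ x = r)
    (hlam : ∀ e, s = .lam e → ∃ κ : Canon S, κ.Good (fun s => 0 ∈ s.FV) b (fun x => (ρ x).shift) ∧
      κ.unwind (fun x => (ρ x).shift) = e) :
    ∃ a : Atom S, a.Good b ρ ∧ a.unwind ρ = s := by
  have key : ∀ r ∈ s.Sb, r.size < s.size → ∃ x < b, ρ x = r := fun r hr hlt =>
    (hs r hr).resolve_left fun h => by simp [h] at hlt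
  cases s with
  | const c => exact ⟨.const c, trivial, rfl⟩
  | var n => exact ⟨.lvar n, trivial, rfl⟩
  | lam e =>
    obtain ⟨κ, h, rfl⟩ := hlam e rfl
    exact ⟨.lam κ, h, rfl⟩
  | app e₁ e₂ =>
    obtain ⟨x, hx, rfl⟩ := key e₁ (by simp [Expr.Sb, Expr.mem_Sb_self]) (by simp only [Expr.size]; omega)
    obtain ⟨y, hy, rfl⟩ := key e₂ (by simp [Expr.Sb, Expr.mem_Sb_self]) (by simp only [Expr.size]; omega)
    exact ⟨.app x y, ⟨hx, hy⟩, rfl⟩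
  | pair e₁ e₂ =>
    obtain ⟨x, hx, rfl⟩ := key e₁ (by simp [Expr.Sb, Expr.mem_Sb_self]) (by simp only [Expr.size]; omega)
    obtain ⟨y, hy, rfl⟩ := key e₂ (by simp [Expr.Sb, Expr.mem_Sb_self]) (by simp only [Expr.size]; omega)
    exact ⟨.pair x y, ⟨hx, hy⟩, rfl⟩
  | proj₁ e =>
    obtain ⟨x, hx, rfl⟩ := key e (by simp [Expr.Sb, Expr.mem_Sb_self]) (by simp [Expr.size])
    exact ⟨.proj₁ x, hx, rfl⟩
  | proj₂ e =>
    obtain ⟨x, hx, rfl⟩ := key e (by simp [Expr.Sb, Expr.mem_Sb_self]) (by simp [Expr.size])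
    exact ⟨.proj₂ x, hx, rfl⟩
  | tcase e τ e₁ e₂ =>
    obtain ⟨x, hx, rfl⟩ := key e (by simp [Expr.Sb, Expr.mem_Sb_self]) (by simp only [Expr.size]; omega)
    obtain ⟨y, hy, rfl⟩ := key e₁ (by simp [Expr.Sb, Expr.mem_Sb_self]) (by simp only [Expr.size]; omega)
    obtain ⟨z, hz, rfl⟩ := key e₂ (by simp [Expr.Sb, Expr.mem_Sb_self]) (by simp only [Expr.size]; omega)
    exact ⟨.tcase x τ y z, ⟨hx, hy, hz⟩, rfl⟩

/-- The induction on `N` bounds the size and serves the bodies of abstractions; the induction on `M`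
bounds the number of sub-expressions still to be bound. One of least size is bound next: its proper
sub-expressions are already in the context, so it is given by an atom. -/
theorem exists_good (N : ℕ) : ∀ (e : Expr S), e.size ≤ N → ∀ (M : ℕ) (P : Expr S → Prop) (b : ℕ)
    (ρ : ℕ → Expr S), {s ∈ e.Sb | P s}.ncard ≤ M → Ctx P b ρ →
    (∀ s ∈ e.Sb, P s ∨ ∃ x < b, ρ x = s) → ∃ κ : Canon S, κ.Good P b ρ ∧ κ.unwind ρ = e := by
  induction N with
  | zero => intro e he; cases e <;> simp [Expr.size] at he
  | succ N ihN =>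
    intro e he M
    induction M with
    | zero =>
      intro P b ρ hM _ hP
      have hfin : {s ∈ e.Sb | P s}.Finite := e.finite_Sb.subset (Set.sep_subset _ _)
      have h0 := (Set.ncard_eq_zero hfin).1 (Nat.le_zero.1 hM)
      rcases hP e e.mem_Sb_self with h | ⟨x, hx, h⟩
      · exact absurd (show e ∈ {s ∈ e.Sb | P s} from ⟨e.mem_Sb_self, h⟩) (by simp [h0])
      · exact ⟨.bvar x, hx, h⟩
    | succ M ihM =>
      intro P b ρ hM hρ hP
      have hfin : {s ∈ e.Sb | P s}.Finite := e.finite_Sb.subset (Set.sep_subset _ _)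
      by_cases hne : {s ∈ e.Sb | P s}.Nonempty
      · obtain ⟨s, ⟨hs, hPs⟩, hmin⟩ := hfin.exists_minimalFor Expr.size _ hne
        have hlt : ∀ r ∈ s.Sb, r.size < s.size → ∃ x < b, ρ x = r := by
          intro r hr hlt
          refine (hP r (Expr.Sb_trans _ _ hs hr)).resolve_left fun h => ?_
          have := hmin ⟨Expr.Sb_trans _ _ hs hr, h⟩ hlt.le
          omega
        have hsb : ∀ r ∈ s.Sb, r = s ∨ ∃ x < b, ρ x = r := fun r hr => by
          by_cases h : r = s
          · exact Or.inl h
          · exact Or.inr (hlt r hr (Expr.size_lt_of_mem_Sb _ _ hr h))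
        obtain ⟨a, ha, hu⟩ := exists_good_atom s hsb (by
          rintro e₀ rfl
          have hle := Expr.size_le_of_mem_Sb _ _ hs
          rw [Expr.size] at hle
          refine ihN e₀ (by omega) _ _ b _ le_rfl hρ.lam fun r hr => ?_
          -- A sub-expression of the body that avoids the abstracted variable is a smaller
          -- sub-expression of the abstraction, hence in the context by minimality.
          by_cases h0 : 0 ∈ r.FV
          · exact Or.inl h0
          · obtain ⟨r', rfl⟩ := Expr.exists_shift_eq h0
            have h1 := Expr.size_le_of_mem_Sb _ _ hr
            rw [Expr.shift, Expr.size_rename] at h1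
            obtain ⟨x, hx, rfl⟩ := hlt r' (Or.inr hr) (by rw [Expr.size]; omega)
            exact Or.inr ⟨x, hx, rfl⟩)
        subst hu
        obtain ⟨κ, hκ, hu⟩ := ihM (fun r => P r ∧ r ≠ a.unwind ρ) (b + 1) (scons (a.unwind ρ) ρ) (by
          refine Nat.le_of_lt_succ (lt_of_lt_of_le (Set.ncard_lt_ncard ?_ hfin) hM)
          refine ⟨fun r hr => ⟨hr.1, hr.2.1⟩, fun h => (h ⟨hs, hPs⟩).2.2 rfl⟩)
          (hρ.cons hPs hsb) (fun r hr => by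
            by_cases h : r = a.unwind ρ
            · exact Or.inr ⟨0, by omega, h.symm⟩
            · rcases hP r hr with h' | ⟨x, hx, h'⟩
              · exact Or.inl ⟨h', h⟩
              · exact Or.inr ⟨x + 1, by omega, h'⟩)
        exact ⟨.bind a κ, ⟨ha, hPs, hu ▸ hs, hκ⟩, hu⟩
      · refine ihM P b ρ ?_ hρ hP
        rw [Set.not_nonempty_iff_eq_empty.1 hne]
        simp

/-! ## The semantic description characterizes maximal sharing forms -/

theorem Expr.rename_add_rename_add (e : Expr S) (l l' : ℕ) :
    (e.rename fun n => n + l).rename (fun n => n + l') = e.rename fun n => n + (l + l') := by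
  rw [Expr.rename_rename]
  congr 1; funext n; simp only [Function.comp]; omega

theorem Expr.zero_notMem_FV_rename_add (e : Expr S) (l : ℕ) :
    0 ∉ (e.rename fun n => n + (l + 1)).FV := by
  rw [Expr.mem_FV_rename]
  rintro ⟨m, _, h⟩
  omega

/-- Goodness is passed down to sub-forms, with enough control to compare two places: the context at
the inner place extends the weakened outer one, bindings below an abstraction contain its variable,
and `P'` holds of a weakening only if `P` held of the original. Below an abstraction the last
property is vacuous. -/
theorem Canon.Occurs.good {κ κ' : Canon S} {l b' : ℕ} (h : κ.Occurs l b' κ') :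
    ∀ {P : Expr S → Prop} {b : ℕ} {ρ : ℕ → Expr S}, Ctx P b ρ → κ.Good P b ρ →
    ∃ (P' : Expr S → Prop) (ρ' : ℕ → Expr S), Ctx P' (b + b') ρ' ∧ κ'.Good P' (b + b') ρ' ∧
      (∀ x, ρ' (x + b') = (ρ x).rename fun n => n + l) ∧
      (∀ s, P' s → l ≠ 0 → 0 ∈ s.FV) ∧ ∀ s, P' (s.rename fun n => n + l) → P s := by
  induction h with
  | refl κ =>
    intro P b ρ hρ hg
    exact ⟨P, ρ, hρ, hg, fun x => (Expr.rename_id _).symm, fun _ _ h => absurd rfl h,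
      fun s hs => (Expr.rename_id s) ▸ hs⟩
  | @body a κ l b' κ' _ ih =>
    intro P b ρ hρ hg
    obtain ⟨P', ρ', h1, h2, h3, h4, h5⟩ := ih (Canon.Good.ctx hρ hg) hg.2.2.2
    have hb : b + (b' + 1) = b + 1 + b' := by omega
    rw [hb]
    refine ⟨P', ρ', h1, h2, fun x => ?_, h4, fun s hs => (h5 s hs).1⟩
    rw [show x + (b' + 1) = x + 1 + b' by omega, h3]
    rfl
  | @lam κ₀ κ l b' κ' _ ih =>
    intro P b ρ hρ hg
    have hg' : κ₀.Good (fun s => 0 ∈ s.FV) b (fun x => (ρ x).shift) := hg.1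
    obtain ⟨P', ρ', h1, h2, h3, h4, h5⟩ := ih hρ.lam hg'
    have key : ∀ e : Expr S, e.shift.rename (fun n => n + l) = e.rename fun n => n + (l + 1) := by
      intro e
      rw [Nat.add_comm l 1]
      exact Expr.rename_add_rename_add e 1 l
    have h0 : ∀ s, P' s → 0 ∈ s.FV := by
      intro s hs
      cases l with
      | zero =>
        have h6 : (s.rename fun n => n + 0) = s := Expr.rename_id s
        exact h5 s (h6.symm ▸ hs)
      | succ l => exact h4 s hs (by omega)
    refine ⟨P', ρ', h1, h2, fun x => (h3 x).trans (key _), fun s hs _ => h0 s hs, fun s hs => ?_⟩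
    exact absurd (h0 _ hs) (Expr.zero_notMem_FV_rename_add s l)

/-- The bindings in an abstraction depend on the variable of the innermost abstraction. -/
theorem Atom.Defines.good {a a' : Atom S} {l b' : ℕ} (h : a.Defines l b' a') {P : Expr S → Prop}
    {b : ℕ} {ρ : ℕ → Expr S} (hρ : Ctx P b ρ) (hg : a.Good b ρ) :
    ∃ ρ' : ℕ → Expr S, (∀ x, ρ' (x + b') = (ρ x).rename fun n => n + l) ∧
      l ≠ 0 ∧ a'.Good (b + b') ρ' ∧ 0 ∈ (a'.unwind ρ').FV := by
  obtain ⟨κ, l, κ', rfl, rfl, ho⟩ := h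
  obtain ⟨P', ρ', h1, h2, h3, h4, h5⟩ := ho.good hρ.lam hg
  refine ⟨ρ', fun x => (h3 x).trans ?_, by omega, h2.1, ?_⟩
  · rw [Nat.add_comm l 1]
    exact Expr.rename_add_rename_add (ρ x) 1 l
  · cases l with
    | zero =>
      have h6 : ((a'.unwind ρ').rename fun n => n + 0) = a'.unwind ρ' := Expr.rename_id _
      exact h5 _ (h6.symm ▸ h2.2.1)
    | succ l => exact h4 _ h2.2.1 (by omega)

mutual
theorem Atom.mem_FV_unwind (n : ℕ) (ρ : ℕ → Expr S) : ∀ a : Atom S, n ∈ (a.unwind ρ).FV →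
    Sum.inl n ∈ a.fv ∨ ∃ x, Sum.inr x ∈ a.fv ∧ n ∈ (ρ x).FV
  | .const _, h => h.elim
  | .lvar _, h => Or.inl (congrArg Sum.inl h)
  | .lam κ, h => by
    rcases Canon.mem_FV_unwind (n + 1) _ κ h with h' | ⟨x, hx, h'⟩
    · exact Or.inl h'
    · refine Or.inr ⟨x, hx, ?_⟩
      obtain ⟨m, hm, h''⟩ := (Expr.mem_FV_rename _ _ _).1 h'
      cases h''
      exact hm
  | .pair x y, h => h.elim (fun h => Or.inr ⟨x, Or.inl rfl, h⟩) fun h => Or.inr ⟨y, Or.inr rfl, h⟩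
  | .app x y, h => h.elim (fun h => Or.inr ⟨x, Or.inl rfl, h⟩) fun h => Or.inr ⟨y, Or.inr rfl, h⟩
  | .proj₁ x, h => Or.inr ⟨x, rfl, h⟩
  | .proj₂ x, h => Or.inr ⟨x, rfl, h⟩
  | .tcase x _ y z, h => by
    rcases h with h | h | h
    · exact Or.inr ⟨x, Or.inl rfl, h⟩
    · exact Or.inr ⟨y, Or.inr (Or.inl rfl), h⟩
    · exact Or.inr ⟨z, Or.inr (Or.inr rfl), h⟩

theorem Canon.mem_FV_unwind (n : ℕ) (ρ : ℕ → Expr S) : ∀ κ : Canon S, n ∈ (κ.unwind ρ).FV →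
    Sum.inl n ∈ κ.fv ∨ ∃ x, Sum.inr x ∈ κ.fv ∧ n ∈ (ρ x).FV
  | .bvar x, h => Or.inr ⟨x, rfl, h⟩
  | .bind a κ, h => by
    rcases Canon.mem_FV_unwind n _ κ h with h' | ⟨x, hx, h'⟩
    · exact Or.inl (Or.inr h')
    · cases x with
      | zero =>
        rcases Atom.mem_FV_unwind n ρ a h' with h'' | ⟨x, hx, h''⟩
        · exact Or.inl (Or.inl h'')
        · exact Or.inr ⟨x, Or.inl hx, h''⟩
      | succ x => exact Or.inr ⟨x, Or.inr hx, h'⟩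
end

/-- Equivalent atoms unwind to the same expression up to weakening. In the continuation, a
repetition is excluded by the predicate. Inside an abstraction, a bound expression contains the
innermost variable, which a weakening never does; this also settles extrusion. If a binding were
unused, its expression would still be a sub-expression of what the continuation unwinds to, without
being in the context or bound there, contrary to `Canon.Good.Sb_unwind`. -/
theorem Canon.Good.isMSC {P : Expr S → Prop} {b : ℕ} {ρ : ℕ → Expr S} (hρ : Ctx P b ρ)
    {κ : Canon S} (hg : κ.Good P b ρ) : κ.IsMSC where
  shared := by
    intro l b' a κ' ho
    obtain ⟨P₁, ρ₁, h1, h2, -, -, -⟩ := ho.good hρ hg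
    refine ⟨?_, ?_, ?_⟩
    · rintro l' b'' a' ⟨κ'', ho'⟩ he
      obtain ⟨P₂, ρ₂, g1, g2, g3, g4, g5⟩ := ho'.good (Canon.Good.ctx h1 h2) h2.2.2.2
      have h3 := he.unwind_eq ρ₂
      rw [Atom.unwind_shift a (ρ := ρ₁) (fun x => by
        rw [show x + (b'' + 1) = x + 1 + b'' by omega, g3]; rfl)] at h3
      exact (g5 (a.unwind ρ₁) (h3 ▸ g2.2.1)).2 rfl
    · intro l' b'' a' hd he
      obtain ⟨ρ₂, g1, g2, -, g4⟩ := hd.good h1 h2.1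
      have h3 := he.unwind_eq ρ₂
      rw [Atom.unwind_shift a g1] at h3
      rw [← h3] at g4
      obtain ⟨l', rfl⟩ := Nat.exists_eq_succ_of_ne_zero g2
      exact Expr.zero_notMem_FV_rename_add _ _ g4
    · rintro l₁ b₁ a₁ l₂ b₂ a₂ hd - ⟨a₀, he, -⟩
      obtain ⟨ρ₂, g1, g2, -, g4⟩ := hd.good h1 h2.1
      have h3 := he.unwind_eq ρ₂
      rw [Atom.unwind_shift a₀ g1] at h3
      rw [← h3] at g4
      obtain ⟨l', rfl⟩ := Nat.exists_eq_succ_of_ne_zero g2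
      exact Expr.zero_notMem_FV_rename_add _ _ g4
  extruded := by
    intro l b' κ₁ κ₂ ho l' b'' a hd hfv
    obtain ⟨P₁, ρ₁, h1, h2, -, -, -⟩ := ho.good hρ hg
    obtain ⟨ρ₂, g1, g2, -, g4⟩ := hd.good h1 h2.1
    obtain ⟨l', rfl⟩ := Nat.exists_eq_succ_of_ne_zero g2
    rcases Atom.mem_FV_unwind _ _ _ g4 with h | ⟨x, hx, h⟩
    · obtain ⟨v, _, hv⟩ := hfv h
      cases v with
      | inl n => exact absurd (Sum.inl_injective hv) (by simp)
      | inr x => cases hv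
    · obtain ⟨v, _, hv⟩ := hfv hx
      cases v with
      | inl n => cases hv
      | inr y =>
        obtain rfl := Sum.inr_injective hv
        dsimp only at h
        rw [g1] at h
        exact Expr.zero_notMem_FV_rename_add _ _ h
  useful := by
    intro l b' a κ' ho
    obtain ⟨P₁, ρ₁, h1, h2, -, -, -⟩ := ho.good hρ hg
    by_contra h0
    obtain ⟨κ'', rfl⟩ := Canon.exists_rename_eq id Nat.succ κ' (fun n _ => ⟨n, rfl⟩) (by
      rintro (_ | x) hx
      · exact absurd hx h0
      · exact ⟨x, rfl⟩)
    obtain ⟨-, h3, h4, h5⟩ := h2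
    have hr : ∀ x, scons (a.unwind ρ₁) ρ₁ (Nat.succ x) = (ρ₁ x).rename id := fun x =>
      (Expr.rename_id _).symm
    rw [Canon.unwind_rename id _ _ _ hr, Expr.rename_id] at h4
    rw [Canon.good_rename_iff (f := id) (fun _ _ h => h) hr (fun _ => Nat.succ_lt_succ_iff)
      (P := fun s => P₁ s ∧ s ≠ a.unwind ρ₁) (fun s => by rw [Expr.rename_id])] at h5
    have h6 : Ctx (fun s => P₁ s ∧ s ≠ a.unwind ρ₁) (b + b') ρ₁ :=
      ⟨h1.inj, h1.closed, fun x hx h => h1.not_mem x hx h.1⟩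
    rcases h5.Sb_unwind h6 _ h4 with ⟨x, hx, h⟩ | h
    · exact h1.not_mem x hx (h ▸ h3)
    · exact (h5.of_mem_binds _ h).1.2 rfl

theorem Canon.Occurs.mem_fv {κ κ' : Canon S} {l b' : ℕ} (h : κ.Occurs l b' κ') :
    (∀ n, Sum.inl (n + l) ∈ κ'.fv → Sum.inl n ∈ κ.fv) ∧
      ∀ x, Sum.inr (x + b') ∈ κ'.fv → Sum.inr x ∈ κ.fv := by
  induction h with
  | refl κ => exact ⟨fun _ h => h, fun _ h => h⟩
  | @body a κ l b' κ' _ ih =>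
    refine ⟨fun n hn => Or.inr (ih.1 n hn), fun x hx => Or.inr (ih.2 (x + 1) ?_)⟩
    rwa [show x + 1 + b' = x + (b' + 1) by omega]
  | @lam κ₀ κ l b' κ' _ ih =>
    refine ⟨fun n hn => Or.inl (ih.1 (n + 1) ?_), fun x hx => Or.inl (ih.2 x hx)⟩
    rwa [show n + 1 + l = n + (l + 1) by omega]

theorem Canon.IsMSC.body {a : Atom S} {κ : Canon S} (h : (Canon.bind a κ).IsMSC) : κ.IsMSC :=
  ⟨fun l b a' κ' ho => h.shared l (b + 1) a' κ' (.body ho),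
    fun l b κ₁ κ₂ ho => h.extruded l (b + 1) κ₁ κ₂ (.body ho),
    fun l b a' κ' ho => h.useful l (b + 1) a' κ' (.body ho)⟩

theorem Canon.IsMSC.lam {κ₀ κ : Canon S} (h : (Canon.bind (.lam κ₀) κ).IsMSC) : κ₀.IsMSC :=
  ⟨fun l b a' κ' ho => h.shared (l + 1) b a' κ' (.lam ho),
    fun l b κ₁ κ₂ ho => h.extruded (l + 1) b κ₁ κ₂ (.lam ho),
    fun l b a' κ' ho => h.useful (l + 1) b a' κ' (.lam ho)⟩

/-- In a maximal sharing form, every binding of an abstraction uses the variable of the abstraction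
or another binding of it. -/
theorem Canon.IsMSC.uses {κ₀ κ : Canon S} (h : (Canon.bind (.lam κ₀) κ).IsMSC) {b : ℕ}
    {a : Atom S} {κ' : Canon S} (ho : κ₀.Occurs 0 b (.bind a κ')) :
    Sum.inl 0 ∈ a.fv ∨ ∃ x < b, Sum.inr x ∈ a.fv := by
  by_contra hc
  push Not at hc
  refine h.extruded 0 0 κ₀ κ (.refl _) 1 b a ⟨κ₀, 0, κ', rfl, rfl, ho⟩ ?_
  rintro (n | x) hv
  · cases n with
    | zero => exact absurd hv hc.1
    | succ n => exact ⟨.inl n, ho.mem_fv.1 (n + 1) (Or.inl hv), rfl⟩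
  · have hx : b ≤ x := not_lt.1 fun hlt => hc.2 x hlt hv
    refine ⟨.inr (x - b), ho.mem_fv.2 (x - b) (Or.inl ?_), ?_⟩ <;>
      simp only [Nat.sub_add_cancel hx, Sum.map_inr]
    exact hv

/-- Every binding variable stands for the expression of an atom, and `κ` does not bind any of
these atoms again. -/
def Unshared (b : ℕ) (ρ : ℕ → Expr S) (κ : Canon S) : Prop :=
  ∀ x < b, ∃ α : Atom S, α.Good b ρ ∧ α.unwind ρ = ρ x ∧
    ∀ l' b' a', κ.Defines l' b' a' → ¬ (α.shift l' b').EqCan a'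

/-- Here `p` tells whether the form is considered inside an abstraction, and the `c` most recent
binding variables are those bound in the current body. A new binding contains the abstracted
variable by the extrusion condition. It is new because an equal expression in the current body
would, by uniqueness of good atoms, come from an equivalent atom, against `Unshared`. -/
theorem Canon.IsMSC.good : ∀ (κ : Canon S), κ.IsMSC → ∀ (p : Prop) (P : Expr S → Prop) (b c : ℕ)
    (ρ : ℕ → Expr S), c ≤ b → Ctx P b ρ → (∀ x, Sum.inr x ∈ κ.fv → x < b) → Unshared b ρ κ →
    (∀ s, P s ↔ (p → 0 ∈ s.FV) ∧ ∀ x < c, ρ x ≠ s) →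
    (p → ∀ x < c, 0 ∈ (ρ x).FV) →
    (p → ∀ b' a κ', κ.Occurs 0 b' (.bind a κ') →
      Sum.inl 0 ∈ a.fv ∨ ∃ x < b' + c, Sum.inr x ∈ a.fv) →
    κ.Good P b ρ
  | .bvar x, _, _, _, _, _, _, _, _, hfv, _, _, _, _ => hfv x rfl
  | .bind a κ, hm, p, P, b, c, ρ, hcb, hρ, hfv, hun, hP, hc, huse => by
    have ha : a.Good b ρ := by
      cases a with
      | const c => trivial
      | lvar n => trivial
      | lam κ₀ =>
        refine Canon.IsMSC.good κ₀ hm.lam True _ b 0 _ (by omega) hρ.lam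
          (fun x hx => hfv x (Or.inl hx)) ?_ (by simp) (by simp)
          (fun _ b' a κ' ho => by simpa using hm.uses ho)
        intro x hx
        obtain ⟨α, h1, h2, h3⟩ := hun x hx
        refine ⟨α.shift 1 0, α.good_weaken_lam_iff.2 h1, ?_, ?_⟩
        · rw [Atom.unwind_weaken_lam, h2]
        · rintro l' b' a' ⟨κ', ho⟩
          rw [Atom.shift_shift, Nat.add_comm 1, Nat.zero_add]
          exact h3 (l' + 1) b' a' ⟨κ', .lam ho⟩
      | pair x y => exact ⟨hfv x (Or.inl (Or.inl rfl)), hfv y (Or.inl (Or.inr rfl))⟩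
      | app x y => exact ⟨hfv x (Or.inl (Or.inl rfl)), hfv y (Or.inl (Or.inr rfl))⟩
      | proj₁ x => exact hfv x (Or.inl rfl)
      | proj₂ x => exact hfv x (Or.inl rfl)
      | tcase x τ y z => exact ⟨hfv x (Or.inl (Or.inl rfl)), hfv y (Or.inl (Or.inr (Or.inl rfl))),
          hfv z (Or.inl (Or.inr (Or.inr rfl)))⟩
    have hFV : p → 0 ∈ (a.unwind ρ).FV := by
      intro hp
      rcases huse hp 0 a κ (.refl _) with h | ⟨x, hx, h⟩
      · exact ha.mem_FV 0 h
      · exact Expr.FV_of_mem_Sb _ _ (ha.of_mem_fv x h).2 (hc hp x (by omega))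
    have hPa : P (a.unwind ρ) := by
      refine (hP _).2 ⟨hFV, fun x hx he => ?_⟩
      obtain ⟨α, h1, h2, h3⟩ := hun x (by omega)
      refine h3 0 0 a ⟨κ, .refl _⟩ ?_
      rw [Atom.shift_zero]
      exact h1.eqCan hρ a ha (h2.trans he)
    have hg : κ.Good (fun s => P s ∧ s ≠ a.unwind ρ) (b + 1) (scons (a.unwind ρ) ρ) := by
      refine Canon.IsMSC.good κ hm.body p _ (b + 1) (c + 1) _ (by omega)
        (hρ.cons hPa (ha.Sb_unwind hρ)) ?_ ?_ (fun s => ?_) ?_ ?_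
      · rintro (_ | x) hx
        · omega
        · have := hfv x (Or.inr hx)
          omega
      · rintro (_ | x) hx
        · refine ⟨a.shift 0 1, a.good_weaken_iff.2 ha, a.unwind_weaken _ _, ?_⟩
          rintro l' b' a' hd
          rw [Atom.shift_shift, Nat.zero_add, Nat.add_comm 1]
          exact (hm.shared 0 0 a κ (.refl _)).1 l' b' a' hd
        · obtain ⟨α, h1, h2, h3⟩ := hun x (by omega)
          refine ⟨α.shift 0 1, α.good_weaken_iff.2 h1, (α.unwind_weaken _ _).trans h2, ?_⟩
          rintro l' b' a' ⟨κ', ho⟩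
          rw [Atom.shift_shift, Nat.zero_add, Nat.add_comm 1]
          exact h3 l' (b' + 1) a' ⟨κ', .body ho⟩
      · rw [hP, and_assoc]
        refine and_congr_right fun _ => ⟨?_, fun h => ⟨fun x hx => h (x + 1) (by omega), ?_⟩⟩
        · rintro ⟨h1, h2⟩ (_ | x) hx
          · exact h2.symm
          · exact h1 x (by omega)
        · exact (h 0 (by omega)).symm
      · rintro hp (_ | x) hx
        · exact hFV hp
        · exact hc hp x (by omega)
      · intro hp b' a' κ' ho
        have := huse hp (b' + 1) a' κ' (.body ho)
        rwa [show b' + (c + 1) = b' + 1 + c by omega]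
    -- Usefulness enters here: the variable occurs in the continuation, so its expression is a
    -- sub-expression of the unwinding.
    exact ⟨ha, hPa, (hg.of_mem_fv 0 (hm.useful 0 0 a κ (.refl _))).2, hg⟩

theorem ctx_zero (P : Expr S → Prop) (ρ : ℕ → Expr S) : Ctx P 0 ρ := by
  constructor <;> intro x hx <;> omega

theorem Canon.isMSCOf_iff {κ : Canon S} {e : Expr S} :
    κ.IsMSCOf e ↔ κ.Good (fun _ => True) 0 Expr.var ∧ κ.unwind Expr.var = e := by
  constructor
  · rintro ⟨h1, h2, h3⟩
    refine ⟨Canon.IsMSC.good κ h1 False _ 0 0 _ le_rfl (ctx_zero _ _)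
      (fun x hx => absurd hx (h2 x)) (fun x hx => by omega) (by simp) (by simp) (by simp), h3⟩
  · rintro ⟨h1, h2⟩
    refine ⟨h1.isMSC (ctx_zero _ _), fun x hx => ?_, h2⟩
    have := (h1.of_mem_fv x hx).1
    omega

theorem exists_isMSCOf (e : Expr S) : ∃ κ : Canon S, κ.IsMSCOf e := by
  obtain ⟨κ, h⟩ := exists_good e.size e le_rfl _ (fun _ => True) 0 Expr.var le_rfl (ctx_zero _ _)
    fun _ _ => Or.inl trivial
  exact ⟨κ, Canon.isMSCOf_iff.2 h⟩

theorem Canon.IsMSCOf.eqCan {κ κ' : Canon S} {e : Expr S} (h : κ.IsMSCOf e) (h' : κ'.IsMSCOf e) :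
    κ.EqCan κ' := by
  rw [Canon.isMSCOf_iff] at h h'
  exact h.1.eqCan (ctx_zero _ _) κ' h'.1 (h.2.trans h'.2.symm)

/-! ## Admissible rules of the declarative system -/

theorem Decl.rename {Γ : Env S} {e : Expr S} {t : Ty S} (h : Decl Γ e t) :
    ∀ (f : ℕ → ℕ) (Γ' : Env S), (∀ n, Γ' (f n) = Γ n) → Decl Γ' (e.rename f) t := by
  induction h with
  | const => exact fun f Γ' _ => .const
  | ax h => exact fun f Γ' hΓ => .ax ((hΓ _).trans h)
  | arrowI m _ ih =>
    refine fun f Γ' hΓ => .arrowI m (ih (upr f) _ ?_)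
    rintro (_ | n)
    · rfl
    · exact hΓ n
  | arrowE _ _ ih₁ ih₂ => exact fun f Γ' hΓ => .arrowE (ih₁ f Γ' hΓ) (ih₂ f Γ' hΓ)
  | prodI _ _ ih₁ ih₂ => exact fun f Γ' hΓ => .prodI (ih₁ f Γ' hΓ) (ih₂ f Γ' hΓ)
  | prodE₁ _ ih => exact fun f Γ' hΓ => .prodE₁ (ih f Γ' hΓ)
  | prodE₂ _ ih => exact fun f Γ' hΓ => .prodE₂ (ih f Γ' hΓ)
  | caseEmpty _ ih => exact fun f Γ' hΓ => .caseEmpty (ih f Γ' hΓ)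
  | case₁ _ _ ih₁ ih₂ => exact fun f Γ' hΓ => .case₁ (ih₁ f Γ' hΓ) (ih₂ f Γ' hΓ)
  | case₂ _ _ ih₁ ih₂ => exact fun f Γ' hΓ => .case₂ (ih₁ f Γ' hΓ) (ih₂ f Γ' hΓ)
  | @union Γ e e' s t m _ _ _ ih₁ ih₂ ih₃ =>
    intro f Γ' hΓ
    have he : (e.inst e').rename f = (e.rename (upr f)).inst (e'.rename f) := by
      rw [Expr.inst, Expr.inst, Expr.subst_rename, Expr.rename_subst]
      congr 1; funext n; cases n <;> rfl
    rw [he]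
    refine .union m (ih₁ f Γ' hΓ) (ih₂ (upr f) _ ?_) (ih₃ (upr f) _ ?_) <;>
      rintro (_ | n) <;> first | rfl | exact hΓ n
  | inter _ _ ih₁ ih₂ => exact fun f Γ' hΓ => .inter (ih₁ f Γ' hΓ) (ih₂ f Γ' hΓ)
  | inst σ _ ih => exact fun f Γ' hΓ => .inst σ (ih f Γ' hΓ)
  | sub _ h ih => exact fun f Γ' hΓ => .sub (ih f Γ' hΓ) h

theorem Decl.weaken {Γ : Env S} {e : Expr S} {t : Ty S} (h : Decl Γ e t) (s : Ty S) :
    Decl (Γ.cons s) e.shift t := h.rename _ _ fun _ => rfl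

/-- Variables may be replaced by expressions of their types. Union elimination survives because the
substitution commutes with the one in its conclusion. -/
theorem Decl.subst {Γ : Env S} {e : Expr S} {t : Ty S} (h : Decl Γ e t) :
    ∀ (θ : ℕ → Expr S) (Γ' : Env S), (∀ n s, Γ n = some s → Decl Γ' (θ n) s) →
      Decl Γ' (e.subst θ) t := by
  have up : ∀ {Γ Γ' : Env S} {θ : ℕ → Expr S} (s : Ty S),
      (∀ n s, Γ n = some s → Decl Γ' (θ n) s) → ∀ n r, (Γ.cons s) n = some r →
      Decl (Γ'.cons s) (scons (.var 0) (fun n => (θ n).shift) n) r := by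
    rintro Γ Γ' θ s hΓ (_ | n) r hr
    · exact .ax hr
    · exact (hΓ n r hr).weaken s
  induction h with
  | const => exact fun f Γ' _ => .const
  | ax h => exact fun f Γ' hΓ => hΓ _ _ h
  | arrowI m _ ih => exact fun f Γ' hΓ => .arrowI m (ih _ _ (up _ hΓ))
  | arrowE _ _ ih₁ ih₂ => exact fun f Γ' hΓ => .arrowE (ih₁ f Γ' hΓ) (ih₂ f Γ' hΓ)
  | prodI _ _ ih₁ ih₂ => exact fun f Γ' hΓ => .prodI (ih₁ f Γ' hΓ) (ih₂ f Γ' hΓ)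
  | prodE₁ _ ih => exact fun f Γ' hΓ => .prodE₁ (ih f Γ' hΓ)
  | prodE₂ _ ih => exact fun f Γ' hΓ => .prodE₂ (ih f Γ' hΓ)
  | caseEmpty _ ih => exact fun f Γ' hΓ => .caseEmpty (ih f Γ' hΓ)
  | case₁ _ _ ih₁ ih₂ => exact fun f Γ' hΓ => .case₁ (ih₁ f Γ' hΓ) (ih₂ f Γ' hΓ)
  | case₂ _ _ ih₁ ih₂ => exact fun f Γ' hΓ => .case₂ (ih₁ f Γ' hΓ) (ih₂ f Γ' hΓ)
  | @union Γ e e' s t m _ _ _ ih₁ ih₂ ih₃ =>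
    intro θ Γ' hΓ
    have he : (e.inst e').subst θ =
        (e.subst (scons (.var 0) fun n => (θ n).shift)).inst (e'.subst θ) := by
      rw [Expr.inst_subst, Expr.inst, Expr.subst_subst]
      congr 1; funext n
      cases n with
      | zero => rfl
      | succ n => exact ((Expr.shift_subst _ _ _).trans (Expr.subst_var _)).symm
    rw [he]
    exact .union m (ih₁ θ Γ' hΓ) (ih₂ _ _ (up _ hΓ)) (ih₃ _ _ (up _ hΓ))
  | inter _ _ ih₁ ih₂ => exact fun f Γ' hΓ => .inter (ih₁ f Γ' hΓ) (ih₂ f Γ' hΓ)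
  | inst σ _ ih => exact fun f Γ' hΓ => .inst σ (ih f Γ' hΓ)
  | sub _ h ih => exact fun f Γ' hΓ => .sub (ih f Γ' hΓ) h

theorem Decl.instVar {Γ : Env S} {e e' : Expr S} {s t : Ty S} (h : Decl Γ e' s)
    (h' : Decl (Γ.cons s) e t) : Decl Γ (e.inst e') t := by
  refine h'.subst _ _ ?_
  rintro (_ | n) r hr
  · cases hr; exact h
  · exact .ax hr

theorem Decl.mono_cons {Γ : Env S} {e : Expr S} {s s' t : Ty S} (h : Decl (Γ.cons s) e t)
    (hs : Ty.Sub s' s) : Decl (Γ.cons s') e t := by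
  have := h.subst .var (Γ.cons s') (by
    rintro (_ | n) r hr
    · cases hr; exact .sub (.ax rfl) hs
    · exact .ax hr)
  rwa [Expr.subst_var] at this

/-- Split on the first member and treat its complement with the others. The last member needs no
split, as it covers what remains. An empty cover would leave no derivation of `e` to start from. -/
theorem Decl.cover {Γ : Env S} {e : Expr S} {t : Ty S} (ms : List (MonoTy S)) :
    ∀ s : Ty S, ms ≠ [] → (∀ d : Dom S, d.Mem s → ∃ m ∈ ms, d.Mem m.1) →
    (∀ m ∈ ms, Decl (Γ.cons (s.inter m.1)) e t) → Decl (Γ.cons s) e t := by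
  induction ms with
  | nil => intro s h; exact absurd rfl h
  | cons m ms ih =>
    intro s _ hc hd
    by_cases hms : ms = []
    · subst hms
      refine (hd m (by simp)).mono_cons fun d hs => (Dom.mem_inter _ _ _).2 ⟨hs, ?_⟩
      simpa using hc d hs
    · have h1 : Decl (Γ.cons s) (.var 0) s := .ax rfl
      -- Union elimination is applied to the variable `0` itself. For this `e` is moved to a second,
      -- fresh variable, which is then replaced by the original one.
      have key : ∀ r, Decl (Γ.cons r) e t → Decl ((Γ.cons s).cons r) (e.rename (upr Nat.succ)) t := by
        intro r hr
        refine hr.rename _ _ ?_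
        rintro (_ | n) <;> rfl
      have h2 : Decl (Γ.cons (s.inter m.1.neg)) e t := by
        refine ih _ hms (fun d hd => ?_) fun m' hm' => ?_
        · simp only [Dom.mem_inter, Dom.mem_neg] at hd
          obtain ⟨m', hm', h⟩ := hc d hd.1
          rcases List.mem_cons.1 hm' with rfl | h'
          · exact absurd h hd.2
          · exact ⟨m', h', h⟩
        · refine (hd m' (List.mem_cons_of_mem _ hm')).mono_cons fun d h => ?_
          simp only [Dom.mem_inter] at h ⊢
          exact ⟨h.1.1, h.2⟩
      have h3 := Decl.union m h1 (key _ (hd m (by simp))) (key _ h2)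
      have he : (e.rename (upr Nat.succ)).inst (.var 0) = e := by
        rw [Expr.inst, Expr.rename_subst]
        refine Eq.trans ?_ (Expr.subst_var e)
        congr 1; funext n; cases n <;> rfl
      rwa [he] at h3

theorem Decl.bigInter {Γ : Env S} {e : Expr S} {l : List (Ty S)} (h0 : l ≠ [])
    (h : ∀ t ∈ l, Decl Γ e t) : Decl Γ e (.bigInter l) := by
  induction l with
  | nil => exact absurd rfl h0
  | cons a l ih =>
    have ha := h a (by simp)
    by_cases hl : l = []
    · subst hl
      exact .inter ha (.sub ha (Ty.sub_any _))
    · exact .inter ha (ih hl fun t ht => h t (List.mem_cons_of_mem _ ht))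

theorem Decl.instList {Γ : Env S} {e : Expr S} {t : Ty S} (h : Decl Γ e t)
    (θs : List (ℕ → Ty S)) : Decl Γ e (t.inst θs) := by
  by_cases h0 : θs = []
  · subst h0
    exact .sub h (Ty.sub_any _)
  · refine Decl.bigInter (by simpa using h0) fun r hr => ?_
    obtain ⟨σ, -, rfl⟩ := List.mem_map.1 hr
    exact .inst σ h

/-! ## Soundness -/

mutual
/-- Unwinding with substitution of the lambda variables by `θ`. -/
def Atom.unwindSubst (θ ρ : ℕ → Expr S) : Atom S → Expr S
  | .const c => .const c
  | .lvar n => θ n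
  | .lam κ => .lam (κ.unwindSubst (scons (.var 0) fun n => (θ n).shift) fun x => (ρ x).shift)
  | .pair x₁ x₂ => .pair (ρ x₁) (ρ x₂)
  | .app x₁ x₂ => .app (ρ x₁) (ρ x₂)
  | .proj₁ x => .proj₁ (ρ x)
  | .proj₂ x => .proj₂ (ρ x)
  | .tcase x τ x₁ x₂ => .tcase (ρ x) τ (ρ x₁) (ρ x₂)

def Canon.unwindSubst (θ ρ : ℕ → Expr S) : Canon S → Expr S
  | .bvar x => ρ x
  | .bind a κ => κ.unwindSubst θ (scons (a.unwindSubst θ ρ) ρ)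
end

theorem scons_var_shift : (scons (.var 0) fun n => (Expr.var n : Expr S).shift) = Expr.var := by
  funext n; cases n <;> rfl

mutual
theorem Atom.unwindSubst_var (ρ : ℕ → Expr S) : ∀ a : Atom S, a.unwindSubst .var ρ = a.unwind ρ
  | .const _ => rfl
  | .lvar _ => rfl
  | .lam κ => by
    simp only [Atom.unwindSubst, Atom.unwind, scons_var_shift, Canon.unwindSubst_var _ κ]
  | .pair _ _ => rfl
  | .app _ _ => rfl
  | .proj₁ _ => rfl
  | .proj₂ _ => rfl
  | .tcase _ _ _ _ => rfl

theorem Canon.unwindSubst_var (ρ : ℕ → Expr S) : ∀ κ : Canon S, κ.unwindSubst .var ρ = κ.unwind ρ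
  | .bvar _ => rfl
  | .bind a κ => by
    simp only [Canon.unwindSubst, Canon.unwind, Atom.unwindSubst_var _ a, Canon.unwindSubst_var _ κ]
end

theorem scons_shift_subst (η : ℕ → Expr S) (e : Expr S) :
    e.shift.subst (scons (.var 0) fun n => (η n).shift) = (e.subst η).shift :=
  (Expr.shift_subst _ _ _).trans (Expr.subst_rename _ _ _).symm

mutual
theorem Atom.unwindSubst_subst (η θ ρ : ℕ → Expr S) : ∀ a : Atom S,
    (a.unwindSubst θ ρ).subst η = a.unwindSubst (fun n => (θ n).subst η) fun x => (ρ x).subst η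
  | .const _ => rfl
  | .lvar _ => rfl
  | .lam κ => by
    simp only [Atom.unwindSubst, Expr.subst]
    rw [Canon.unwindSubst_subst _ _ _ κ]
    congr 2
    · funext n
      cases n with
      | zero => rfl
      | succ n => exact scons_shift_subst _ _
    · funext x
      exact scons_shift_subst _ _
  | .pair _ _ => rfl
  | .app _ _ => rfl
  | .proj₁ _ => rfl
  | .proj₂ _ => rfl
  | .tcase _ _ _ _ => rfl

theorem Canon.unwindSubst_subst (η θ ρ : ℕ → Expr S) : ∀ κ : Canon S,
    (κ.unwindSubst θ ρ).subst η = κ.unwindSubst (fun n => (θ n).subst η) fun x => (ρ x).subst η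
  | .bvar _ => rfl
  | .bind a κ => by
    simp only [Canon.unwindSubst]
    rw [Canon.unwindSubst_subst _ _ _ κ, ← Atom.unwindSubst_subst η θ ρ a]
    congr 1
    funext n; cases n <;> rfl
end

theorem Env.decl_cons {Γ Γ' : Env S} {θ : ℕ → Expr S} (s : Ty S)
    (hΓ : ∀ n s, Γ n = some s → Decl Γ' (θ n) s) : ∀ n r, (Γ.cons s) n = some r →
      Decl (Γ'.cons s) (scons (.var 0) (fun n => (θ n).shift) n) r := by
  rintro (_ | n) r hr
  · exact .ax hr
  · exact (hΓ n r hr).weaken s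

mutual
-- The statement allows arbitrary expressions for both sorts of variables. In the `keep` case the
-- continuation is first typed with a fresh source variable for the binding, then the expression of
-- the atom is substituted for it.
theorem AlgA.sound {Γ Δ : Env S} {a : Atom S} {A : AAnnot S} {t : Ty S} :
    AlgA Γ Δ a A t → ∀ (θ ρ : ℕ → Expr S) (Γ' : Env S), (∀ n s, Γ n = some s → Decl Γ' (θ n) s) →
      (∀ x s, Δ x = some s → Decl Γ' (ρ x) s) → Decl Γ' (a.unwindSubst θ ρ) t
  | .const => fun _ _ _ _ _ => .const
  | .ax h => fun _ _ _ hΓ _ => hΓ _ _ h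
  | .arrowI h => fun θ ρ Γ' hΓ hΔ => .arrowI _ (h.sound _ _ _ (Env.decl_cons _ hΓ)
      fun x s hx => (hΔ x s hx).weaken _)
  | .arrowE h₁ h₂ _ _ _ h₃ => fun θ ρ Γ' _ hΔ =>
    .arrowE (.sub ((hΔ _ _ h₁).instList _) h₃.1) ((hΔ _ _ h₂).instList _)
  | .prodI h₁ h₂ => fun θ ρ Γ' _ hΔ => .prodI (.inst _ (hΔ _ _ h₁)) (.inst _ (hΔ _ _ h₂))
  | .prodE₁ h _ h' => fun θ ρ Γ' _ hΔ => .prodE₁ (.sub ((hΔ _ _ h).instList _) h'.1)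
  | .prodE₂ h _ h' => fun θ ρ Γ' _ hΔ => .prodE₂ (.sub ((hΔ _ _ h).instList _) h'.1)
  | .caseEmpty h h' => fun θ ρ Γ' _ hΔ => .caseEmpty (.sub ((hΔ _ _ h).instList _) h'.1)
  | .case₁ h h' h₁ => fun θ ρ Γ' _ hΔ => .case₁ (.sub ((hΔ _ _ h).instList _) h') (hΔ _ _ h₁)
  | .case₂ h h' h₁ => fun θ ρ Γ' _ hΔ => .case₂ (.sub ((hΔ _ _ h).instList _) h') (hΔ _ _ h₁)
  | .inter h0 h => fun θ ρ Γ' hΓ hΔ => Decl.bigInter (by simpa using h0) fun t ht => by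
    obtain ⟨i, rfl⟩ := (List.mem_ofFn' _ _).1 ht
    exact (h i).sound θ ρ Γ' hΓ hΔ

theorem AlgF.sound {Γ Δ : Env S} {κ : Canon S} {A : FAnnot S} {t : Ty S} :
    AlgF Γ Δ κ A t → ∀ (θ ρ : ℕ → Expr S) (Γ' : Env S), (∀ n s, Γ n = some s → Decl Γ' (θ n) s) →
      (∀ x s, Δ x = some s → Decl Γ' (ρ x) s) → Decl Γ' (κ.unwindSubst θ ρ) t
  | .var h => fun θ ρ Γ' _ hΔ => .inst _ (hΔ _ _ h)
  | .bind₁ h => fun θ ρ Γ' hΓ hΔ => h.sound θ _ Γ' hΓ (by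
      rintro (_ | x) s hx
      · cases hx
      · exact hΔ x s hx)
  | @AlgF.bind₂ _ Γ Δ a κ A s n m As t hm h h' => fun θ ρ Γ' hΓ hΔ => by
    have h1 := h.sound θ ρ Γ' hΓ hΔ
    have h2 : ∀ i, Decl (Γ'.cons (s.inter (m i).1))
        (κ.unwindSubst (fun n => (θ n).shift) (scons (.var 0) fun x => (ρ x).shift))
        (.bigUnion (List.ofFn t)) := fun i =>
      .sub ((h' i).sound _ _ _ (fun n r hn => (hΓ n r hn).weaken _) (by
        rintro (_ | x) r hx
        · exact .ax hx
        · exact (hΔ x r hx).weaken _))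
        (Ty.sub_bigUnion ((List.mem_ofFn' _ _).2 ⟨i, rfl⟩))
    have hcov : ∀ d : Dom S, ∃ i, d.Mem (m i).1 := by
      intro d
      obtain ⟨_, h1, h2⟩ := (Dom.mem_bigUnion d _).1 (hm.2 d (Dom.mem_any d))
      obtain ⟨i, rfl⟩ := (List.mem_ofFn' _ _).1 h1
      exact ⟨i, h2⟩
    have h3 := Decl.cover (List.ofFn m) s (by
      intro h0
      -- The domain is not empty: it contains the empty relation. Hence the cover has a member.
      obtain ⟨i, -⟩ := hcov (.fn (m := 0) (k := 0) Fin.elim0 Fin.elim0 Fin.elim0 ∅)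
      have := (List.ofFn_eq_nil_iff.1 h0)
      exact absurd i.2 (by omega))
      (fun d _ => by
        obtain ⟨i, hi⟩ := hcov d
        exact ⟨m i, (List.mem_ofFn' _ _).2 ⟨i, rfl⟩, hi⟩)
      (fun m' hm' => by
        obtain ⟨i, rfl⟩ := (List.mem_ofFn' _ _).1 hm'
        exact h2 i)
    have h4 := h1.instVar h3
    rw [Expr.inst, Canon.unwindSubst_subst] at h4
    have e1 : (fun n => ((θ n).shift).subst (scons (a.unwindSubst θ ρ) .var)) = θ := by
      funext n
      exact (Expr.shift_subst _ _ _).trans (Expr.subst_var _)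
    have e2 : (fun x => (scons (.var 0) (fun x => (ρ x).shift) x : Expr S).subst
        (scons (a.unwindSubst θ ρ) .var)) = scons (a.unwindSubst θ ρ) ρ := by
      funext x
      cases x with
      | zero => rfl
      | succ x => exact (Expr.shift_subst _ _ _).trans (Expr.subst_var _)
    rw [e1, e2] at h4
    exact h4
  | .inter h0 h => fun θ ρ Γ' hΓ hΔ => Decl.bigInter (by simpa using h0) fun t ht => by
    obtain ⟨i, rfl⟩ := (List.mem_ofFn' _ _).1 ht
    exact (h i).sound θ ρ Γ' hΓ hΔ
end

theorem AlgF.decl {Γ : Env S} {κ : Canon S} {A : FAnnot S} {t : Ty S} (h : AlgF Γ Env.nil κ A t) :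
    Decl Γ (κ.unwind Expr.var) t := by
  rw [← Canon.unwindSubst_var]
  exact h.sound _ _ Γ (fun n s hn => .ax hn) fun x s hx => by cases hx

/-! ## Monotonicity of the algorithmic system -/

/-- `Δ'` gives polymorphic subtypes of the types of `Δ`. -/
def Env.Le (Δ' Δ : Env S) : Prop := ∀ x s, Δ x = some s → ∃ s', Δ' x = some s' ∧ s'.PolySub s

theorem Env.Le.cons {Δ' Δ : Env S} (h : Δ'.Le Δ) {s' s : Ty S} (hs : s'.PolySub s) :
    Env.Le (Δ'.cons s') (Δ.cons s) := by
  rintro (_ | x) r hr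
  · cases hr
    exact ⟨s', rfl, hs⟩
  · exact h x r hr

/-- The atom has a type that is a polymorphic subtype of `s`. -/
def HasA (Γ Δ : Env S) (a : Atom S) (s : Ty S) : Prop := ∃ A s', AlgA Γ Δ a A s' ∧ s'.PolySub s

/-- The form has a type that is a polymorphic subtype of `t`. -/
def HasF (Γ Δ : Env S) (κ : Canon S) (t : Ty S) : Prop := ∃ A t', AlgF Γ Δ κ A t' ∧ t'.PolySub t

theorem HasA.trans {Γ Δ : Env S} {a : Atom S} {s t : Ty S} (h : HasA Γ Δ a s) (h' : s.PolySub t) :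
    HasA Γ Δ a t :=
  let ⟨A, s', h1, h2⟩ := h
  ⟨A, s', h1, h2.trans h'⟩

theorem HasF.trans {Γ Δ : Env S} {κ : Canon S} {s t : Ty S} (h : HasF Γ Δ κ s)
    (h' : s.PolySub t) : HasF Γ Δ κ t :=
  let ⟨A, s', h1, h2⟩ := h
  ⟨A, s', h1, h2.trans h'⟩

theorem HasA.bigInter {Γ Δ : Env S} {a : Atom S} {n : ℕ} (hn : n ≠ 0) {t : Fin n → Ty S}
    (h : ∀ i, HasA Γ Δ a (t i)) : HasA Γ Δ a (.bigInter (List.ofFn t)) := by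
  choose A s h1 h2 using h
  refine ⟨_, _, .inter hn h1, Ty.PolySub.bigInter_right fun r hr => ?_⟩
  obtain ⟨i, rfl⟩ := (List.mem_ofFn' _ _).1 hr
  exact (Ty.bigInter_sub ((List.mem_ofFn' _ _).2 ⟨i, rfl⟩)).polySub.trans (h2 i)

theorem HasF.bigInter {Γ Δ : Env S} {κ : Canon S} {n : ℕ} (hn : n ≠ 0) {t : Fin n → Ty S}
    (h : ∀ i, HasF Γ Δ κ (t i)) : HasF Γ Δ κ (.bigInter (List.ofFn t)) := by
  choose A s h1 h2 using h
  refine ⟨_, _, .inter hn h1, Ty.PolySub.bigInter_right fun r hr => ?_⟩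
  obtain ⟨i, rfl⟩ := (List.mem_ofFn' _ _).1 hr
  exact (Ty.bigInter_sub ((List.mem_ofFn' _ _).2 ⟨i, rfl⟩)).polySub.trans (h2 i)

theorem HasA.inter {Γ Δ : Env S} {a : Atom S} {s t : Ty S} (h : HasA Γ Δ a s)
    (h' : HasA Γ Δ a t) : HasA Γ Δ a (s.inter t) := by
  refine (HasA.bigInter (t := ![s, t]) (by simp) (by simp [Fin.forall_fin_two, h, h'])).trans
    (Ty.Sub.polySub fun d hd => ?_)
  simpa [Dom.mem_bigInter] using hd

/-- A single arrow inequality yields all premises of the algorithmic application rule. Maximality of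
the domain accepts the argument, minimality of the result keeps it below `r`. -/
theorem exists_app_of_sub {s₁ s₂ r : Ty S} (h : Ty.Sub s₁ (.arrow s₂ r)) :
    Ty.Sub s₁ (.arrow .empty .any) ∧ ∃ d r', Ty.IsDom s₁ d ∧ Ty.Sub s₂ d ∧
      Ty.IsApply s₁ s₂ r' ∧ Ty.Sub r' r := by
  have h1 : Ty.Sub s₁ (.arrow s₂ .any) := h.trans (.arrow (.refl _) (Ty.sub_any _))
  have h2 := h1.trans (.arrow (Ty.empty_sub _) (.refl _))
  obtain ⟨d, hd⟩ := Ty.exists_isDom h2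
  obtain ⟨r', hr⟩ := Ty.exists_isApply h1
  exact ⟨h2, d, r', hd, hd.2 _ h1, hr, hr.2 _ h⟩

theorem HasA.app {Γ Δ : Env S} {x₁ x₂ : ℕ} {s₁ s₂ r : Ty S} {θs₁ θs₂ : List (ℕ → Ty S)}
    (h₁ : Δ x₁ = some s₁) (h₂ : Δ x₂ = some s₂)
    (h : Ty.Sub (s₁.inst θs₁) (.arrow (s₂.inst θs₂) r)) : HasA Γ Δ (.app x₁ x₂) r := by
  obtain ⟨h3, d, r', h4, h5, h6, h7⟩ := exists_app_of_sub h
  exact ⟨_, r', .arrowE h₁ h₂ h3 h4 h5 h6, h7.polySub⟩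

theorem HasA.proj₁ {Γ Δ : Env S} {x : ℕ} {s r r' : Ty S} {θs : List (ℕ → Ty S)}
    (h : Δ x = some s) (h' : Ty.Sub (s.inst θs) (.prod r r')) : HasA Γ Δ (.proj₁ x) r := by
  obtain ⟨q, hq⟩ := Ty.exists_isProj₁ (h'.trans (.prod (Ty.sub_any _) (Ty.sub_any _)))
  exact ⟨_, q, .prodE₁ h (h'.trans (.prod (Ty.sub_any _) (Ty.sub_any _))) hq,
    (hq.2 _ (h'.trans (.prod (.refl _) (Ty.sub_any _)))).polySub⟩

theorem HasA.proj₂ {Γ Δ : Env S} {x : ℕ} {s r r' : Ty S} {θs : List (ℕ → Ty S)}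
    (h : Δ x = some s) (h' : Ty.Sub (s.inst θs) (.prod r r')) : HasA Γ Δ (.proj₂ x) r' := by
  obtain ⟨q, hq⟩ := Ty.exists_isProj₂ (h'.trans (.prod (Ty.sub_any _) (Ty.sub_any _)))
  exact ⟨_, q, .prodE₂ h (h'.trans (.prod (Ty.sub_any _) (Ty.sub_any _))) hq,
    (hq.2 _ (h'.trans (.prod (Ty.sub_any _) (.refl _)))).polySub⟩

theorem HasA.pair {Γ Δ : Env S} {x₁ x₂ : ℕ} {s₁ s₂ t₁ t₂ : Ty S} (h₁ : Δ x₁ = some s₁)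
    (h₂ : Δ x₂ = some s₂) (h₁' : s₁.PolySub t₁) (h₂' : s₂.PolySub t₂) :
    HasA Γ Δ (.pair x₁ x₂) (.prod t₁ t₂) :=
  ⟨_, _, .prodI h₁ h₂, h₁'.prod h₂'⟩

theorem HasA.lam {Γ Δ : Env S} {κ : Canon S} {m : MonoTy S} {t : Ty S}
    (h : HasF (Γ.cons m.1) Δ κ t) : HasA Γ Δ (.lam κ) (.arrow m.1 t) :=
  let ⟨_, _, h1, h2⟩ := h
  ⟨_, _, .arrowI h1, h2.arrow m.2⟩

/-- The type of a form can be renamed. -/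
theorem AlgF.exists_rename {Γ Δ : Env S} {κ : Canon S} {A : FAnnot S} {t : Ty S} (ρ : Renaming) :
    AlgF Γ Δ κ A t → ∃ A' t', AlgF Γ Δ κ A' t' ∧ Ty.Sub t' (t.rename ρ.1)
  | @AlgF.var _ _ _ _ s ρ₀ h => by
    refine ⟨_, _, .var (ρ := ⟨ρ.1 ∘ ρ₀.1, ρ.2.comp ρ₀.2⟩) h, fun d hd => ?_⟩
    rw [Ty.rename, Ty.rename, Ty.mem_subst_subst]
    simpa [Ty.rename] using hd
  | .bind₁ h =>
    let ⟨_, _, h1, h2⟩ := h.exists_rename ρ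
    ⟨_, _, .bind₁ h1, h2⟩
  | @AlgF.bind₂ _ _ _ _ _ _ _ _ _ _ t hm h h' => by
    choose A' t' h1 h2 using fun i => (h' i).exists_rename ρ
    refine ⟨_, _, .bind₂ hm h h1, fun d hd => ?_⟩
    obtain ⟨_, h3, h4⟩ := (Dom.mem_bigUnion _ _).1 hd
    obtain ⟨i, rfl⟩ := (List.mem_ofFn' _ _).1 h3
    rw [Ty.rename, Ty.subst_bigUnion, Dom.mem_bigUnion]
    exact ⟨_, List.mem_map_of_mem ((List.mem_ofFn' _ _).2 ⟨i, rfl⟩), h2 i d h4⟩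
  | @AlgF.inter _ _ _ _ _ _ t hn h => by
    choose A' t' h1 h2 using fun i => (h i).exists_rename ρ
    refine ⟨_, _, .inter hn h1, fun d hd => ?_⟩
    rw [Ty.rename, Ty.subst_bigInter, Dom.mem_bigInter]
    intro r hr
    obtain ⟨_, h3, rfl⟩ := List.mem_map.1 hr
    obtain ⟨i, rfl⟩ := (List.mem_ofFn' _ _).1 h3
    exact h2 i d ((Dom.mem_bigInter _ _).1 hd _ ((List.mem_ofFn' _ _).2 ⟨i, rfl⟩))

/-- The types of the branches are renamed apart first, so that each can be instantiated
independently and their union stays `⊑ t`. -/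
theorem HasF.bind {Γ Δ : Env S} {a : Atom S} {κ : Canon S} {A : AAnnot S} {s t : Ty S} {n : ℕ}
    {m : Fin n → MonoTy S} (hm : Ty.Equiv (.bigUnion (List.ofFn fun i => (m i).1)) .any)
    (ha : AlgA Γ Δ a A s) (h : ∀ i, HasF Γ (Δ.cons (.inter s (m i).1)) κ t) :
    HasF Γ Δ (.bind a κ) t := by
  choose A t' h1 h2 using h
  choose A' t'' h3 h4 using fun i => (h1 i).exists_rename (Ty.copy i)
  exact ⟨_, _, .bind₂ hm ha h3, Ty.PolySub.bigUnion_copy h2 h4⟩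

mutual
-- Smaller types of the binding variables have instances below the given ones, since `⊑` composes.
-- The annotations change, and the resulting type is smaller in the sense of `⊑`.
theorem AlgA.anti {Γ Δ : Env S} {a : Atom S} {A : AAnnot S} {t : Ty S} :
    AlgA Γ Δ a A t → ∀ Δ' : Env S, Δ'.Le Δ → HasA Γ Δ' a t
  | .const => fun _ _ => ⟨_, _, .const, .refl _⟩
  | .ax h => fun _ _ => ⟨_, _, .ax h, .refl _⟩
  | .arrowI h => fun Δ' hΔ => HasA.lam (h.anti Δ' hΔ)
  | @AlgA.arrowE _ _ _ _ _ _ _ θs₁ θs₂ d r h₁ h₂ _ _ _ h₃ => fun Δ' hΔ => by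
    obtain ⟨s₁', g1, g2⟩ := hΔ _ _ h₁
    obtain ⟨s₂', g3, g4⟩ := hΔ _ _ h₂
    obtain ⟨η₁, g5⟩ := g2.exists_inst_sub_inst θs₁
    obtain ⟨η₂, g6⟩ := g4.exists_inst_sub_inst θs₂
    exact HasA.app g1 g3 ((g5.trans h₃.1).trans (.arrow g6 (.refl _)))
  | .prodI h₁ h₂ => fun Δ' hΔ => by
    obtain ⟨s₁', g1, g2⟩ := hΔ _ _ h₁
    obtain ⟨s₂', g3, g4⟩ := hΔ _ _ h₂
    exact HasA.pair g1 g3 (g2.trans (Ty.polySub_subst _ _)) (g4.trans (Ty.polySub_subst _ _))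
  | @AlgA.prodE₁ _ _ _ _ _ θs _ h _ h' => fun Δ' hΔ => by
    obtain ⟨s', g1, g2⟩ := hΔ _ _ h
    obtain ⟨η, g3⟩ := g2.exists_inst_sub_inst θs
    exact HasA.proj₁ g1 (g3.trans h'.1)
  | @AlgA.prodE₂ _ _ _ _ _ θs _ h _ h' => fun Δ' hΔ => by
    obtain ⟨s', g1, g2⟩ := hΔ _ _ h
    obtain ⟨η, g3⟩ := g2.exists_inst_sub_inst θs
    exact HasA.proj₂ g1 (g3.trans h'.1)
  | @AlgA.caseEmpty _ _ _ _ _ _ _ _ θs h h' => fun Δ' hΔ => by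
    obtain ⟨s', g1, g2⟩ := hΔ _ _ h
    obtain ⟨η, g3⟩ := g2.exists_inst_sub_inst θs
    exact ⟨_, _, .caseEmpty g1 ⟨g3.trans h'.1, Ty.empty_sub _⟩, .refl _⟩
  | @AlgA.case₁ _ _ _ _ _ _ _ _ θs _ h h' h₁ => fun Δ' hΔ => by
    obtain ⟨s', g1, g2⟩ := hΔ _ _ h
    obtain ⟨t', g4, g5⟩ := hΔ _ _ h₁
    obtain ⟨η, g3⟩ := g2.exists_inst_sub_inst θs
    exact ⟨_, _, .case₁ g1 (g3.trans h') g4, g5⟩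
  | @AlgA.case₂ _ _ _ _ _ _ _ _ θs _ h h' h₁ => fun Δ' hΔ => by
    obtain ⟨s', g1, g2⟩ := hΔ _ _ h
    obtain ⟨t', g4, g5⟩ := hΔ _ _ h₁
    obtain ⟨η, g3⟩ := g2.exists_inst_sub_inst θs
    exact ⟨_, _, .case₂ g1 (g3.trans h') g4, g5⟩
  | .inter hn h => fun Δ' hΔ => HasA.bigInter hn fun i => (h i).anti Δ' hΔ

theorem AlgF.anti {Γ Δ : Env S} {κ : Canon S} {A : FAnnot S} {t : Ty S} :
    AlgF Γ Δ κ A t → ∀ Δ' : Env S, Δ'.Le Δ → HasF Γ Δ' κ t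
  | @AlgF.var _ _ _ _ _ ρ h => fun Δ' hΔ => by
    obtain ⟨s', g1, g2⟩ := hΔ _ _ h
    exact ⟨_, _, .var (ρ := ρ) g1, ((Ty.rename_polySub _ ρ.2).trans g2).trans
      (Ty.polySub_subst _ _)⟩
  | .bind₁ h => fun Δ' hΔ =>
    let ⟨_, _, h1, h2⟩ := h.anti Δ'.skip (by
      rintro (_ | x) s hs
      · cases hs
      · exact hΔ x s hs)
    ⟨_, _, .bind₁ h1, h2⟩
  | .bind₂ hm h h' => fun Δ' hΔ => by
    obtain ⟨A', s', h1, h2⟩ := h.anti Δ' hΔ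
    exact HasF.bind hm h1 fun i => ((h' i).anti _ (hΔ.cons (h2.inter_mono _))).trans
      (Ty.sub_bigUnion ((List.mem_ofFn' _ _).2 ⟨i, rfl⟩)).polySub
  | .inter hn h => fun Δ' hΔ => HasF.bigInter hn fun i => (h i).anti Δ' hΔ
end

theorem HasA.anti {Γ Δ Δ' : Env S} {a : Atom S} {t : Ty S} (h : HasA Γ Δ a t) (hΔ : Δ'.Le Δ) :
    HasA Γ Δ' a t :=
  let ⟨_, _, h1, h2⟩ := h
  (h1.anti Δ' hΔ).trans h2

theorem HasF.anti {Γ Δ Δ' : Env S} {κ : Canon S} {t : Ty S} (h : HasF Γ Δ κ t) (hΔ : Δ'.Le Δ) :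
    HasF Γ Δ' κ t :=
  let ⟨_, _, h1, h2⟩ := h
  (h1.anti Δ' hΔ).trans h2

mutual
-- A derivation for a renamed atom looks up only renamed variables, so the same annotation works
-- before renaming. This undoes weakenings.
theorem AlgA.of_rename {Γ' Δ' : Env S} {a' : Atom S} {A : AAnnot S} {t : Ty S} :
    AlgA Γ' Δ' a' A t → ∀ (Γ Δ : Env S) (f g : ℕ → ℕ) (a : Atom S), a.rename f g = a' →
      (∀ n, Γ' (f n) = Γ n) → (∀ x, Δ' (g x) = Δ x) → AlgA Γ Δ a A t
  | .const => by
    intro Γ Δ f g a ha hΓ hΔ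
    cases a <;> simp only [Atom.rename, reduceCtorEq, Atom.const.injEq] at ha
    subst ha
    exact .const
  | .ax h => by
    intro Γ Δ f g a ha hΓ hΔ
    cases a <;> simp only [Atom.rename, reduceCtorEq, Atom.lvar.injEq] at ha
    subst ha
    exact .ax (hΓ _ ▸ h)
  | .arrowI h => by
    intro Γ Δ f g a ha hΓ hΔ
    cases a <;> simp only [Atom.rename, reduceCtorEq, Atom.lam.injEq] at ha
    refine .arrowI (h.of_rename _ _ _ _ _ ha ?_ hΔ)
    rintro (_ | n)
    · rfl
    · exact hΓ n
  | .arrowE h₁ h₂ h₃ h₄ h₅ h₆ => by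
    intro Γ Δ f g a ha hΓ hΔ
    cases a <;> simp only [Atom.rename, reduceCtorEq, Atom.app.injEq] at ha
    obtain ⟨rfl, rfl⟩ := ha
    exact .arrowE (hΔ _ ▸ h₁) (hΔ _ ▸ h₂) h₃ h₄ h₅ h₆
  | .prodI h₁ h₂ => by
    intro Γ Δ f g a ha hΓ hΔ
    cases a <;> simp only [Atom.rename, reduceCtorEq, Atom.pair.injEq] at ha
    obtain ⟨rfl, rfl⟩ := ha
    exact .prodI (hΔ _ ▸ h₁) (hΔ _ ▸ h₂)
  | .prodE₁ h₁ h₂ h₃ => by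
    intro Γ Δ f g a ha hΓ hΔ
    cases a <;> simp only [Atom.rename, reduceCtorEq, Atom.proj₁.injEq] at ha
    subst ha
    exact .prodE₁ (hΔ _ ▸ h₁) h₂ h₃
  | .prodE₂ h₁ h₂ h₃ => by
    intro Γ Δ f g a ha hΓ hΔ
    cases a <;> simp only [Atom.rename, reduceCtorEq, Atom.proj₂.injEq] at ha
    subst ha
    exact .prodE₂ (hΔ _ ▸ h₁) h₂ h₃
  | .caseEmpty h₁ h₂ => by
    intro Γ Δ f g a ha hΓ hΔ
    cases a <;> simp only [Atom.rename, reduceCtorEq, Atom.tcase.injEq] at ha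
    obtain ⟨rfl, rfl, rfl, rfl⟩ := ha
    exact .caseEmpty (hΔ _ ▸ h₁) h₂
  | .case₁ h₁ h₂ h₃ => by
    intro Γ Δ f g a ha hΓ hΔ
    cases a <;> simp only [Atom.rename, reduceCtorEq, Atom.tcase.injEq] at ha
    obtain ⟨rfl, rfl, rfl, rfl⟩ := ha
    exact .case₁ (hΔ _ ▸ h₁) h₂ (hΔ _ ▸ h₃)
  | .case₂ h₁ h₂ h₃ => by
    intro Γ Δ f g a ha hΓ hΔ
    cases a <;> simp only [Atom.rename, reduceCtorEq, Atom.tcase.injEq] at ha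
    obtain ⟨rfl, rfl, rfl, rfl⟩ := ha
    exact .case₂ (hΔ _ ▸ h₁) h₂ (hΔ _ ▸ h₃)
  | .inter hn h => fun _ _ _ _ _ ha hΓ hΔ => .inter hn fun i => (h i).of_rename _ _ _ _ _ ha hΓ hΔ

theorem AlgF.of_rename {Γ' Δ' : Env S} {κ' : Canon S} {A : FAnnot S} {t : Ty S} :
    AlgF Γ' Δ' κ' A t → ∀ (Γ Δ : Env S) (f g : ℕ → ℕ) (κ : Canon S), κ.rename f g = κ' →
      (∀ n, Γ' (f n) = Γ n) → (∀ x, Δ' (g x) = Δ x) → AlgF Γ Δ κ A t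
  | .var h => by
    intro Γ Δ f g κ hκ hΓ hΔ
    cases κ <;> simp only [Canon.rename, reduceCtorEq, Canon.bvar.injEq] at hκ
    subst hκ
    exact .var (hΔ _ ▸ h)
  | .bind₁ h => by
    intro Γ Δ f g κ hκ hΓ hΔ
    cases κ <;> simp only [Canon.rename, reduceCtorEq, Canon.bind.injEq] at hκ
    refine .bind₁ (h.of_rename _ _ _ _ _ hκ.2 hΓ ?_)
    rintro (_ | x)
    · rfl
    · exact hΔ x
  | .bind₂ hm h h' => by
    intro Γ Δ f g κ hκ hΓ hΔ
    cases κ <;> simp only [Canon.rename, reduceCtorEq, Canon.bind.injEq] at hκ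
    refine .bind₂ hm (h.of_rename _ _ _ _ _ hκ.1 hΓ hΔ) fun i => (h' i).of_rename _ _ _ _ _ hκ.2 hΓ ?_
    rintro (_ | x)
    · rfl
    · exact hΔ x
  | .inter hn h => fun _ _ _ _ _ hκ hΓ hΔ => .inter hn fun i => (h i).of_rename _ _ _ _ _ hκ hΓ hΔ
end

/-! ## Closed environments -/

namespace Ty

theorem Invariant.subst {t : Ty S} (h : t.Invariant) (τ : ℕ → Ty S) : (t.subst τ).Invariant :=
  fun σ d => by rw [mem_subst_subst, h, h]

theorem Invariant.arrow {s t : Ty S} (hs : s.Invariant) (ht : t.Invariant) :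
    (s.arrow t).Invariant := invariant_of_sub fun σ => by
  rw [subst_arrow]
  exact .arrow (fun d => (hs σ d).1) fun d => (ht σ d).2

theorem Invariant.prod {s t : Ty S} (hs : s.Invariant) (ht : t.Invariant) :
    (s.prod t).Invariant := invariant_of_sub fun σ => by
  rw [subst_prod]
  exact .prod (fun d => (hs σ d).2) fun d => (ht σ d).2

theorem Invariant.inter {s t : Ty S} (hs : s.Invariant) (ht : t.Invariant) :
    (s.inter t).Invariant := fun σ d => by
  rw [subst_inter, Dom.mem_inter, Dom.mem_inter, hs, ht]

theorem Invariant.bigInter {l : List (Ty S)} (h : ∀ t ∈ l, t.Invariant) :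
    (Ty.bigInter l).Invariant := fun σ d => by
  simp only [subst_bigInter, Dom.mem_bigInter, List.forall_mem_map]
  exact forall₂_congr fun t ht => h t ht σ d

theorem Invariant.bigUnion {l : List (Ty S)} (h : ∀ t ∈ l, t.Invariant) :
    (Ty.bigUnion l).Invariant := fun σ d => by
  simp only [subst_bigUnion, Dom.mem_bigUnion, List.mem_map, exists_exists_and_eq_and]
  exact exists_congr fun t => and_congr_right fun ht => h t ht σ d

theorem IsMono.invariant {t : Ty S} (h : t.IsMono) : t.Invariant := h.mem_subst

/-- Substitution turns `t ≤ s → r` into `t ≤ s → r σ`. Minimality gives `r ≤ r σ`, and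
`Ty.invariant_of_sub` does the rest. -/
theorem IsApply.invariant {t s r : Ty S} (h : IsApply t s r) (ht : t.Invariant)
    (hs : s.Invariant) : r.Invariant := invariant_of_sub fun σ => h.2 _ (by
  have h1 := h.1.subst σ
  rw [subst_arrow] at h1
  exact Sub.trans (fun d => (ht σ d).2) (h1.trans (.arrow (fun d => (hs σ d).2) (.refl _))))

theorem IsProj₁.invariant {t r : Ty S} (h : IsProj₁ t r) (ht : t.Invariant) : r.Invariant :=
  invariant_of_sub fun σ => h.2 _ (by
    have h1 := h.1.subst σ
    rw [subst_prod, subst_any] at h1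
    exact Sub.trans (fun d => (ht σ d).2) h1)

theorem IsProj₂.invariant {t r : Ty S} (h : IsProj₂ t r) (ht : t.Invariant) : r.Invariant :=
  invariant_of_sub fun σ => h.2 _ (by
    have h1 := h.1.subst σ
    rw [subst_prod, subst_any] at h1
    exact Sub.trans (fun d => (ht σ d).2) h1)

end Ty

theorem Env.invariant_cons {Γ : Env S} (h : ∀ n s, Γ n = some s → s.Invariant) {t : Ty S}
    (ht : t.Invariant) : ∀ n s, (Γ.cons t) n = some s → s.Invariant := by
  rintro (_ | n) s hs
  · cases hs; exact ht
  · exact h n s hs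

mutual
-- Annotations of abstractions and of cases are monomorphic, so without polymorphism in the
-- environment none arises in the result.
theorem AlgA.invariant {Γ Δ : Env S} {a : Atom S} {A : AAnnot S} {t : Ty S} :
    AlgA Γ Δ a A t → (∀ n s, Γ n = some s → s.Invariant) → (∀ x s, Δ x = some s → s.Invariant) →
      t.Invariant
  | .const => fun _ _ σ d => by rw [Ty.subst_basic]
  | .ax h => fun hΓ _ => hΓ _ _ h
  | @AlgA.arrowI _ _ _ _ _ _ m h => fun hΓ hΔ =>
    m.2.invariant.arrow (h.invariant (Env.invariant_cons hΓ m.2.invariant) hΔ)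
  | .arrowE h₁ h₂ _ _ _ h₃ => fun _ hΔ =>
    h₃.invariant ((hΔ _ _ h₁).inst _) ((hΔ _ _ h₂).inst _)
  | .prodI h₁ h₂ => fun _ hΔ => ((hΔ _ _ h₁).subst _).prod ((hΔ _ _ h₂).subst _)
  | .prodE₁ h _ h' => fun _ hΔ => h'.invariant ((hΔ _ _ h).inst _)
  | .prodE₂ h _ h' => fun _ hΔ => h'.invariant ((hΔ _ _ h).inst _)
  | .caseEmpty _ _ => fun _ _ σ d => by rw [Ty.subst_empty]
  | .case₁ _ _ h => fun _ hΔ => hΔ _ _ h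
  | .case₂ _ _ h => fun _ hΔ => hΔ _ _ h
  | .inter _ h => fun hΓ hΔ => Ty.Invariant.bigInter fun t ht => by
    obtain ⟨i, rfl⟩ := (List.mem_ofFn' _ _).1 ht
    exact (h i).invariant hΓ hΔ

theorem AlgF.invariant {Γ Δ : Env S} {κ : Canon S} {A : FAnnot S} {t : Ty S} :
    AlgF Γ Δ κ A t → (∀ n s, Γ n = some s → s.Invariant) → (∀ x s, Δ x = some s → s.Invariant) →
      t.Invariant
  | .var h => fun _ hΔ => (hΔ _ _ h).subst _
  | .bind₁ h => fun hΓ hΔ => h.invariant hΓ (by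
      rintro (_ | x) s hs
      · cases hs
      · exact hΔ x s hs)
  | @AlgF.bind₂ _ _ _ _ _ _ _ _ m _ _ _ h h' => fun hΓ hΔ => Ty.Invariant.bigUnion fun t ht => by
    obtain ⟨i, rfl⟩ := (List.mem_ofFn' _ _).1 ht
    exact (h' i).invariant hΓ
      (Env.invariant_cons hΔ ((h.invariant hΓ hΔ).inter (m i).2.invariant))
  | .inter _ h => fun hΓ hΔ => Ty.Invariant.bigInter fun t ht => by
    obtain ⟨i, rfl⟩ := (List.mem_ofFn' _ _).1 ht
    exact (h i).invariant hΓ hΔ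
end

/-! ## Saturated assignments of sets of types -/

/-- Closed under polymorphic supertypes and intersections. -/
structure TyFilter (F : Set (Ty S)) : Prop where
  up : ∀ {s t}, s ∈ F → s.PolySub t → t ∈ F
  inter : ∀ {s t}, s ∈ F → t ∈ F → s.inter t ∈ F

/-- The types of the environment are taken from `V`. -/
def Env.In (Δ : Env S) (V : ℕ → Set (Ty S)) : Prop := ∀ x s, Δ x = some s → s ∈ V x

/-- Intersect pointwise. By monotonicity, one environment can then serve several derivations at
once. -/
theorem Env.In.exists_le {Δ₁ Δ₂ : Env S} {V : ℕ → Set (Ty S)} (hV : ∀ x, TyFilter (V x))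
    (h₁ : Δ₁.In V) (h₂ : Δ₂.In V) : ∃ Δ : Env S, Δ.In V ∧ Δ.Le Δ₁ ∧ Δ.Le Δ₂ := by
  refine ⟨fun x => match Δ₁ x, Δ₂ x with
    | some s, some t => some (s.inter t)
    | some s, none => some s
    | none, r => r, fun x s hs => ?_, fun x s hs => ?_, fun x s hs => ?_⟩
  · dsimp only at hs
    split at hs
    · rename_i s₁ s₂ e₁ e₂
      cases hs
      exact (hV x).inter (h₁ x _ e₁) (h₂ x _ e₂)
    · rename_i s₁ e₁ e₂
      cases hs
      exact h₁ x _ e₁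
    · exact h₂ x s hs
  · simp only [hs]
    split
    · rename_i s₁ s₂ e₁ e₂
      cases e₁
      exact ⟨_, rfl, (Ty.inter_sub_left _ _).polySub⟩
    · rename_i s₁ e₁ e₂
      cases e₁
      exact ⟨_, rfl, .refl _⟩
    · rename_i e₁
      cases e₁
  · simp only [hs]
    split
    · rename_i s₁ s₂ e₁ e₂
      cases e₂
      exact ⟨_, rfl, (Ty.inter_sub_right _ _).polySub⟩
    · rename_i s₁ e₁ e₂
      cases e₂
    · exact ⟨_, rfl, .refl _⟩

/-- The rules with two premises need both types from a single environment. If the two variables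
coincide, the intersection of the types serves for both. -/
theorem Env.In.exists_two {V : ℕ → Set (Ty S)} (hV : ∀ x, TyFilter (V x)) {x y : ℕ} {s t : Ty S}
    (hs : s ∈ V x) (ht : t ∈ V y) : ∃ Δ : Env S, Δ.In V ∧ (∃ s', Δ x = some s' ∧ s'.Sub s) ∧
      ∃ t', Δ y = some t' ∧ t'.Sub t := by
  by_cases hxy : x = y
  · subst hxy
    refine ⟨fun z => if z = x then some (s.inter t) else none, fun z r hr => ?_,
      ⟨_, if_pos rfl, Ty.inter_sub_left _ _⟩, ⟨_, if_pos rfl, Ty.inter_sub_right _ _⟩⟩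
    dsimp only at hr
    split at hr
    · subst z; cases hr; exact (hV x).inter hs ht
    · cases hr
  · refine ⟨fun z => if z = x then some s else if z = y then some t else none, fun z r hr => ?_,
      ⟨s, if_pos rfl, .refl _⟩, ⟨t, by simp [Ne.symm hxy], .refl _⟩⟩
    dsimp only at hr
    split at hr
    · subst z; cases hr; exact hs
    · split at hr
      · subst z; cases hr; exact ht
      · cases hr

/-- Typability of an atom with types taken from `V`. -/
def HasAIn (Γ : Env S) (V : ℕ → Set (Ty S)) (a : Atom S) (s : Ty S) : Prop :=
  ∃ Δ : Env S, Δ.In V ∧ HasA Γ Δ a s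

/-- Typability of a form with types taken from `V`. -/
def HasFIn (Γ : Env S) (V : ℕ → Set (Ty S)) (κ : Canon S) (t : Ty S) : Prop :=
  ∃ Δ : Env S, Δ.In V ∧ HasF Γ Δ κ t

theorem HasAIn.of_weaken {Γ : Env S} {F : Set (Ty S)} {V : ℕ → Set (Ty S)} {a : Atom S} {s : Ty S}
    (h : HasAIn Γ (scons F V) (a.shift 0 1) s) : HasAIn Γ V a s := by
  obtain ⟨Δ, h1, A, s', h2, h3⟩ := h
  exact ⟨fun x => Δ (x + 1), fun x s hs => h1 (x + 1) s hs, A, s',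
    h2.of_rename Γ _ _ _ a rfl (fun _ => rfl) (fun _ => rfl), h3⟩

theorem HasAIn.of_weaken_lam {Γ : Env S} {t : Ty S} {V : ℕ → Set (Ty S)} {a : Atom S} {s : Ty S}
    (h : HasAIn (Γ.cons t) V (a.shift 1 0) s) : HasAIn Γ V a s := by
  obtain ⟨Δ, h1, A, s', h2, h3⟩ := h
  exact ⟨Δ, h1, A, s', h2.of_rename Γ _ _ _ a rfl (fun _ => rfl) (fun _ => rfl), h3⟩

/-- A set of types for every binding variable `x < b`, standing for the expression `ρ x`, that
decides all monomorphic types and contains all types that are derivable for the expression. -/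
structure World (Γ : Env S) (b : ℕ) (ρ : ℕ → Expr S) (V : ℕ → Set (Ty S)) : Prop where
  ctx : Ctx (fun _ => False) b ρ
  filter : ∀ x, TyFilter (V x)
  prime : ∀ x, (V x).Nonempty → ∀ m : MonoTy S, m.1 ∈ V x ∨ m.1.neg ∈ V x
  sat : ∀ x < b, ∃ a : Atom S, a.Good b ρ ∧ a.unwind ρ = ρ x ∧ ∀ s, HasAIn Γ V a s → s ∈ V x

theorem Ctx.weaken {P Q : Expr S → Prop} {b : ℕ} {ρ : ℕ → Expr S} (h : Ctx P b ρ)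
    (hQ : ∀ s, Q s → P s) : Ctx Q b ρ :=
  ⟨h.inj, h.closed, fun x hx hq => h.not_mem x hx (hQ _ hq)⟩

theorem World.lam {Γ : Env S} {b : ℕ} {ρ : ℕ → Expr S} {V : ℕ → Set (Ty S)}
    (h : World Γ b ρ V) (t : Ty S) : World (Γ.cons t) b (fun x => (ρ x).shift) V where
  ctx := h.ctx.lam.weaken fun _ => False.elim
  filter := h.filter
  prime := h.prime
  sat x hx := by
    obtain ⟨a, h1, h2, h3⟩ := h.sat x hx
    exact ⟨a.shift 1 0, a.good_weaken_lam_iff.2 h1, by rw [Atom.unwind_weaken_lam, h2],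
      fun s hs => h3 s hs.of_weaken_lam⟩

theorem World.cons {Γ : Env S} {b : ℕ} {ρ : ℕ → Expr S} {V : ℕ → Set (Ty S)}
    (h : World Γ b ρ V) {P : Expr S → Prop} (hρ : Ctx P b ρ) {a : Atom S} (ha : a.Good b ρ)
    (hP : P (a.unwind ρ)) {F : Set (Ty S)} (hF : TyFilter F)
    (hF' : F.Nonempty → ∀ m : MonoTy S, m.1 ∈ F ∨ m.1.neg ∈ F) (hs : ∀ s, HasAIn Γ V a s → s ∈ F) :
    World Γ (b + 1) (scons (a.unwind ρ) ρ) (scons F V) where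
  ctx := (hρ.cons hP (ha.Sb_unwind hρ)).weaken fun _ => False.elim
  filter := by
    rintro (_ | x)
    · exact hF
    · exact h.filter x
  prime := by
    rintro (_ | x)
    · exact hF'
    · exact h.prime x
  sat := by
    rintro (_ | x) hx
    · exact ⟨a.shift 0 1, a.good_weaken_iff.2 ha, a.unwind_weaken _ _,
        fun s h => hs s h.of_weaken⟩
    · obtain ⟨α, h1, h2, h3⟩ := h.sat x (by omega)
      exact ⟨α.shift 0 1, α.good_weaken_iff.2 h1, (α.unwind_weaken _ _).trans h2,
        fun s h => h3 s h.of_weaken⟩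

/-- The elements of a monomorphic type. -/
def MonoTy.elems (m : MonoTy S) : Set (Dom S) := {d | d.Mem m.1}

/-- If a binding cannot be typed by cases, then there is an ultrafilter of monomorphic types for
which the case fails. -/
theorem exists_ultrafilter_of_not_hasFIn {Γ : Env S} {V : ℕ → Set (Ty S)}
    (hV : ∀ x, TyFilter (V x)) {a : Atom S} {κ : Canon S} {t s₀ : Ty S} (hs₀ : HasAIn Γ V a s₀)
    (ht : ¬ HasFIn Γ V (.bind a κ) t) : ∃ U : Ultrafilter (Dom S), ∀ m : MonoTy S, m.elems ∈ U →
      ∀ (Δ : Env S) (s : Ty S), Δ.In V → HasA Γ Δ a s → ¬ HasF Γ (Δ.cons (.inter s m.1)) κ t := by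
  let J : Set (MonoTy S) := {m | ∃ (Δ : Env S) (s : Ty S), Δ.In V ∧ HasA Γ Δ a s ∧
    HasF Γ (Δ.cons (.inter s m.1)) κ t}
  -- Finitely many typable cases are brought to one environment and one type of the atom, by a
  -- common lower environment and an intersection of types.
  have key : ∀ ms : List (MonoTy S), (∀ m ∈ ms, m ∈ J) → ∃ (Δ : Env S) (A : AAnnot S) (s : Ty S),
      Δ.In V ∧ AlgA Γ Δ a A s ∧ ∀ m ∈ ms, HasF Γ (Δ.cons (.inter s m.1)) κ t := by
    intro ms
    induction ms with
    | nil =>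
      intro _
      obtain ⟨Δ, h1, A, s, h2, -⟩ := hs₀
      exact ⟨Δ, A, s, h1, h2, by simp⟩
    | cons m ms ih =>
      intro h
      obtain ⟨Δ₁, s₁, g1, g2, g3⟩ := h m (by simp)
      obtain ⟨Δ₂, A₂, s₂, g4, g5, g6⟩ := ih fun m hm => h m (List.mem_cons_of_mem _ hm)
      obtain ⟨Δ, g7, g8, g9⟩ := g1.exists_le hV g4
      obtain ⟨A, s, g10, g11⟩ := (g2.anti g8).inter (HasA.anti (⟨_, _, g5, .refl _⟩ : HasA Γ Δ₂ a s₂) g9)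
      refine ⟨Δ, A, s, g7, g10, fun m' hm' => ?_⟩
      rcases List.mem_cons.1 hm' with rfl | hm'
      · exact g3.anti (g8.cons ((g11.trans_sub (Ty.inter_sub_left _ _)).inter_mono _))
      · exact (g6 m' hm').anti (g9.cons ((g11.trans_sub (Ty.inter_sub_right _ _)).inter_mono _))
  -- If finitely many types in `J` covered the domain, they would be the cases of a `keep`
  -- annotation for the form. So the complements have the finite intersection property.
  obtain ⟨U, hU⟩ := Ultrafilter.exists_ultrafilter_of_finite_inter_nonempty
    ((fun m : MonoTy S => m.elemsᶜ) '' J) (by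
      classical
      intro T hT
      obtain ⟨J', hJ, rfl⟩ := Finset.subset_set_image_iff.1 hT
      by_contra hne
      rw [Set.not_nonempty_iff_eq_empty, Set.eq_empty_iff_forall_notMem] at hne
      obtain ⟨Δ, A, s, h1, h2, h3⟩ := key J'.toList fun m hm => hJ (by simpa using hm)
      refine ht ⟨Δ, h1, HasF.bind (n := J'.toList.length) (m := J'.toList.get)
        ⟨Ty.sub_any _, fun d _ => ?_⟩ h2 fun i => h3 _ (List.get_mem _ _)⟩
      have hd := hne d
      simp only [Set.mem_sInter, Finset.coe_image, Set.mem_image, Finset.mem_coe] at hd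
      push Not at hd
      obtain ⟨_, ⟨m, hm, rfl⟩, hd⟩ := hd
      rw [Set.notMem_compl_iff] at hd
      obtain ⟨i, hi⟩ := List.get_of_mem (Finset.mem_toList.2 hm)
      exact (Dom.mem_bigUnion _ _).2 ⟨m.1, (List.mem_ofFn' _ _).2 ⟨i, by rw [← hi]⟩, hd⟩)
  refine ⟨U, fun m hm Δ s h1 h2 h3 => ?_⟩
  have h4 : m.elemsᶜ ∈ U := hU ⟨m, ⟨Δ, s, h1, h2, h3⟩, rfl⟩
  exact Ultrafilter.compl_mem_iff_notMem.1 h4 hm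

/-- A form that cannot be typed has a saturated assignment that refutes the type. -/
theorem exists_world_of_not_hasFIn {Γ : Env S} {t : Ty S} : ∀ (κ : Canon S) (P : Expr S → Prop)
    (b : ℕ) (ρ : ℕ → Expr S) (V : ℕ → Set (Ty S)), World Γ b ρ V → Ctx P b ρ → κ.Good P b ρ →
    ¬ HasFIn Γ V κ t → ∃ (b' : ℕ) (ρ' : ℕ → Expr S) (V' : ℕ → Set (Ty S)), World Γ b' ρ' V' ∧
      (∃ y < b', ρ' y = κ.unwind ρ ∧ t ∉ V' y) ∧
      ∀ x < b', (∃ x₀ < b, ρ' x = ρ x₀ ∧ V' x = V x₀) ∨ P (ρ' x)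
  | .bvar x, P, b, ρ, V, hw, _, hg, ht => by
    refine ⟨b, ρ, V, hw, ⟨x, hg, rfl, fun h => ht ?_⟩, fun y hy => Or.inl ⟨y, hy, rfl, rfl⟩⟩
    obtain ⟨Δ, h1, ⟨s, h2, h3⟩, -⟩ := Env.In.exists_two hw.filter h h
    exact ⟨Δ, h1, _, _, .var (ρ := ⟨id, fun _ _ h => h⟩) h2,
      (Ty.rename_polySub s (fun _ _ h => h)).trans_sub h3⟩
  | .bind a κ, P, b, ρ, V, hw, hρ, hg, ht => by
    have hext : ∃ F : Set (Ty S), TyFilter F ∧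
        (F.Nonempty → ∀ m : MonoTy S, m.1 ∈ F ∨ m.1.neg ∈ F) ∧ (∀ s, HasAIn Γ V a s → s ∈ F) ∧
        ¬ HasFIn Γ (scons F V) κ t := by
      by_cases hs₀ : ∃ s₀, HasAIn Γ V a s₀
      · obtain ⟨s₀, hs₀⟩ := hs₀
        obtain ⟨U, hU⟩ := exists_ultrafilter_of_not_hasFIn hw.filter hs₀ ht
        have hmem : ∀ {s : Ty S} {m : MonoTy S} {r : Ty S}, HasAIn Γ V a s → m.elems ∈ U →
            (s.inter m.1).PolySub r → r ∈ {r | ∃ (s : Ty S) (m : MonoTy S), HasAIn Γ V a s ∧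
              m.elems ∈ U ∧ (s.inter m.1).PolySub r} := fun h1 h2 h3 => ⟨_, _, h1, h2, h3⟩
        -- The closure under `⊑` of the intersections of types of the atom with the monomorphic
        -- types in the ultrafilter.
        refine ⟨{r | ∃ (s : Ty S) (m : MonoTy S), HasAIn Γ V a s ∧ m.elems ∈ U ∧
          (s.inter m.1).PolySub r}, ⟨?_, ?_⟩, fun _ m => ?_, fun s hs => ?_, ?_⟩
        · rintro s r ⟨s', m, h1, h2, h3⟩ hsr
          exact hmem h1 h2 (h3.trans hsr)
        · rintro r₁ r₂ ⟨s₁, m₁, ⟨Δ₁, g1, g2⟩, g3, g4⟩ ⟨s₂, m₂, ⟨Δ₂, g5, g6⟩, g7, g8⟩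
          obtain ⟨Δ, g9, g10, g11⟩ := g1.exists_le hw.filter g5
          refine hmem (s := s₁.inter s₂) (m := ⟨m₁.1.inter m₂.1, m₁.2.inter m₂.2⟩)
            ⟨Δ, g9, (g2.anti g10).inter (g6.anti g11)⟩ ?_ (.inter_right (.trans ?_ g4) (.trans ?_ g8))
          · filter_upwards [g3, g7] with d h1 h2
            exact (Dom.mem_inter _ _ _).2 ⟨h1, h2⟩
          · refine Ty.Sub.polySub fun d hd => ?_
            simp only [Dom.mem_inter] at hd ⊢
            exact ⟨hd.1.1, hd.2.1⟩
          · refine Ty.Sub.polySub fun d hd => ?_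
            simp only [Dom.mem_inter] at hd ⊢
            exact ⟨hd.1.2, hd.2.2⟩
        · rcases U.mem_or_compl_mem m.elems with h | h
          · exact Or.inl (hmem hs₀ h (Ty.inter_sub_right _ _).polySub)
          · refine Or.inr (hmem (m := ⟨m.1.neg, m.2.neg⟩) hs₀ ?_ (Ty.inter_sub_right _ _).polySub)
            filter_upwards [h] with d hd
            exact (Dom.mem_neg _ _).2 hd
        · refine hmem (m := ⟨Ty.empty.neg, Ty.IsMono.neg ?_⟩) hs ?_ (Ty.inter_sub_left _ _).polySub
          · rw [Ty.isMono_iff, Ty.vars_empty]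
          · filter_upwards with d
            exact Dom.mem_any d
        · rintro ⟨Δ', h1, h2⟩
          -- A typing of the continuation that ignores the new binding gives a `skip` annotation.
          -- One that uses it at `r` can be strengthened to some `s ∧ m` with `m` in the
          -- ultrafilter, which was chosen to prevent this.
          cases h0 : Δ' 0 with
          | none =>
            have he : Δ' = Env.skip fun x => Δ' (x + 1) := by
              funext x
              cases x with
              | zero => exact h0
              | succ x => rfl
            rw [he] at h2
            obtain ⟨A, t', h3, h4⟩ := h2
            exact ht ⟨_, fun x s hs => h1 (x + 1) s hs, _, _, .bind₁ h3, h4⟩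
          | some r =>
            obtain ⟨s, m, ⟨Δ, h5, h6⟩, h7, h8⟩ := h1 0 r h0
            obtain ⟨Δ₁, g1, g2, g3⟩ := Env.In.exists_le hw.filter h5
              (fun x s hs => h1 (x + 1) s hs : Env.In (fun x => Δ' (x + 1)) V)
            refine hU m h7 Δ₁ s g1 (h6.anti g2) (h2.anti ?_)
            rintro (_ | x) s' hs'
            · rw [h0] at hs'
              cases hs'
              exact ⟨_, rfl, h8⟩
            · exact g3 x s' hs'
      -- An atom without any type gets the empty set; typing the continuation then amounts to
      -- skipping the binding.
      · refine ⟨∅, ⟨fun h => h.elim, fun h => h.elim⟩, fun h => absurd h (by simp),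
          fun s hs => absurd ⟨s, hs⟩ hs₀, ?_⟩
        rintro ⟨Δ', h1, h2⟩
        have he : Δ' = Env.skip fun x => Δ' (x + 1) := by
          funext x
          cases x with
          | zero =>
            cases h0 : Δ' 0 with
            | none => rfl
            | some s => exact (h1 0 s h0).elim
          | succ x => rfl
        rw [he] at h2
        obtain ⟨A, t', h3, h4⟩ := h2
        exact ht ⟨_, fun x s hs => h1 (x + 1) s hs, _, _, .bind₁ h3, h4⟩
    obtain ⟨F, hF, hF', hs, hnot⟩ := hext
    obtain ⟨b', ρ', V', h1, h2, h3⟩ := exists_world_of_not_hasFIn κ _ _ _ _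
      (hw.cons hρ hg.1 hg.2.1 hF hF' hs) (Canon.Good.ctx hρ hg) hg.2.2.2 hnot
    refine ⟨b', ρ', V', h1, h2, fun x hx => ?_⟩
    rcases h3 x hx with ⟨_ | x₀, hx₀, h4, h5⟩ | h4
    · exact Or.inr (h4.symm ▸ hg.2.1)
    · exact Or.inl ⟨x₀, by omega, h4, h5⟩
    · exact Or.inr h4.1

/-! ## Completeness -/

theorem World.mem_of_var {Γ : Env S} {b : ℕ} {ρ : ℕ → Expr S} {V : ℕ → Set (Ty S)}
    (hw : World Γ b ρ V) {n : ℕ} {t : Ty S} (hn : Γ n = some t) {x : ℕ} (hx : x < b)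
    (h : ρ x = .var n) : t ∈ V x := by
  obtain ⟨a, -, h2, h3⟩ := hw.sat x hx
  rw [h] at h2
  cases a <;> simp only [Atom.unwind, reduceCtorEq, Expr.var.injEq] at h2
  subst h2
  exact h3 _ ⟨Env.nil, (fun _ _ h => by cases h), _, _, .ax hn, .refl _⟩

/-- The declarative system is sound for saturated assignments. -/
theorem World.mem_of_decl {Γ' : Env S} {e : Expr S} {t : Ty S} (h : Decl Γ' e t) :
    ∀ {Γ : Env S} {b : ℕ} {ρ : ℕ → Expr S} {V : ℕ → Set (Ty S)} (θ : ℕ → Expr S),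
    World Γ b ρ V → (∀ n s, Γ' n = some s → ∀ x < b, ρ x = θ n → s ∈ V x) →
    ∀ x < b, ρ x = e.subst θ → t ∈ V x := by
  -- The sets of a world are closed under instances, so the annotations chosen below need only the
  -- identity substitution.
  have poly_inst : ∀ {s t : Ty S}, s.Sub t → (s.inst [Ty.poly]).Sub t := fun h =>
    (Ty.inst_poly_sub _).trans h
  induction h with
  | const =>
    intro Γ b ρ V θ hw _ x hx h
    obtain ⟨a, -, h2, h3⟩ := hw.sat x hx
    rw [h] at h2
    cases a <;> simp only [Atom.unwind, Expr.subst, reduceCtorEq, Expr.const.injEq] at h2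
    subst h2
    exact h3 _ ⟨Env.nil, (fun _ _ h => by cases h), _, _, .const, .refl _⟩
  | ax hn =>
    intro Γ b ρ V θ hw hΓ x hx h
    exact hΓ _ _ hn x hx h
  | @arrowI Γ' e t m _ ih =>
    intro Γ b ρ V θ hw hΓ x hx h
    obtain ⟨a, h1, h2, h3⟩ := hw.sat x hx
    rw [h] at h2
    cases a <;> simp only [Atom.unwind, Expr.subst, reduceCtorEq, Expr.lam.injEq] at h2
    rename_i κ
    -- Otherwise the body yields an extended world without `t`, against the induction hypothesis.
    -- Its variables are old ones with unchanged sets or stand for expressions containing the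
    -- abstracted variable; the latter cannot equal a weakened `θ n`.
    have hF : HasFIn (Γ.cons m.1) V κ t := by
      by_contra hc
      obtain ⟨b', ρ', V', hw', ⟨y, hy, hy1, hy2⟩, hext⟩ := exists_world_of_not_hasFIn κ _ b _ V
        (hw.lam m.1) hw.ctx.lam h1 hc
      refine hy2 (ih _ hw' ?_ y hy (hy1.trans h2))
      rintro (_ | n) s hs x' hx' he
      · cases hs
        exact hw'.mem_of_var (n := 0) rfl hx' he
      · rcases hext x' hx' with ⟨x₀, hx₀, h4, h5⟩ | h4
        · rw [h5]
          exact hΓ n s hs x₀ hx₀ (Expr.shift_injective (h4.symm.trans he))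
        · rw [he] at h4
          exact absurd h4 (Expr.zero_notMem_FV_shift _)
    obtain ⟨Δ, g1, g2⟩ := hF
    exact h3 _ ⟨Δ, g1, .lam g2⟩
  | arrowE _ _ ih₁ ih₂ =>
    intro Γ b ρ V θ hw hΓ x hx h
    obtain ⟨a, h1, h2, h3⟩ := hw.sat x hx
    rw [h] at h2
    cases a <;> simp only [Atom.unwind, Expr.subst, reduceCtorEq, Expr.app.injEq] at h2
    obtain ⟨Δ, g1, ⟨s₁, g2, g3⟩, s₂, g4, g5⟩ := Env.In.exists_two hw.filter
      (ih₁ θ hw hΓ _ h1.1 h2.1) (ih₂ θ hw hΓ _ h1.2 h2.2)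
    exact h3 _ ⟨Δ, g1, .app g2 g4 (poly_inst (g3.trans (.arrow (poly_inst g5) (.refl _))))⟩
  | prodI _ _ ih₁ ih₂ =>
    intro Γ b ρ V θ hw hΓ x hx h
    obtain ⟨a, h1, h2, h3⟩ := hw.sat x hx
    rw [h] at h2
    cases a <;> simp only [Atom.unwind, Expr.subst, reduceCtorEq, Expr.pair.injEq] at h2
    obtain ⟨Δ, g1, ⟨s₁, g2, g3⟩, s₂, g4, g5⟩ := Env.In.exists_two hw.filter
      (ih₁ θ hw hΓ _ h1.1 h2.1) (ih₂ θ hw hΓ _ h1.2 h2.2)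
    exact h3 _ ⟨Δ, g1, .pair g2 g4 g3.polySub g5.polySub⟩
  | prodE₁ _ ih =>
    intro Γ b ρ V θ hw hΓ x hx h
    obtain ⟨a, h1, h2, h3⟩ := hw.sat x hx
    rw [h] at h2
    cases a <;> simp only [Atom.unwind, Expr.subst, reduceCtorEq, Expr.proj₁.injEq] at h2
    have h4 := ih θ hw hΓ _ h1 h2
    obtain ⟨Δ, g1, ⟨s₁, g2, g3⟩, -⟩ := Env.In.exists_two hw.filter h4 h4
    exact h3 _ ⟨Δ, g1, .proj₁ g2 (poly_inst g3)⟩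
  | prodE₂ _ ih =>
    intro Γ b ρ V θ hw hΓ x hx h
    obtain ⟨a, h1, h2, h3⟩ := hw.sat x hx
    rw [h] at h2
    cases a <;> simp only [Atom.unwind, Expr.subst, reduceCtorEq, Expr.proj₂.injEq] at h2
    have h4 := ih θ hw hΓ _ h1 h2
    obtain ⟨Δ, g1, ⟨s₁, g2, g3⟩, -⟩ := Env.In.exists_two hw.filter h4 h4
    exact h3 _ ⟨Δ, g1, .proj₂ g2 (poly_inst g3)⟩
  | caseEmpty _ ih =>
    intro Γ b ρ V θ hw hΓ x hx h
    obtain ⟨a, h1, h2, h3⟩ := hw.sat x hx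
    rw [h] at h2
    cases a <;> simp only [Atom.unwind, Expr.subst, reduceCtorEq, Expr.tcase.injEq] at h2
    have h4 := ih θ hw hΓ _ h1.1 h2.1
    obtain ⟨Δ, g1, ⟨s₁, g2, g3⟩, -⟩ := Env.In.exists_two hw.filter h4 h4
    exact h3 _ ⟨Δ, g1, _, _, .caseEmpty g2 ⟨poly_inst g3, Ty.empty_sub _⟩, .refl _⟩
  | case₁ _ _ ih₁ ih₂ =>
    intro Γ b ρ V θ hw hΓ x hx h
    obtain ⟨a, h1, h2, h3⟩ := hw.sat x hx
    rw [h] at h2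
    cases a <;> simp only [Atom.unwind, Expr.subst, reduceCtorEq, Expr.tcase.injEq] at h2
    obtain ⟨h2, rfl, h2', -⟩ := h2
    obtain ⟨Δ, g1, ⟨s₁, g2, g3⟩, s₂, g4, g5⟩ := Env.In.exists_two hw.filter
      (ih₁ θ hw hΓ _ h1.1 h2) (ih₂ θ hw hΓ _ h1.2.1 h2')
    exact h3 _ ⟨Δ, g1, _, _, .case₁ g2 (poly_inst g3) g4, g5.polySub⟩
  | case₂ _ _ ih₁ ih₂ =>
    intro Γ b ρ V θ hw hΓ x hx h
    obtain ⟨a, h1, h2, h3⟩ := hw.sat x hx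
    rw [h] at h2
    cases a <;> simp only [Atom.unwind, Expr.subst, reduceCtorEq, Expr.tcase.injEq] at h2
    obtain ⟨h2, rfl, -, h2'⟩ := h2
    obtain ⟨Δ, g1, ⟨s₁, g2, g3⟩, s₂, g4, g5⟩ := Env.In.exists_two hw.filter
      (ih₁ θ hw hΓ _ h1.1 h2) (ih₂ θ hw hΓ _ h1.2.2 h2')
    exact h3 _ ⟨Δ, g1, _, _, .case₂ g2 (poly_inst g3) g4, g5.polySub⟩
  | @union Γ' e e' s t m _ _ _ ih₁ ih₂ ih₃ =>
    intro Γ b ρ V θ hw hΓ x hx h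
    rw [Expr.inst_subst] at h
    have key : ∀ r : Ty S, (∀ y < b, ρ y = e'.subst θ → r ∈ V y) →
        ∀ n q, (Γ'.cons r) n = some q → ∀ y < b, ρ y = scons (e'.subst θ) θ n → q ∈ V y := by
      rintro r hr (_ | n) q hq y hy he
      · cases hq
        exact hr y hy he
      · exact hΓ n q hq y hy he
    -- If a variable stands for `e'`, its set decides `m` and selects a branch. That variable is
    -- unique, so the branch is right for all occurrences. If there is none, the assumption on the
    -- new variable is vacuous and either branch will do.
    by_cases hin : ∃ y < b, ρ y = e'.subst θ
    · obtain ⟨y, hy, he⟩ := hin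
      have hs := ih₁ θ hw hΓ y hy he
      rcases hw.prime y ⟨s, hs⟩ m with hm | hm
      · refine ih₂ _ hw (key _ fun z hz hze => ?_) x hx h
        rw [hw.ctx.inj z hz y hy (hze.trans he.symm)]
        exact (hw.filter y).inter hs hm
      · refine ih₃ _ hw (key _ fun z hz hze => ?_) x hx h
        rw [hw.ctx.inj z hz y hy (hze.trans he.symm)]
        exact (hw.filter y).inter hs hm
    · exact ih₂ _ hw (key _ fun z hz hze => absurd ⟨z, hz, hze⟩ hin) x hx h
  | inter _ _ ih₁ ih₂ =>
    intro Γ b ρ V θ hw hΓ x hx h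
    exact (hw.filter x).inter (ih₁ θ hw hΓ x hx h) (ih₂ θ hw hΓ x hx h)
  | inst σ _ ih =>
    intro Γ b ρ V θ hw hΓ x hx h
    exact (hw.filter x).up (ih θ hw hΓ x hx h) (Ty.polySub_subst _ _)
  | sub _ hs ih =>
    intro Γ b ρ V θ hw hΓ x hx h
    exact (hw.filter x).up (ih θ hw hΓ x hx h) hs.polySub

/-- The countermodel construction starts from the world without binding variables. The only
environment with types from empty sets is the empty one. -/
theorem Canon.IsMSCOf.hasF {κ : Canon S} {e : Expr S} (hκ : κ.IsMSCOf e) {Γ : Env S} {t : Ty S}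
    (h : Decl Γ e t) : HasF Γ Env.nil κ t := by
  obtain ⟨hg, rfl⟩ := Canon.isMSCOf_iff.1 hκ
  have hw : World Γ 0 Expr.var fun _ => (∅ : Set (Ty S)) :=
    ⟨ctx_zero _ _, fun _ => ⟨fun h => h.elim, fun h => h.elim⟩, fun _ h => absurd h (by simp),
      fun x hx => by omega⟩
  have hF : HasFIn Γ (fun _ => ∅) κ t := by
    by_contra hc
    obtain ⟨b, ρ, V, hw', ⟨y, hy, hy1, hy2⟩, -⟩ :=
      exists_world_of_not_hasFIn κ _ 0 _ _ hw (ctx_zero _ _) hg hc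
    refine hy2 (World.mem_of_decl h Expr.var hw'
      (fun n s hn x hx hxn => hw'.mem_of_var hn hx hxn) y hy ?_)
    rw [hy1, Expr.subst_var]
  obtain ⟨Δ, h1, h2⟩ := hF
  have : Δ = Env.nil := by
    funext x
    cases hx : Δ x with
    | none => rfl
    | some s => exact (h1 x s hx).elim
  rwa [this] at h2

end MSC

-- Assembly of existence, uniqueness, completeness and soundness.

theorem mainTheorem2 (S : Signature) (e : Expr S) :
    (∃ κ : Canon S, κ.IsMSCOf e) ∧
    (∀ κ κ' : Canon S, κ.IsMSCOf e → κ'.IsMSCOf e → κ.EqCan κ') ∧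
    ∀ κ : Canon S, κ.IsMSCOf e →
      (∀ t : Ty S, Decl Env.nil e t →
        ∃ (A : FAnnot S) (t' : Ty S), AlgF Env.nil Env.nil κ A t' ∧ t'.Sub t) ∧
      (∀ (Γ : Env S) (t : Ty S), Decl Γ e t →
        ∃ (A : FAnnot S) (t' : Ty S), AlgF Γ Env.nil κ A t' ∧ t'.PolySub t) ∧
      (∀ (Γ : Env S) (A : FAnnot S) (t : Ty S), AlgF Γ Env.nil κ A t → Decl Γ e t) := by
  refine ⟨exists_isMSCOf e, fun κ κ' h h' => h.eqCan h', fun κ hκ =>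
    ⟨fun t ht => ?_, fun Γ t ht => hκ.hasF ht, fun Γ A t h => hκ.unwind_eq ▸ h.decl⟩⟩
  obtain ⟨A, t', h1, h2⟩ := hκ.hasF ht
  exact ⟨A, t', h1, (h1.invariant (fun _ _ h => by cases h)
    (fun _ _ h => by cases h)).sub_of_polySub h2⟩
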